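/- Write $\zeta_k=e^{2\pi i/k}$, $q=e^{2\pi i z}$ and $q^{r}=e^{2\pi i r z}$ for rational $r$, $(a;q)_n=\prod_{j=0}^{n-1}(1-aq^j)$, and let $\eta$ be the Dedekind eta function. Put $$\theta_1(z)=\frac{\eta(z)^2}{\eta(2z)},\qquad \theta_2(z)=\frac{\eta(z)^2}{\eta(z/2)},\qquad \theta_3(z)=\frac{\eta(z)^2}{\eta(z/2+1/2)},$$ and for $n\ge 0$ $$\theta_{1,n}=\frac{(q;q)_n}{(-q;q)_n},\qquad \theta_{2,n}=q^{1/16}\frac{(q;q)_n}{(q^{1/2};q)_{n+1}},\qquad \theta_{3,n}=\frac{\zeta_{16}}{\zeta_{12}}\,q^{1/16}\frac{(q;q)_n}{(-q^{1/2};q)_{n+1}}.$$ For $x\in\mathbb Q$ let $\phi_i(x)=\theta_i^S(e^{2\pi i x})=\sum_{n\ge0}\theta_{i,n}$ at $z=x$; it is defined on the set $D_i$ of those $x$ for which no denominator vanishes. Put $\phi=(\phi_1,\phi_2,\phi_3)^T$. For $x=a/b$ in lowest terms, $x\in D_1$ iff $b$ is odd, $x\in D_2$ iff $a$ is odd, $x\in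 D_3$ iff $ab$ is even; for $x\in D_i$ the series $\phi_i(x)$ converges. Moreover: (1) Let $$G_1=2\sum_{n\ge0}\frac{q^{2n+1}(q;q)_{2n}}{(1+q^{2n+1})(-q;q)_{2n}},\quad G_2=-q^{7/16}\sum_{n\ge0}\frac{q^{n/2}(q;q)_n}{(q^{1/2};q)_{n+1}},\quad G_3=\zeta_{48}^{-1}q^{7/16}\sum_{n\ge0}\frac{(-1)^nq^{n/2}(q;q)_n}{(-q^{1/2};q)_{n+1}}.$$ These series are well defined and convergent for $|q|<1$. If $x\in\mathbb Q$ and $-x\in D_i$, then $G_i$ is also well defined and convergent at $z=x$, and $\theta_i^S(q^{-1})=\phi_i(-x)$ equals its value there. (2) Let $$M_T=\begin{pmatrix}1&0&0\\0&0&\zeta_{12}\\0&\zeta_{24}&0\end{pmatrix},\qquad M_S=\begin{pmatrix}0&\sqrt2&0\\1/\sqrt2&0&0\\0&0&1\end{pmatrix},\qquad g_i(x)=\frac{i}{\pi(1+i)}\int_0^{i\infty}\frac{\theta_i(z)}{(z-x)^{3/2}}\,dz\quad(x\in\mathbb R),$$ the integral being taken along the imaginary axis, and all powers being principal. Then $\phi$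 is a weight $3/2$ vector-valued quantum modular form for $\mathrm{SL}_2(\mathbb Z)$: there are invertible matrices $\rho(\gamma)$, $\gamma\in\mathrm{SL}_2(\mathbb Z)$, multiplicative up to constants of modulus one, with $\rho(T)=M_T$, $\rho(S)=-M_S$, such that for every $\gamma=\begin{pmatrix}a&b\\c&d\end{pmatrix}$ the function $$h_\gamma(x)=j_\gamma(x)^{-1}\phi(\gamma x)-\rho(\gamma)\phi(x)\qquad(x\in\mathbb Q,\ cx+d\ne0)$$ extends off a finite set to a real-analytic function of $x\in\mathbb R$; here $j_\gamma(x)=1$ if $c=0$ and $j_\gamma(x)=\bigl(i\,\mathrm{sgn}(c)(cx+d)\bigr)^{3/2}$ otherwise. In particular, for $z\in\mathbb Q$, $$\phi(z+1)-M_T\,\phi(z)=0,$$ and, for $z\in\mathbb Q\setminus\{0\}$, $$\Bigl(\frac{z}{-i}\Bigr)^{-3/2}\phi(-1/z)+M_S\,\phi(z)=M_S\,g(z).$$ All vector identities are meant entry by entry, the $i$-th one at all points where the entry $\phi_i$ at the transformed point ($\gamma x$, $z+1$, $-1/z$) is defined; the entries of $\phi(x)$, resp. $\phi(z)$, that occur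 in it with non-zero coefficient are then defined as well. The integrals $g_i(x)$ converge absolutely for $x\ne0$, and $g_1(0),g_3(0)$ do too. Each $g_i$ is real-analytic on $\mathbb R\setminus\{0\}$; $g_1$ and $g_3$ are $C^\infty$ on $\mathbb R$, and $g_2(x)+\frac{i}{\pi x}$ extends to a $C^\infty$ function on $\mathbb R$. -/

import Mathlib

open scoped MatrixGroups

noncomputable section

namespace Strange

/-- `q ^ r` for `q = e ^ (2 π i z)`, read as `e ^ (2 π i r z)`. -/
def qpow (r z : ℂ) : ℂ := Complex.exp (2 * Real.pi * Complex.I * r * z)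

/-- The root of unity `ζ_k = e ^ (2 π i / k)`. -/
def zeta (k : ℕ) : ℂ := Complex.exp (2 * Real.pi * Complex.I / k)

/-- The finite `q`-Pochhammer symbol `(a; q)_n`. -/
def qPoch (a q : ℂ) (n : ℕ) : ℂ := ∏ j ∈ Finset.range n, (1 - a * q ^ j)

/-- The three eta-quotients `θ₁, θ₂, θ₃` (indexed by `0, 1, 2`). -/
def theta : Fin 3 → ℂ → ℂ
  | 0, z => ModularForm.eta z ^ 2 / ModularForm.eta (2 * z)
  | 1, z => ModularForm.eta z ^ 2 / ModularForm.eta (z / 2)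
  | 2, z => ModularForm.eta z ^ 2 / ModularForm.eta (z / 2 + 1 / 2)

/-- The denominator of the `n`-th finite product attached to `θᵢ`. -/
def strangeDen : Fin 3 → ℕ → ℂ → ℂ
  | 0, n, z => qPoch (-qpow 1 z) (qpow 1 z) n
  | 1, n, z => qPoch (qpow (1 / 2) z) (qpow 1 z) (n + 1)
  | 2, n, z => qPoch (-qpow (1 / 2) z) (qpow 1 z) (n + 1)

/-- The numerical factor and power of `q` in front of the finite products attached to `θᵢ`. -/
def strangePrefactor : Fin 3 → ℂ → ℂ
  | 0, _ => 1
  | 1, z => qpow (1 / 16) z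
  | 2, z => zeta 16 / zeta 12 * qpow (1 / 16) z

/-- The finite product `θ_{i,n}`, at `q = e ^ (2 π i z)`. -/
def strangeTerm (i : Fin 3) (n : ℕ) (z : ℂ) : ℂ :=
  strangePrefactor i z * (qPoch (qpow 1 z) (qpow 1 z) n / strangeDen i n z)

/-- The rationals `x` at which all the terms of the `i`-th strange series make sense, that is, at
which no denominator vanishes. -/
def domain (i : Fin 3) : Set ℚ := {x | ∀ n, strangeDen i n (x : ℂ) ≠ 0}

/-- The vector `φ(x)` of strange series at `q = e ^ (2 π i x)`; its `i`-th entry is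
meaningful for `x ∈ domain i`. -/
def phi (x : ℚ) (i : Fin 3) : ℂ := ∑' n, strangeTerm i n (x : ℂ)

/-- Numerators of the terms of the reflected series, in the variable `q` for `i = 0` and
`w = q ^ (1 / 2)` for `i = 1, 2`. -/
def reflNum : Fin 3 → ℕ → ℂ → ℂ
  | 0, n, q => 2 * q ^ (2 * n + 1) * qPoch q q (2 * n)
  | 1, n, w => -(w ^ n * qPoch (w ^ 2) (w ^ 2) n)
  | 2, n, w => (-w) ^ n * qPoch (w ^ 2) (w ^ 2) n

/-- Denominators of the terms of the reflected series. -/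
def reflDen : Fin 3 → ℕ → ℂ → ℂ
  | 0, n, q => (1 + q ^ (2 * n + 1)) * qPoch (-q) q (2 * n)
  | 1, n, w => qPoch w (w ^ 2) (n + 1)
  | 2, n, w => qPoch (-w) (w ^ 2) (n + 1)

/-- The variable of the `i`-th reflected series at `q = e ^ (2 π i z)`: `q`, `q ^ (1 / 2)`,
`q ^ (1 / 2)`. -/
def reflVar : Fin 3 → ℂ → ℂ
  | 0, z => qpow 1 z
  | 1, z => qpow (1 / 2) z
  | 2, z => qpow (1 / 2) z

/-- The factor in front of the `i`-th reflected series. -/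
def reflPrefactor : Fin 3 → ℂ → ℂ
  | 0, _ => 1
  | 1, z => qpow (7 / 16) z
  | 2, z => (zeta 48)⁻¹ * qpow (7 / 16) z

/-- The `q`-series `Gᵢ` at `q = e ^ (2 π i z)`. -/
def G (i : Fin 3) (z : ℂ) : ℂ :=
  reflPrefactor i z * ∑' n, reflNum i n (reflVar i z) / reflDen i n (reflVar i z)

/-- The matrix of the translation `z ↦ z + 1`. -/
def matT : Matrix (Fin 3) (Fin 3) ℂ := !![1, 0, 0; 0, 0, zeta 12; 0, zeta 24, 0]

/-- The matrix of the inversion `z ↦ -1 / z`. -/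
def matS : Matrix (Fin 3) (Fin 3) ℂ :=
  !![0, (Real.sqrt 2 : ℂ), 0; 1 / (Real.sqrt 2 : ℂ), 0, 0; 0, 0, 1]

/-- The integrand of the period integral `∫_0^{i∞} θᵢ(z) (z - x) ^ (-3/2) dz` on the imaginary
axis `z = i t`, with the principal branch of the power. -/
def periodIntegrand (i : Fin 3) (x t : ℝ) : ℂ :=
  theta i (Complex.I * t) / (Complex.I * t - x) ^ (3 / 2 : ℂ) * Complex.I

/-- The vector `g(x)` of period integrals. -/
def g (x : ℝ) (i : Fin 3) : ℂ :=
  Complex.I / (Real.pi * (1 + Complex.I)) * ∫ t in Set.Ioi (0 : ℝ), periodIntegrand i x t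

/-- The Möbius action `x ↦ (a x + b) / (c x + d)` on rationals with `c x + d ≠ 0`. -/
def mobius (γ : SL(2, ℤ)) (x : ℚ) : ℚ :=
  ((γ 0 0 : ℚ) * x + (γ 0 1 : ℚ)) / ((γ 1 0 : ℚ) * x + (γ 1 1 : ℚ))

/-- The factor of automorphy of weight `k`. Up to a constant of modulus one (which is part of the
multiplier) it is the boundary value of the holomorphic function `(c z + d) ^ k` on the lower half
plane: multiplying by `± i` turns `c z + d` into the right half plane, where the principal power is
continuous up to the boundary, except at `c z + d = 0`. -/
def autFactor (k : ℝ) (γ : SL(2, ℤ)) (x : ℚ) : ℂ :=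
  if γ 1 0 = 0 then 1
  else (Complex.I * ((γ 1 0).sign : ℂ) * ((γ 1 0 : ℂ) * (x : ℂ) + (γ 1 1 : ℂ))) ^ (k : ℂ)

/-- Vector-valued quantum modular forms of weight `k` for `SL(2, ℤ)` with multiplier `ρ`, for a
vector `φ` whose `i`-th entry is defined on the set `D i` of rationals. For every `γ` the
difference between the slashed vector and `ρ(γ) φ` is real analytic off a finite set; the `i`-th
transformation law is imposed at all `x` where its left-hand side is defined, and all entries
of `φ` that occur in it are then required to be defined. -/
structure IsVectorQuantumModularForm {ι : Type*} [Fintype ι] [DecidableEq ι] (k : ℝ)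
    (ρ : SL(2, ℤ) → Matrix ι ι ℂ) (D : ι → Set ℚ) (φ : ℚ → ι → ℂ) : Prop where
  isUnit_det : ∀ γ, IsUnit (ρ γ).det
  multiplier : ∀ γ₁ γ₂, ∃ c : ℂ, ‖c‖ = 1 ∧ ρ (γ₁ * γ₂) = c • (ρ γ₁ * ρ γ₂)
  quantum : ∀ γ : SL(2, ℤ), ∃ (E : Set ℝ) (h : ι → ℝ → ℂ), E.Finite ∧
    (∀ i, AnalyticOnNhd ℝ (h i) Eᶜ) ∧
    ∀ x : ℚ, (γ 1 0 : ℚ) * x + (γ 1 1 : ℚ) ≠ 0 → ∀ i, mobius γ x ∈ D i →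
      (∀ j, ρ γ i j ≠ 0 → x ∈ D j) ∧
      (autFactor k γ x)⁻¹ * φ (mobius γ x) i - (ρ γ).mulVec (φ x) i = h i (x : ℝ)

end Strange

end

open scoped MatrixGroups

noncomputable section

namespace Strange

open Complex Filter Topology MeasureTheory

/-! ### Roots of unity and the domains of the strange series -/

/-! Each `theta i` is a theta function of weight 1/2, and `phi` is, with one constant for all three
entries, its Eichler integral up the vertical line above the rational point: φᵢ(x) = (π√2)⁻¹ ∫ θᵢ(x
+ iu) u^(-3/2) du over u > 0 (`phi_eq_eichler`). Once this is known, quantum modularity is a contour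
shift.

The link comes from a special case of the Rogers–Fine identity, used twice. The sum (1 - t) ∑
(tq;q)_n / (βtq;q)_n t^n satisfies a recursion under t ↦ tq (`fineSum_rec`), and for β = -1 or q =
β² its iteration produces a partial theta series in t (`fineSum_neg_one`, `fineSum_sq`). Inside the
disc, at t = 1, the sum is an infinite product, and the eta-quotients become theta series
(`theta_eq_thetaSeries`). At a root of unity, as t → 1⁻, division by 1 - t turns the sum into the
terminating strange series, while the theta side becomes an Abel sum of theta coefficients twisted
by x. Writing e^(-s|n+a|) as a superposition of Gaussians (`integral_subordination`) makes that Abel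
sum an integral of θᵢ against u^(-3/2). The integral converges at u = 0 because the twisted
coefficients are antiperiodic for x in `domain i`, hence have mean zero, so θᵢ vanishes to infinite
order at x (`exists_theta_decay`).

For the inversion, the weight-1/2 law of the thetas turns the integral from -1/x into one along a
curve from x to 0. Together with the imaginary axis and the vertical line above x it bounds a region
free of singularities, so the three integrals are related, and the axis contributes the period
integral (`phi_neg_one_div`).

For general γ, S and T generate the group, and errors propagate along words in them
(`IsMultiplier.S_mul`, `IsMultiplier.T_mul`). The matrices are multiplicative up to phases because
the same matrices transform the three thetas, which are linearly independent
(`eq_zero_of_theta_relation`).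

The period integrals extend holomorphically off the imaginary axis. At x = 0 they are smooth when θᵢ
is flat at the cusp 0; the second theta behaves there like a multiple of t^(-1/2), whose integral is
the explicit pole. The reflection formulas are term-by-term manipulations of finite products. -/

lemma qpow_add (r s z : ℂ) : qpow (r + s) z = qpow r z * qpow s z := by
  rw [qpow, qpow, qpow, ← Complex.exp_add]
  ring_nf

lemma qpow_nat_mul (n : ℕ) (r z : ℂ) : qpow (n * r) z = qpow r z ^ n := by
  rw [qpow, qpow, ← Complex.exp_nat_mul]
  ring_nf

lemma qpow_ne_zero (r z : ℂ) : qpow r z ≠ 0 := Complex.exp_ne_zero _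

lemma qpow_neg_right (r z : ℂ) : qpow r (-z) = (qpow r z)⁻¹ := by
  rw [qpow, qpow, ← Complex.exp_neg]
  ring_nf

lemma qpow_add_one (r z : ℂ) : qpow r (z + 1) = qpow r z * Complex.exp (2 * Real.pi * I * r) := by
  rw [qpow, qpow, ← Complex.exp_add]
  ring_nf

lemma qpow_one_eq_sq (z : ℂ) : qpow 1 z = qpow (1 / 2) z ^ 2 := by
  rw [← qpow_nat_mul]
  norm_num

lemma qpow_one_add_one (z : ℂ) : qpow 1 (z + 1) = qpow 1 z := by
  rw [qpow_add_one, mul_one, Complex.exp_two_pi_mul_I, mul_one]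

lemma qpow_half_add_one (z : ℂ) : qpow (1 / 2) (z + 1) = -qpow (1 / 2) z := by
  rw [qpow_add_one, show 2 * (Real.pi : ℂ) * I * (1 / 2) = Real.pi * I by ring,
    Complex.exp_pi_mul_I]
  ring

lemma zeta_ne_zero (k : ℕ) : zeta k ≠ 0 := Complex.exp_ne_zero _

lemma norm_zeta (k : ℕ) : ‖zeta k‖ = 1 := by
  rw [zeta, show 2 * (Real.pi : ℂ) * I / k = ((2 * Real.pi / k : ℝ) : ℂ) * I by push_cast; ring]
  exact Complex.norm_exp_ofReal_mul_I _

lemma norm_qpow_of_real (r x : ℝ) : ‖qpow r x‖ = 1 := by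
  rw [qpow, show 2 * (Real.pi : ℂ) * I * r * x = ((2 * Real.pi * r * x : ℝ) : ℂ) * I by
    push_cast; ring]
  exact Complex.norm_exp_ofReal_mul_I _

lemma isPrimitiveRoot_qpow (x : ℚ) : IsPrimitiveRoot (qpow 1 (x : ℂ)) x.den := by
  have h := Complex.isPrimitiveRoot_exp_rat x
  rwa [show 2 * (Real.pi : ℂ) * I * (x : ℂ) = 2 * Real.pi * I * 1 * x by ring] at h

lemma exp_pi_mul_rat_eq_one_iff (y : ℚ) :
    Complex.exp (Real.pi * I * y) = 1 ↔ ∃ k : ℤ, y = 2 * k := by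
  rw [Complex.exp_eq_one_iff]
  have hpi : (Real.pi : ℂ) * I ≠ 0 := by simp [Real.pi_ne_zero]
  refine exists_congr fun k => ?_
  rw [show (k : ℂ) * (2 * Real.pi * I) = Real.pi * I * (2 * k) by ring, mul_right_inj' hpi]
  exact_mod_cast Iff.rfl

lemma exp_pi_mul_rat_eq_neg_one_iff (y : ℚ) :
    Complex.exp (Real.pi * I * y) = -1 ↔ ∃ k : ℤ, y = 2 * k + 1 := by
  have h := exp_pi_mul_rat_eq_one_iff (y - 1)
  push_cast at h
  rw [mul_sub, mul_one, Complex.exp_sub, Complex.exp_pi_mul_I, div_neg, div_one, neg_eq_iff_eq_neg]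
    at h
  rw [h]
  exact exists_congr fun k => ⟨fun h => by linarith, fun h => by linarith⟩

lemma qpow_half_mul_pow (x : ℚ) (j : ℕ) :
    qpow (1 / 2) (x : ℂ) * qpow 1 (x : ℂ) ^ j
      = Complex.exp (Real.pi * I * ((((2 * j + 1 : ℕ) : ℚ) * x : ℚ) : ℂ)) := by
  rw [← qpow_nat_mul, ← qpow_add, qpow]
  push_cast
  ring_nf

lemma qpow_one_pow_succ (x : ℚ) (j : ℕ) :
    qpow 1 (x : ℂ) ^ (j + 1)
      = Complex.exp (Real.pi * I * ((((2 * (j + 1) : ℕ) : ℚ) * x : ℚ) : ℂ)) := by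
  rw [← qpow_nat_mul, qpow]
  push_cast
  ring_nf

lemma qPoch_ne_zero_iff (a q : ℂ) (n : ℕ) :
    qPoch a q n ≠ 0 ↔ ∀ j < n, 1 - a * q ^ j ≠ 0 := by
  simp [qPoch, Finset.prod_ne_zero_iff]

lemma coprime_num_den (x : ℚ) : IsCoprime x.num (x.den : ℤ) :=
  Int.isCoprime_iff_gcd_eq_one.2 (by simpa [Int.gcd] using x.reduced)

lemma rat_mul_eq_iff (x : ℚ) (m k : ℤ) : (m : ℚ) * x = k ↔ m * x.num = k * x.den := by
  have hd : (x.den : ℚ) ≠ 0 := by exact_mod_cast x.den_nz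
  have hx : x = x.num / x.den := (Rat.num_div_den x).symm
  constructor
  · intro h
    rw [hx, mul_div_assoc', div_eq_iff hd] at h
    exact_mod_cast h
  · intro h
    rw [hx, mul_div_assoc', div_eq_iff hd]
    exact_mod_cast h

lemma odd_num_or_odd_den (x : ℚ) : Odd x.num ∨ Odd (x.den : ℤ) := by
  by_contra! h
  rw [Int.not_odd_iff_even, Int.not_odd_iff_even] at h
  have := (coprime_num_den x).isUnit_of_dvd' h.1.two_dvd h.2.two_dvd
  exact absurd this (by decide)

lemma den_mul_self_rat (x : ℚ) : ((x.den : ℤ) : ℚ) * x = (x.num : ℤ) :=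
  (rat_mul_eq_iff x x.den x.num).2 (by ring)

/-- Writing q^(j+1) as exp(πi·2(j+1)x) makes the vanishing of a factor an arithmetic condition on a
multiple of x. The other two domains work likewise, with odd multiples. -/
lemma mem_domain_zero_iff' (x : ℚ) :
    x ∈ domain 0 ↔ ∀ j : ℕ, ¬ ∃ k : ℤ, ((2 * (j + 1) : ℕ) : ℚ) * x = 2 * k + 1 := by
  have key : ∀ j : ℕ, 1 - -qpow 1 (x : ℂ) * qpow 1 (x : ℂ) ^ j ≠ 0 ↔
      ¬ ∃ k : ℤ, ((2 * (j + 1) : ℕ) : ℚ) * x = 2 * k + 1 := by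
    intro j
    rw [← exp_pi_mul_rat_eq_neg_one_iff, ← qpow_one_pow_succ, not_iff_not, pow_succ]
    constructor <;> intro h <;> linear_combination h
  simp only [domain, strangeDen, Set.mem_ofPred_eq, qPoch_ne_zero_iff]
  -- The product of index n has n factors here, so index j + 1 is needed to reach factor j; in the
  -- other two cases it has n + 1 factors and index j suffices.
  exact ⟨fun h j => (key j).1 (h (j + 1) j (by omega)), fun h n j _ => (key j).2 (h j)⟩

lemma mem_domain_one_iff' (x : ℚ) :
    x ∈ domain 1 ↔ ∀ j : ℕ, ¬ ∃ k : ℤ, ((2 * j + 1 : ℕ) : ℚ) * x = 2 * k := by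
  have key : ∀ j : ℕ, 1 - qpow (1 / 2) (x : ℂ) * qpow 1 (x : ℂ) ^ j ≠ 0 ↔
      ¬ ∃ k : ℤ, ((2 * j + 1 : ℕ) : ℚ) * x = 2 * k := by
    intro j
    rw [← exp_pi_mul_rat_eq_one_iff, ← qpow_half_mul_pow, not_iff_not]
    constructor <;> intro h <;> linear_combination -h
  simp only [domain, strangeDen, Set.mem_ofPred_eq, qPoch_ne_zero_iff]
  exact ⟨fun h j => (key j).1 (h j j (by omega)), fun h n j _ => (key j).2 (h j)⟩

lemma mem_domain_two_iff' (x : ℚ) :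
    x ∈ domain 2 ↔ ∀ j : ℕ, ¬ ∃ k : ℤ, ((2 * j + 1 : ℕ) : ℚ) * x = 2 * k + 1 := by
  have key : ∀ j : ℕ, 1 - -qpow (1 / 2) (x : ℂ) * qpow 1 (x : ℂ) ^ j ≠ 0 ↔
      ¬ ∃ k : ℤ, ((2 * j + 1 : ℕ) : ℚ) * x = 2 * k + 1 := by
    intro j
    rw [← exp_pi_mul_rat_eq_neg_one_iff, ← qpow_half_mul_pow, not_iff_not]
    constructor <;> intro h <;> linear_combination h
  simp only [domain, strangeDen, Set.mem_ofPred_eq, qPoch_ne_zero_iff]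
  exact ⟨fun h j => (key j).1 (h j j (by omega)), fun h n j _ => (key j).2 (h j)⟩

theorem mem_domain_zero (x : ℚ) : x ∈ domain 0 ↔ Odd x.den := by
  rw [mem_domain_zero_iff']
  constructor
  · intro h
    by_contra hd
    rw [Nat.not_odd_iff_even] at hd
    obtain ⟨m, hm⟩ := hd
    have hnum : Odd x.num := by
      rcases odd_num_or_odd_den x with h1 | h1
      · exact h1
      · rw [hm] at h1
        exact absurd h1 (by rw [Int.not_odd_iff_even]; exact ⟨m, by push_cast; ring⟩)
    obtain ⟨k, hk⟩ := hnum
    have hm0 : 0 < m := by have := x.pos; omega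
    -- The denominator is 2m and q^m = exp(πi·num) = -1, so the vanishing factor is the one with j +
    -- 1 = m.
    refine h (m - 1) ⟨k, ?_⟩
    have hmm : 2 * (m - 1 + 1) = x.den := by omega
    rw [hmm]
    have := den_mul_self_rat x
    rw [hk] at this
    push_cast at this ⊢
    exact this
  · rintro ⟨m, hm⟩ j ⟨k, hk⟩
    have := (rat_mul_eq_iff x (2 * (j + 1) : ℕ) (2 * k + 1)).1 (by push_cast at hk ⊢; exact hk)
    rw [hm] at this
    push_cast at this
    have : (2 : ℤ) * ((j + 1) * x.num - (2 * k + 1) * m - k) = 1 := by linarith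
    omega

theorem mem_domain_one (x : ℚ) : x ∈ domain 1 ↔ Odd x.num := by
  rw [mem_domain_one_iff']
  constructor
  · intro h
    by_contra hd
    have hden := (odd_num_or_odd_den x).resolve_left hd
    rw [Int.not_odd_iff_even] at hd
    obtain ⟨k, hk⟩ := hd
    have hden' : Odd x.den := by exact_mod_cast hden
    obtain ⟨j, hj⟩ := hden'
    refine h j ⟨k, ?_⟩
    rw [← hj]
    have := den_mul_self_rat x
    rw [hk] at this
    push_cast at this ⊢
    rw [this]
    ring
  · rintro ⟨m, hm⟩ j ⟨k, hk⟩
    have := (rat_mul_eq_iff x (2 * j + 1 : ℕ) (2 * k)).1 (by push_cast at hk ⊢; exact hk)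
    rw [hm] at this
    push_cast at this
    have : (2 : ℤ) * (k * x.den - (2 * j + 1) * m - j) = 1 := by linarith
    omega

theorem mem_domain_two (x : ℚ) : x ∈ domain 2 ↔ Even (x.num * x.den) := by
  rw [mem_domain_two_iff']
  constructor
  · intro h
    by_contra hd
    rw [Int.not_even_iff_odd, Int.odd_mul] at hd
    obtain ⟨⟨k, hk⟩, hden⟩ := hd
    have hden' : Odd x.den := by exact_mod_cast hden
    obtain ⟨j, hj⟩ := hden'
    refine h j ⟨k, ?_⟩
    rw [← hj]
    have := den_mul_self_rat x
    rw [hk] at this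
    push_cast at this ⊢
    exact this
  · rintro he j ⟨k, hk⟩
    have := (rat_mul_eq_iff x (2 * j + 1 : ℕ) (2 * k + 1)).1 (by push_cast at hk ⊢; exact hk)
    have h1 : Odd x.num ↔ Odd (x.den : ℤ) := by
      have h2 : Odd (((2 * j + 1 : ℕ) : ℤ) * x.num) ↔ Odd ((2 * k + 1) * (x.den : ℤ)) := by
        rw [this]
      rw [Int.odd_mul, Int.odd_mul] at h2
      have h3 : Odd ((2 * j + 1 : ℕ) : ℤ) := ⟨j, by push_cast; ring⟩
      have h4 : Odd (2 * k + 1) := ⟨k, rfl⟩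
      tauto
    have h5 := odd_num_or_odd_den x
    rw [← Int.not_odd_iff_even, Int.odd_mul] at he
    tauto

/-- The factor of index den - 1 is 1 - q^den = 0. This is why all the series terminate at rational
points. -/
lemma qPoch_self_eq_zero (x : ℚ) {n : ℕ} (hn : x.den ≤ n) :
    qPoch (qpow 1 (x : ℂ)) (qpow 1 (x : ℂ)) n = 0 := by
  refine Finset.prod_eq_zero (i := x.den - 1)
    (Finset.mem_range.2 (by have := x.pos; omega)) ?_
  rw [← pow_succ', Nat.sub_add_cancel x.pos, (isPrimitiveRoot_qpow x).pow_eq_one, sub_self]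

lemma strangeTerm_eq_zero (i : Fin 3) (x : ℚ) {n : ℕ} (hn : x.den ≤ n) :
    strangeTerm i n (x : ℂ) = 0 := by
  rw [strangeTerm, qPoch_self_eq_zero x hn, zero_div, mul_zero]

theorem summable_strangeTerm (i : Fin 3) (x : ℚ) :
    Summable fun n => strangeTerm i n (x : ℂ) :=
  summable_of_ne_finset_zero (s := Finset.range x.den) fun n hn =>
    strangeTerm_eq_zero i x (by simpa using hn)

lemma phi_eq_sum (i : Fin 3) (x : ℚ) :
    phi x i = ∑ n ∈ Finset.range x.den, strangeTerm i n (x : ℂ) :=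
  tsum_eq_sum fun n hn => strangeTerm_eq_zero i x (by simpa using hn)

lemma neg_mem_domain (i : Fin 3) {x : ℚ} (hx : -x ∈ domain i) : x ∈ domain i := by
  fin_cases i
  · exact (mem_domain_zero x).2 (by simpa using (mem_domain_zero (-x)).1 hx)
  · exact (mem_domain_one x).2 (by simpa using (mem_domain_one (-x)).1 hx)
  · exact (mem_domain_two x).2 (by simpa using (mem_domain_two (-x)).1 hx)

/-! ### The law for the translation -/

lemma add_one_mem_domain_zero {z : ℚ} : z + 1 ∈ domain 0 ↔ z ∈ domain 0 := by
  simp only [domain, strangeDen, Set.mem_ofPred_eq]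
  push_cast
  simp only [qpow_one_add_one]

lemma add_one_mem_domain_one {z : ℚ} : z + 1 ∈ domain 1 ↔ z ∈ domain 2 := by
  simp only [domain, strangeDen, Set.mem_ofPred_eq]
  push_cast
  simp only [qpow_one_add_one, qpow_half_add_one]

lemma add_one_mem_domain_two {z : ℚ} : z + 1 ∈ domain 2 ↔ z ∈ domain 1 := by
  simp only [domain, strangeDen, Set.mem_ofPred_eq]
  push_cast
  simp only [qpow_one_add_one, qpow_half_add_one, neg_neg]

lemma phi_add_one_zero (z : ℚ) : phi (z + 1) 0 = phi z 0 := by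
  simp only [phi, strangeTerm, strangePrefactor, strangeDen]
  push_cast
  simp only [qpow_one_add_one]

lemma qpow_sixteenth_add_one (z : ℂ) : qpow (1 / 16) (z + 1) = zeta 16 * qpow (1 / 16) z := by
  rw [qpow_add_one, zeta, mul_comm]
  push_cast
  ring_nf

/-- Translation fixes q and negates q^(1/2), which exchanges the products of the second and third
series. The constant ζ₁₆/ζ₁₂ in the third prefactor leaves ζ₁₂ here and ζ₁₆²/ζ₁₂ = ζ₂₄ on the way
back. -/
lemma phi_add_one_one (z : ℚ) : phi (z + 1) 1 = zeta 12 * phi z 2 := by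
  simp only [phi, strangeTerm, strangePrefactor, strangeDen, tsum_mul_left]
  push_cast
  simp only [qpow_one_add_one, qpow_half_add_one, qpow_sixteenth_add_one]
  field_simp [zeta_ne_zero 12]

lemma zeta_sixteen_sq : zeta 16 ^ 2 = zeta 12 * zeta 24 := by
  rw [zeta, zeta, zeta, ← Complex.exp_nat_mul, ← Complex.exp_add]
  push_cast
  ring_nf

lemma phi_add_one_two (z : ℚ) : phi (z + 1) 2 = zeta 24 * phi z 1 := by
  simp only [phi, strangeTerm, strangePrefactor, strangeDen, tsum_mul_left]
  push_cast
  simp only [qpow_one_add_one, qpow_half_add_one, qpow_sixteenth_add_one, neg_neg]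
  have := zeta_sixteen_sq
  field_simp [zeta_ne_zero 12]
  rw [this]
  ring

lemma matT_mulVec (v : Fin 3 → ℂ) :
    matT.mulVec v = ![v 0, zeta 12 * v 2, zeta 24 * v 1] := by
  funext i
  fin_cases i <;> simp [matT, Matrix.mulVec, dotProduct, Fin.sum_univ_three]

lemma matS_mulVec (v : Fin 3 → ℂ) :
    matS.mulVec v = ![(Real.sqrt 2 : ℂ) * v 1, 1 / (Real.sqrt 2 : ℂ) * v 0, v 2] := by
  funext i
  fin_cases i <;> simp [matS, Matrix.mulVec, dotProduct, Fin.sum_univ_three]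

lemma phi_add_one (z : ℚ) : phi (z + 1) = matT.mulVec (phi z) := by
  rw [matT_mulVec]
  funext i
  fin_cases i
  · exact phi_add_one_zero z
  · exact phi_add_one_one z
  · exact phi_add_one_two z

theorem translation_law (z : ℚ) (i : Fin 3) (hz : z + 1 ∈ domain i) :
    (∀ j, matT i j ≠ 0 → z ∈ domain j) ∧ (phi (z + 1) - matT.mulVec (phi z)) i = 0 := by
  refine ⟨fun j hj => ?_, by rw [phi_add_one, sub_self]; rfl⟩
  fin_cases i <;> fin_cases j <;> simp [matT] at hj ⊢
  · exact add_one_mem_domain_zero.1 hz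
  · exact add_one_mem_domain_one.1 hz
  · exact add_one_mem_domain_two.1 hz

/-! ### The reflected series -/

lemma qPoch_succ (a q : ℂ) (n : ℕ) : qPoch a q (n + 1) = qPoch a q n * (1 - a * q ^ n) :=
  Finset.prod_range_succ _ _

lemma qPoch_zero (a q : ℂ) : qPoch a q 0 = 1 := Finset.prod_range_zero _

lemma one_sub_ne_zero_of_norm_lt {z : ℂ} (hz : ‖z‖ < 1) : 1 - z ≠ 0 := by
  intro h
  rw [sub_eq_zero] at h
  rw [← h, norm_one] at hz
  exact lt_irrefl _ hz

lemma norm_pow_lt_one {w : ℂ} (hw : ‖w‖ < 1) {n : ℕ} (hn : n ≠ 0) : ‖w ^ n‖ < 1 := by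
  rw [norm_pow]
  exact pow_lt_one₀ (norm_nonneg _) hw hn

theorem reflDen_ne_zero_of_norm_lt (i : Fin 3) {w : ℂ} (hw : ‖w‖ < 1) (n : ℕ) :
    reflDen i n w ≠ 0 := by
  fin_cases i <;> simp only [reflDen]
  · refine mul_ne_zero ?_ ((qPoch_ne_zero_iff _ _ _).2 fun j _ => ?_)
    · rw [← sub_neg_eq_add]
      exact one_sub_ne_zero_of_norm_lt (by rw [norm_neg]; exact norm_pow_lt_one hw (by omega))
    · rw [neg_mul, ← pow_succ']
      exact one_sub_ne_zero_of_norm_lt (by rw [norm_neg]; exact norm_pow_lt_one hw (by omega))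
  · refine (qPoch_ne_zero_iff _ _ _).2 fun j _ => ?_
    rw [← pow_mul, ← pow_succ']
    exact one_sub_ne_zero_of_norm_lt (norm_pow_lt_one hw (by omega))
  · refine (qPoch_ne_zero_iff _ _ _).2 fun j _ => ?_
    rw [neg_mul, ← pow_mul, ← pow_succ']
    exact one_sub_ne_zero_of_norm_lt (by rw [norm_neg]; exact norm_pow_lt_one hw (by omega))

lemma summable_of_ratio_tendsto {f ρ : ℕ → ℂ} {ρ₀ : ℂ} (hf : ∀ n, f (n + 1) = ρ n * f n)
    (hρ : Tendsto ρ atTop (𝓝 ρ₀)) (h₀ : ‖ρ₀‖ < 1) : Summable f := by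
  obtain ⟨r, hr0, hr1⟩ := exists_between h₀
  refine summable_of_ratio_norm_eventually_le hr1 ?_
  filter_upwards [hρ.norm.eventually_lt_const hr0] with n hn
  rw [hf, norm_mul]
  exact mul_le_mul_of_nonneg_right hn.le (norm_nonneg _)

lemma tendsto_pow_affine {w : ℂ} (hw : ‖w‖ < 1) (k c : ℕ) (hk : k ≠ 0) :
    Tendsto (fun n : ℕ => w ^ (k * n + c)) atTop (𝓝 0) := by
  have h := (tendsto_pow_atTop_nhds_zero_of_norm_lt_one (norm_pow_lt_one hw hk)).mul_const (w ^ c)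
  rw [zero_mul] at h
  refine h.congr fun n => ?_
  rw [pow_add, pow_mul]

/-- Ratio test: the quotients of consecutive terms tend to w², w and -w respectively. -/
theorem summable_reflTerm_of_norm_lt (i : Fin 3) {w : ℂ} (hw : ‖w‖ < 1) :
    Summable fun n => reflNum i n w / reflDen i n w := by
  have ht : ∀ c, Tendsto (fun n : ℕ => w ^ (2 * n + c)) atTop (𝓝 0) := fun c =>
    tendsto_pow_affine hw 2 c two_ne_zero
  have hden : ∀ j : Fin 3, ∀ n, reflDen j n w ≠ 0 := fun j => reflDen_ne_zero_of_norm_lt j hw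
  fin_cases i
  · refine summable_of_ratio_tendsto (ρ₀ := w ^ 2 * ((1 - 0) * (1 - 0) / ((1 + 0) * (1 + 0))))
      (ρ := fun n => w ^ 2 * ((1 - w ^ (2 * n + 1)) * (1 - w ^ (2 * n + 2)) /
        ((1 + w ^ (2 * n + 3)) * (1 + w ^ (2 * n + 2))))) (fun n => ?_) ?_ ?_
    · have h1 := hden 0 n
      have h2 := hden 0 (n + 1)
      simp only [reflNum, reflDen, show 2 * (n + 1) = 2 * n + 1 + 1 by ring, qPoch_succ, neg_mul,
        sub_neg_eq_add, ← pow_succ'] at h1 h2 ⊢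
      have h3 := left_ne_zero_of_mul h1
      have h4 := right_ne_zero_of_mul h1
      have h5 := left_ne_zero_of_mul h2
      have h6 := right_ne_zero_of_mul (right_ne_zero_of_mul h2)
      simp only [show 2 * n + 1 + 1 = 2 * n + 2 by ring, show 2 * n + 2 + 1 = 2 * n + 3 by ring]
        at h5 h6 ⊢
      field_simp
      ring
    · refine Tendsto.const_mul _ (Tendsto.div ?_ ?_ (by norm_num))
      · exact ((ht 1).const_sub 1).mul ((ht 2).const_sub 1)
      · exact ((ht 3).const_add 1).mul ((ht 2).const_add 1)
    · simpa using norm_pow_lt_one hw two_ne_zero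
  · refine summable_of_ratio_tendsto (ρ₀ := w * ((1 - 0) / (1 - 0)))
      (ρ := fun n => w * ((1 - w ^ (2 * n + 2)) / (1 - w ^ (2 * n + 3)))) (fun n => ?_) ?_ ?_
    · have h1 := hden 1 n
      have h2 := hden 1 (n + 1)
      simp only [reflNum, reflDen] at h1 h2 ⊢
      rw [qPoch_succ w _ (n + 1)] at h2 ⊢
      rw [qPoch_succ _ _ n]
      have h3 := right_ne_zero_of_mul h2
      rw [show w * (w ^ 2) ^ (n + 1) = w ^ (2 * n + 3) by rw [← pow_mul]; ring] at h3 ⊢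
      rw [show w ^ 2 * (w ^ 2) ^ n = w ^ (2 * n + 2) by rw [← pow_mul]; ring]
      field_simp
      ring
    · exact Tendsto.const_mul _ (((ht 2).const_sub 1).div ((ht 3).const_sub 1) (by norm_num))
    · simpa using hw
  · refine summable_of_ratio_tendsto (ρ₀ := -w * ((1 - 0) / (1 + 0)))
      (ρ := fun n => -w * ((1 - w ^ (2 * n + 2)) / (1 + w ^ (2 * n + 3)))) (fun n => ?_) ?_ ?_
    · have h1 := hden 2 n
      have h2 := hden 2 (n + 1)
      simp only [reflNum, reflDen] at h1 h2 ⊢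
      rw [qPoch_succ (-w) _ (n + 1)] at h2 ⊢
      rw [qPoch_succ _ _ n]
      have h3 := right_ne_zero_of_mul h2
      rw [show 1 - -w * (w ^ 2) ^ (n + 1) = 1 + w ^ (2 * n + 3) by rw [← pow_mul]; ring] at h3 ⊢
      rw [show w ^ 2 * (w ^ 2) ^ n = w ^ (2 * n + 2) by rw [← pow_mul]; ring]
      field_simp
      ring
    · exact Tendsto.const_mul _ (((ht 2).const_sub 1).div ((ht 3).const_add 1) (by norm_num))
    · simpa using hw

lemma reflDen_ne_zero_of_mem (i : Fin 3) {x : ℚ} (hx : x ∈ domain i) (n : ℕ) :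
    reflDen i n (reflVar i (x : ℂ)) ≠ 0 := by
  fin_cases i
  -- Index 2n + 1 is the right one because (-q;q)_{2n+1} = (-q;q)_{2n} (1 + q^(2n+1)) is the whole
  -- reflected denominator.
  · have h : strangeDen 0 (2 * n + 1) (x : ℂ) ≠ 0 := hx (2 * n + 1)
    rw [strangeDen, qPoch_succ] at h
    simp only [reflDen, reflVar]
    rw [mul_comm]
    convert h using 2
    ring
  · have h : strangeDen 1 n (x : ℂ) ≠ 0 := hx n
    simpa only [reflDen, reflVar, strangeDen, qpow_one_eq_sq] using h
  · have h : strangeDen 2 n (x : ℂ) ≠ 0 := hx n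
    simpa only [reflDen, reflVar, strangeDen, qpow_one_eq_sq] using h

lemma reflNum_eq_zero (i : Fin 3) (x : ℚ) {n : ℕ} (hn : x.den ≤ n) :
    reflNum i n (reflVar i (x : ℂ)) = 0 := by
  have h1 := qPoch_self_eq_zero x hn
  fin_cases i
  · simp only [reflNum, reflVar]
    rw [qPoch_self_eq_zero x (by omega), mul_zero]
  · simp only [reflNum, reflVar, ← qpow_one_eq_sq]
    rw [h1, mul_zero, neg_zero]
  · simp only [reflNum, reflVar, ← qpow_one_eq_sq]
    rw [h1, mul_zero]

lemma summable_reflTerm (i : Fin 3) (x : ℚ) :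
    Summable fun n => reflNum i n (reflVar i (x : ℂ)) / reflDen i n (reflVar i (x : ℂ)) :=
  summable_of_ne_finset_zero (s := Finset.range x.den) fun n hn => by
    rw [reflNum_eq_zero i x (by simpa using hn), zero_div]

lemma one_sub_inv {z : ℂ} (hz : z ≠ 0) : 1 - z⁻¹ = -z⁻¹ * (1 - z) := by
  field_simp
  ring

lemma one_add_inv {z : ℂ} (hz : z ≠ 0) : 1 + z⁻¹ = z⁻¹ * (1 + z) := by
  field_simp
  ring

/-- Each factor flips by 1 - z⁻¹ = -z⁻¹(1 - z). With n factors above and n + 1 below, one sign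
survives, and the monomials leave w^((n+1)² - n(n+1)) = w^(n+1). -/
lemma qPoch_inv_div (w : ℂ) (hw : w ≠ 0) (h : ∀ j, 1 - w * (w ^ 2) ^ j ≠ 0) (n : ℕ) :
    qPoch (w ^ 2)⁻¹ (w ^ 2)⁻¹ n / qPoch w⁻¹ (w ^ 2)⁻¹ (n + 1)
      = -w * (w ^ n * qPoch (w ^ 2) (w ^ 2) n / qPoch w (w ^ 2) (n + 1)) := by
  have hp : ∀ n, qPoch w (w ^ 2) n ≠ 0 := fun n => (qPoch_ne_zero_iff _ _ _).2 fun j _ => h j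
  have hinv : ∀ j, 1 - w⁻¹ * ((w ^ 2)⁻¹) ^ j = -(w * (w ^ 2) ^ j)⁻¹ * (1 - w * (w ^ 2) ^ j) := by
    intro j
    rw [inv_pow, ← mul_inv, one_sub_inv (mul_ne_zero hw (pow_ne_zero _ (pow_ne_zero _ hw)))]
  have hp' : ∀ n, qPoch w⁻¹ (w ^ 2)⁻¹ n ≠ 0 := fun n => (qPoch_ne_zero_iff _ _ _).2 fun j _ => by
    rw [hinv]
    exact mul_ne_zero (neg_ne_zero.2 (inv_ne_zero (by positivity))) (h j)
  induction n with
  | zero =>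
    have h0 := h 0
    have h1 := hinv 0
    simp only [pow_zero, mul_one] at h0 h1
    simp only [zero_add, qPoch_succ, qPoch_zero, pow_zero, mul_one, h1]
    field_simp
  | succ n ih =>
    rw [qPoch_succ _ _ (n + 1), qPoch_succ _ _ n, mul_div_mul_comm, ih, qPoch_succ w _ (n + 1),
      qPoch_succ (w ^ 2) _ n, hinv (n + 1)]
    have h0 := h (n + 1)
    have h1 := hp (n + 1)
    have h2 : (1 - (w ^ 2)⁻¹ * ((w ^ 2)⁻¹) ^ n) = -((w ^ 2) * (w ^ 2) ^ n)⁻¹ *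
        (1 - w ^ 2 * (w ^ 2) ^ n) := by
      rw [inv_pow, ← mul_inv, one_sub_inv (by positivity)]
    rw [h2]
    field_simp
    ring

lemma zeta_sixteen_div : zeta 16 / zeta 12 = (zeta 48)⁻¹ := by
  rw [zeta, zeta, zeta, ← Complex.exp_sub, ← Complex.exp_neg]
  push_cast
  ring_nf

lemma qpow_seven_sixteenth (z : ℂ) :
    qpow (7 / 16) z = (qpow (1 / 16) z)⁻¹ * qpow (1 / 2) z := by
  rw [← qpow_neg_right, qpow, qpow, qpow, ← Complex.exp_add]
  ring_nf

/-- Flipping the factors under q ↦ q⁻¹, the powers of q cancel between numerator and denominator,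
and only the numerator contributes signs. -/
lemma strangeTerm_neg_zero (x : ℚ) (hx : x ∈ domain 0) (n : ℕ) :
    strangeTerm 0 n ((-x : ℚ) : ℂ) = (-1) ^ n * strangeTerm 0 n (x : ℂ) := by
  have hq := qpow_ne_zero 1 (x : ℂ)
  simp only [strangeTerm, strangePrefactor, strangeDen, one_mul]
  push_cast
  rw [qpow_neg_right]
  have h' : ∀ n, qPoch (-qpow 1 (x : ℂ)) (qpow 1 (x : ℂ)) n ≠ 0 := hx
  generalize qpow 1 (x : ℂ) = q at *
  induction n with
  | zero => simp [qPoch_zero]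
  | succ n ih =>
    rw [qPoch_succ, qPoch_succ, mul_div_mul_comm, ih, qPoch_succ, qPoch_succ]
    have h1 := h' n
    have h2 := h' (n + 1)
    rw [qPoch_succ] at h2
    have h3 := right_ne_zero_of_mul h2
    have h4 : (1 - q⁻¹ * q⁻¹ ^ n) = -(q * q ^ n)⁻¹ * (1 - q * q ^ n) := by
      rw [inv_pow, ← mul_inv, one_sub_inv (by positivity)]
    have h5 : (1 - -q⁻¹ * q⁻¹ ^ n) = (q * q ^ n)⁻¹ * (1 - -q * q ^ n) := by
      rw [neg_mul, neg_mul, sub_neg_eq_add, sub_neg_eq_add, inv_pow, ← mul_inv,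
        one_add_inv (by positivity)]
    rw [h4, h5, pow_succ]
    field_simp

lemma tsum_eq_tsum_pairs {f : ℕ → ℂ} (hf : Summable f) :
    ∑' n, f n = ∑' n, (f (2 * n) + f (2 * n + 1)) := by
  have h1 : Summable fun n => f (2 * n) :=
    hf.comp_injective fun a b h => by simpa using h
  have h2 : Summable fun n => f (2 * n + 1) :=
    hf.comp_injective fun a b h => by simpa using h
  rw [h1.tsum_add h2, tsum_even_add_odd h1 h2]

theorem reflection (i : Fin 3) (x : ℚ) (hx : x ∈ domain i) : phi (-x) i = G i (x : ℂ) := by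
  have hw := qpow_ne_zero (1 / 2) (x : ℂ)
  fin_cases i
  · change phi (-x) 0 = G 0 (x : ℂ)
    simp only [phi, G, reflPrefactor, one_mul]
    have hs : Summable fun n => strangeTerm 0 n ((-x : ℚ) : ℂ) := summable_strangeTerm 0 (-x)
    -- The reflected terms alternate in sign, and neighbours combine through 1 - (1 - Q)/(1 + Q) =
    -- 2Q/(1 + Q) with Q = q^(2n+1).
    rw [tsum_eq_tsum_pairs hs]
    refine tsum_congr fun n => ?_
    rw [strangeTerm_neg_zero x hx, strangeTerm_neg_zero x hx]
    have h1 := reflDen_ne_zero_of_mem 0 hx n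
    simp only [strangeTerm, strangePrefactor, strangeDen, reflNum, reflDen, reflVar, one_mul,
      qPoch_succ] at h1 ⊢
    generalize qpow 1 (x : ℂ) = q at *
    have h2 := left_ne_zero_of_mul h1
    have h3 := right_ne_zero_of_mul h1
    rw [show 1 - -q * q ^ (2 * n) = 1 + q ^ (2 * n + 1) by ring,
      show 1 - q * q ^ (2 * n) = 1 - q ^ (2 * n + 1) by ring, pow_succ, pow_mul]
    norm_num
    field_simp
    ring
  · have h : ∀ j, 1 - qpow (1 / 2) (x : ℂ) * (qpow (1 / 2) (x : ℂ) ^ 2) ^ j ≠ 0 := by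
      intro j
      rw [← qpow_one_eq_sq]
      exact (qPoch_ne_zero_iff _ _ _).1 (hx j) j (by omega)
    simp only [phi, G, ← tsum_mul_left]
    refine tsum_congr fun n => ?_
    simp only [strangeTerm, strangePrefactor, strangeDen, reflNum, reflDen, reflVar, reflPrefactor]
    push_cast
    simp only [qpow_neg_right, qpow_one_eq_sq]
    rw [qPoch_inv_div _ hw h, qpow_seven_sixteenth]
    ring
  · have h : ∀ j, 1 - -qpow (1 / 2) (x : ℂ) * ((-qpow (1 / 2) (x : ℂ)) ^ 2) ^ j ≠ 0 := by
      intro j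
      rw [neg_sq, ← qpow_one_eq_sq]
      exact (qPoch_ne_zero_iff _ _ _).1 (hx j) j (by omega)
    -- The third series is the second with w = q^(1/2) replaced by -w, which leaves w² = q
    -- unchanged.
    have key := qPoch_inv_div _ (neg_ne_zero.2 hw) h
    simp only [inv_neg, neg_sq] at key
    simp only [phi, G, ← tsum_mul_left]
    refine tsum_congr fun n => ?_
    simp only [strangeTerm, strangePrefactor, strangeDen, reflNum, reflDen, reflVar, reflPrefactor]
    push_cast
    simp only [qpow_neg_right, qpow_one_eq_sq]
    rw [key, qpow_seven_sixteenth, zeta_sixteen_div]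
    ring

/-! ### A special case of the Rogers–Fine identity -/

/-- The quotient `(tq; q)_n / (βtq; q)_n`. -/
def ratioProd (β q t : ℂ) (n : ℕ) : ℂ :=
  ∏ j ∈ Finset.range n, (1 - t * q ^ (j + 1)) / (1 - β * t * q ^ (j + 1))

/-- The Abel-summed form of `(1 - t) ∑ (tq; q)_n / (βtq; q)_n t ^ n`. -/
def fineSum (β q t : ℂ) : ℂ :=
  1 + ∑' n, (ratioProd β q t (n + 1) - ratioProd β q t n) * t ^ (n + 1)

lemma ratioProd_zero (β q t : ℂ) : ratioProd β q t 0 = 1 := Finset.prod_range_zero _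

lemma ratioProd_succ (β q t : ℂ) (n : ℕ) : ratioProd β q t (n + 1)
    = ratioProd β q t n * ((1 - t * q ^ (n + 1)) / (1 - β * t * q ^ (n + 1))) :=
  Finset.prod_range_succ _ _

/-- The factor q^(n+1) gained by differencing turns powers of t into powers of tq. It is the source
both of the functional equation and of convergence at t = 1 inside the disc. -/
lemma ratioProd_succ_sub {β q t : ℂ} {n : ℕ} (h : 1 - β * t * q ^ (n + 1) ≠ 0) :
    ratioProd β q t (n + 1) - ratioProd β q t n
      = t * q ^ (n + 1) * (β * ratioProd β q t (n + 1) - ratioProd β q t n) := by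
  have h1 : ratioProd β q t (n + 1) * (1 - β * t * q ^ (n + 1))
      = ratioProd β q t n * (1 - t * q ^ (n + 1)) := by
    rw [ratioProd_succ, mul_assoc, div_mul_cancel₀ _ h]
  linear_combination h1

lemma ratioProd_shift (β q t : ℂ) (n : ℕ) : ratioProd β q t (n + 1)
    = (1 - t * q) / (1 - β * t * q) * ratioProd β q (t * q) n := by
  rw [ratioProd, Finset.prod_range_succ', mul_comm, ratioProd]
  congr 1
  · simp
  · refine Finset.prod_congr rfl fun j _ => ?_
    rw [pow_succ' q (j + 1)]
    ring_nf

lemma ratioProd_add (β q t : ℂ) (k n : ℕ) :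
    ratioProd β q t (n + k) = ratioProd β q t k * ratioProd β q (t * q ^ k) n := by
  rw [ratioProd, add_comm, Finset.prod_range_add, ratioProd, ratioProd]
  congr 1
  refine Finset.prod_congr rfl fun j _ => ?_
  rw [show k + j + 1 = k + (j + 1) by ring, pow_add]
  ring_nf

lemma fineSum_eq_mul_tsum {β q t : ℂ} (h : Summable fun n => ratioProd β q t n * t ^ n) :
    fineSum β q t = (1 - t) * ∑' n, ratioProd β q t n * t ^ n := by
  have h1 : Summable fun n => ratioProd β q t (n + 1) * t ^ (n + 1) :=
    (summable_nat_add_iff (f := fun n => ratioProd β q t n * t ^ n) 1).2 h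
  have h2 : ∑' n, ratioProd β q t n * t ^ n
      = 1 + ∑' n, ratioProd β q t (n + 1) * t ^ (n + 1) := by
    rw [h.tsum_eq_zero_add, ratioProd_zero, pow_zero, mul_one]
  have h3 : ∀ n, (ratioProd β q t (n + 1) - ratioProd β q t n) * t ^ (n + 1)
      = ratioProd β q t (n + 1) * t ^ (n + 1) - t * (ratioProd β q t n * t ^ n) := by
    intro n
    ring
  rw [fineSum, tsum_congr h3, h1.tsum_sub (h.mul_left t), tsum_mul_left]
  linear_combination -h2

/-- By `ratioProd_succ_sub` the differenced series splits into ∑ R_{n+1}(tq)^n and ∑ R_n(tq)^n,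
where R_n is the ratio product at t. These differ by an index shift, and `ratioProd_shift`
identifies the first with the series at tq. Only convergence at tq enters, so t = 1 is allowed in
the disc. -/
lemma fineSum_rec {β q t : ℂ} (h0 : ∀ n : ℕ, 1 - β * t * q ^ (n + 1) ≠ 0)
    (h : Summable fun n => ratioProd β q (t * q) n * (t * q) ^ n) :
    fineSum β q t
      = 1 - t ^ 2 * q + t ^ 2 * q * (β - t * q) / (1 - β * t * q) * fineSum β q (t * q) := by
  have h00 : 1 - β * t * q ≠ 0 := by simpa using h0 0
  have hs : ∀ n, ratioProd β q t (n + 1) * (t * q) ^ n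
      = (1 - t * q) / (1 - β * t * q) * (ratioProd β q (t * q) n * (t * q) ^ n) := by
    intro n
    rw [ratioProd_shift, mul_assoc]
  have h1 : Summable fun n => ratioProd β q t (n + 1) * (t * q) ^ n := by
    simpa only [hs] using h.mul_left ((1 - t * q) / (1 - β * t * q))
  have h1' : Summable fun n => ratioProd β q t (n + 1) * (t * q) ^ (n + 1) := by
    simpa only [pow_succ, ← mul_assoc] using h1.mul_right (t * q)
  have h2 : Summable fun n => ratioProd β q t n * (t * q) ^ n :=
    (summable_nat_add_iff (f := fun n => ratioProd β q t n * (t * q) ^ n) 1).1 h1'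
  set W := ∑' n, ratioProd β q t (n + 1) * (t * q) ^ n with hW
  have h3 : ∑' n, ratioProd β q t n * (t * q) ^ n = 1 + t * q * W := by
    rw [h2.tsum_eq_zero_add, ratioProd_zero, pow_zero, mul_one, hW, ← tsum_mul_left]
    congr 1
    refine tsum_congr fun n => ?_
    ring
  have h4 : (1 - β * t * q) * W = fineSum β q (t * q) := by
    rw [fineSum_eq_mul_tsum h, hW, tsum_congr hs, tsum_mul_left]
    field_simp
  have h5 : ∀ n, (ratioProd β q t (n + 1) - ratioProd β q t n) * t ^ (n + 1)
      = t ^ 2 * q * (β * (ratioProd β q t (n + 1) * (t * q) ^ n))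
        - t ^ 2 * q * (ratioProd β q t n * (t * q) ^ n) := by
    intro n
    rw [ratioProd_succ_sub (h0 n)]
    ring
  rw [fineSum, tsum_congr h5, Summable.tsum_sub ((h1.mul_left β).mul_left _) (h2.mul_left _),
    tsum_mul_left, tsum_mul_left, tsum_mul_left, h3, ← h4, ← hW, ← mul_assoc (_ / _),
    div_mul_cancel₀ _ h00]
  ring

/-- K iterations leave the remainder F K * u K, with F the running product of the f, so the partial
sums telescope. -/
lemma eq_tsum_of_rec {u p f : ℕ → ℂ} (hu : ∀ k, u k = p k + f k * u (k + 1)) {F : ℕ → ℂ}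
    (hF0 : F 0 = 1) (hF : ∀ k, F (k + 1) = F k * f k)
    (hlim : Tendsto (fun k => F k * u k) atTop (𝓝 0)) (hs : Summable fun k => F k * p k) :
    u 0 = ∑' k, F k * p k := by
  have h1 : ∀ K, ∑ k ∈ Finset.range K, F k * p k = u 0 - F K * u K := by
    intro K
    induction K with
    | zero => simp [hF0]
    | succ K ih =>
      rw [Finset.sum_range_succ, ih, hF]
      linear_combination -F K * hu K
  have h2 := hs.hasSum.tendsto_sum_nat
  simp only [h1] at h2
  have h3 := hlim.const_sub (u 0)
  rw [sub_zero] at h3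
  exact tendsto_nhds_unique h3 h2

lemma sq_pow_mul_pow_norm_le {t q : ℂ} (ht : ‖t‖ ≤ 1) (hq : ‖q‖ ≤ 1) (k : ℕ) :
    ‖(-1) ^ k * t ^ (2 * k) * q ^ (k ^ 2)‖ ≤ ‖t * q‖ ^ k := by
  have h1 : ‖t‖ ^ (2 * k) ≤ ‖t‖ ^ k := pow_le_pow_of_le_one (norm_nonneg _) ht (by omega)
  have h2 : ‖q‖ ^ (k ^ 2) ≤ ‖q‖ ^ k :=
    pow_le_pow_of_le_one (norm_nonneg _) hq (Nat.le_self_pow two_ne_zero k)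
  simp only [norm_mul, norm_pow, norm_neg, norm_one, one_pow, one_mul, mul_pow]
  exact mul_le_mul h1 h2 (by positivity) (by positivity)

lemma triangular_norm_le {t w : ℂ} (hw : ‖w‖ ≤ 1) (m : ℕ) :
    ‖t ^ m * w ^ (m * (m + 1) / 2)‖ ≤ ‖t * w‖ ^ m := by
  have h2 : ‖w‖ ^ (m * (m + 1) / 2) ≤ ‖w‖ ^ m := by
    refine pow_le_pow_of_le_one (norm_nonneg _) hw ?_
    rw [Nat.le_div_iff_mul_le two_pos]
    rcases m.eq_zero_or_pos with rfl | hm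
    · simp
    · exact Nat.mul_le_mul_left m (by omega)
  simp only [norm_mul, norm_pow, mul_pow]
  exact mul_le_mul_of_nonneg_left h2 (by positivity)

lemma summable_sq_pow_mul_pow {t q : ℂ} (ht : ‖t‖ ≤ 1) (hq : ‖q‖ ≤ 1) (htq : ‖t * q‖ < 1) :
    Summable fun k : ℕ => (-1) ^ k * t ^ (2 * k) * q ^ (k ^ 2) :=
  Summable.of_norm_bounded (summable_geometric_of_lt_one (norm_nonneg _) htq)
    (sq_pow_mul_pow_norm_le ht hq)

lemma summable_triangular {t w : ℂ} (hw : ‖w‖ ≤ 1) (htw : ‖t * w‖ < 1) :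
    Summable fun m : ℕ => t ^ m * w ^ (m * (m + 1) / 2) :=
  Summable.of_norm_bounded (summable_geometric_of_lt_one (norm_nonneg _) htw)
    (triangular_norm_le hw)

/-- The conditions on the parameters under which the recursion for `fineSum` can be iterated. -/
structure FineHyp (β q t : ℂ) : Prop where
  ne_zero : ∀ n : ℕ, 1 - β * t * q ^ (n + 1) ≠ 0
  summable : ∀ k : ℕ, Summable fun n => ratioProd β q (t * q ^ (k + 1)) n * (t * q ^ (k + 1)) ^ n
  bounded : ∃ C, ∀ k : ℕ, ‖fineSum β q (t * q ^ (k + 1))‖ ≤ C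

lemma FineHyp.recursion {β q t : ℂ} (h : FineHyp β q t) (k : ℕ) :
    fineSum β q (t * q ^ k) = 1 - t ^ 2 * q ^ (2 * k + 1) +
      t ^ 2 * q ^ (2 * k + 1) * (β - t * q ^ (k + 1)) / (1 - β * t * q ^ (k + 1)) *
        fineSum β q (t * q ^ (k + 1)) := by
  have h1 : t * q ^ k * q = t * q ^ (k + 1) := by rw [pow_succ, mul_assoc]
  have h2 := fineSum_rec (β := β) (q := q) (t := t * q ^ k) (fun n => by
    have := h.ne_zero (k + n)
    rwa [show β * t * q ^ (k + n + 1) = β * (t * q ^ k) * q ^ (n + 1) by ring] at this)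
    (by rw [h1]; exact h.summable k)
  rw [h2, h1]
  congr 1
  · ring
  · rw [show β * (t * q ^ k) * q = β * t * q ^ (k + 1) by ring]
    ring

lemma tendsto_mul_zero_of_bounded {F u : ℕ → ℂ} {C : ℝ} {r : ℝ} (hr0 : 0 ≤ r) (hr : r < 1)
    (hF : ∀ k, ‖F k‖ ≤ r ^ k) (hu : ∀ k, ‖u (k + 1)‖ ≤ C) :
    Tendsto (fun k => F k * u k) atTop (𝓝 0) := by
  rw [← tendsto_add_atTop_iff_nat 1]
  refine squeeze_zero_norm (a := fun k => r ^ (k + 1) * C) (fun k => ?_) ?_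
  · rw [norm_mul]
    exact mul_le_mul (hF _) (hu k) (norm_nonneg _) (by positivity)
  · have := ((tendsto_pow_atTop_nhds_zero_of_lt_one hr0 hr).comp
      (tendsto_add_atTop_nat 1)).mul_const C
    simpa using this

/-- For β = -1 the quotient (β - tq^(k+1))/(1 - βtq^(k+1)) collapses to -1, so the iterated
multipliers are the theta terms a_k. The inhomogeneous parts become a_k + a_{k+1}, which counts
every term twice except a_0. -/
theorem fineSum_neg_one {q t : ℂ} (h : FineHyp (-1) q t) (ht : ‖t‖ ≤ 1) (hq : ‖q‖ ≤ 1)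
    (htq : ‖t * q‖ < 1) :
    fineSum (-1) q t = 2 * (∑' k : ℕ, (-1) ^ k * t ^ (2 * k) * q ^ (k ^ 2)) - 1 := by
  obtain ⟨C, hC⟩ := h.bounded
  set a : ℕ → ℂ := fun k => (-1) ^ k * t ^ (2 * k) * q ^ (k ^ 2) with ha
  have hs : Summable a := summable_sq_pow_mul_pow ht hq htq
  have hs' : Summable fun k => a (k + 1) := (summable_nat_add_iff 1).2 hs
  have hstep : ∀ k, a (k + 1) = a k * -(t ^ 2 * q ^ (2 * k + 1)) := by
    intro k
    simp only [ha]
    ring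
  have hp : ∀ k, a k * (1 - t ^ 2 * q ^ (2 * k + 1)) = a k + a (k + 1) := by
    intro k
    rw [hstep]
    ring
  have key := eq_tsum_of_rec (u := fun k => fineSum (-1) q (t * q ^ k))
    (p := fun k => 1 - t ^ 2 * q ^ (2 * k + 1)) (f := fun k => -(t ^ 2 * q ^ (2 * k + 1)))
    (F := a) (fun k => ?_) (by simp [ha]) hstep ?_ ?_
  · simp only [pow_zero, mul_one, hp] at key
    have h0 : a 0 = 1 := by simp [ha]
    rw [key, hs.tsum_add hs', hs.tsum_eq_zero_add, h0]
    ring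
  · have := h.ne_zero k
    rw [h.recursion k]
    congr 1
    rw [show -1 - t * q ^ (k + 1) = -(1 - -1 * t * q ^ (k + 1)) by ring, mul_neg, neg_div,
      mul_div_cancel_right₀ _ this]
  · exact tendsto_mul_zero_of_bounded (norm_nonneg _) htq (sq_pow_mul_pow_norm_le ht hq) hC
  · simp only [hp]
    exact hs.add hs'

/-- For β = w and q = w² one has β - tq^(k+1) = w(1 - tw^(2k+1)), while the denominator is 1 -
tw^(2k+3). Normalising the k-th value by 1 - tw^(2k+1) therefore makes the multiplier a monomial.
Each step then yields two terms, with exponents the triangular numbers of indices 2k and 2k + 1. -/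
theorem fineSum_sq {w t : ℂ} (h : FineHyp w (w ^ 2) t) (hw : ‖w‖ ≤ 1)
    (htw : ‖t * w‖ < 1)
    (hb : ∃ c > 0, ∀ k : ℕ, c ≤ ‖1 - t * w ^ (2 * k + 1)‖) :
    fineSum w (w ^ 2) t / (1 - t * w) = ∑' m : ℕ, t ^ m * w ^ (m * (m + 1) / 2) := by
  obtain ⟨C, hC⟩ := h.bounded
  obtain ⟨c, hc0, hc⟩ := hb
  set B : ℕ → ℂ := fun m => t ^ m * w ^ (m * (m + 1) / 2) with hB
  have hs : Summable B := summable_triangular hw htw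
  have hBe : ∀ k, B (2 * k) = t ^ (2 * k) * w ^ (k * (2 * k + 1)) := by
    intro k
    simp only [hB]
    rw [show 2 * k * (2 * k + 1) = 2 * (k * (2 * k + 1)) by ring, Nat.mul_div_cancel_left _ two_pos]
  have hBo : ∀ k, B (2 * k + 1) = t ^ (2 * k + 1) * w ^ ((2 * k + 1) * (k + 1)) := by
    intro k
    simp only [hB]
    rw [show (2 * k + 1) * (2 * k + 1 + 1) = 2 * ((2 * k + 1) * (k + 1)) by ring,
      Nat.mul_div_cancel_left _ two_pos]
  have hp : ∀ k, B (2 * k) * (1 + t * w ^ (2 * k + 1)) = B (2 * k) + B (2 * k + 1) := by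
    intro k
    rw [hBe, hBo]
    ring
  have hne : ∀ k : ℕ, 1 - t * w ^ (2 * k + 1) ≠ 0 := by
    intro k hk
    have := hc k
    rw [hk, norm_zero] at this
    linarith
  have hcs : ∀ k : ℕ, w * t * (w ^ 2) ^ (k + 1) = t * w ^ (2 * (k + 1) + 1) := by
    intro k
    ring
  have key := eq_tsum_of_rec (u := fun k => fineSum w (w ^ 2) (t * (w ^ 2) ^ k) /
      (1 - t * w ^ (2 * k + 1)))
    (p := fun k => 1 + t * w ^ (2 * k + 1)) (f := fun k => t ^ 2 * w ^ (4 * k + 3))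
    (F := fun k => B (2 * k)) (fun k => ?_) (by simp [hB]) (fun k => ?_) ?_ ?_
  · simp only [pow_zero, mul_one, mul_zero, zero_add, pow_one, hp] at key
    rw [key, tsum_eq_tsum_pairs hs]
  · have h1 := hne k
    have h2 := hne (k + 1)
    rw [h.recursion k, hcs]
    field_simp
    ring
  · rw [hBe, hBe]
    ring
  · refine tendsto_mul_zero_of_bounded (r := ‖t * w‖) (C := C / c) (norm_nonneg _) htw
      (fun k => (triangular_norm_le hw (2 * k)).trans ?_) (fun k => ?_)
    · exact pow_le_pow_of_le_one (norm_nonneg _) htw.le (by omega)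
    · rw [norm_div]
      have := (norm_nonneg _).trans (hC k)
      exact div_le_div₀ this (hC k) hc0 (hc _)
  · simp only [hp]
    refine Summable.add (hs.comp_injective fun a b h => by simpa using h)
      (hs.comp_injective fun a b h => by simpa using h)

/-! ### The identity at roots of unity -/

lemma prod_one_sub_mul_pow {q : ℂ} {b : ℕ} (hb : 0 < b) (hq : IsPrimitiveRoot q b) (c : ℂ) :
    ∏ j ∈ Finset.range b, (1 - c * q ^ j) = 1 - c ^ b := by
  have h := hq.pow_sub_pow_eq_prod_sub_mul 1 c hb
  rw [one_pow] at h
  rw [h]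
  have himg : (Finset.range b).image (fun j => q ^ j) = Polynomial.nthRootsFinset b (1 : ℂ) := by
    refine Finset.eq_of_subset_of_card_le (fun z hz => ?_) ?_
    · obtain ⟨j, _, rfl⟩ := Finset.mem_image.1 hz
      rw [Polynomial.mem_nthRootsFinset hb, ← pow_mul, mul_comm, pow_mul, hq.pow_eq_one, one_pow]
    · rw [hq.card_nthRootsFinset, Finset.card_image_of_injOn, Finset.card_range]
      intro i hi j hj hij
      exact hq.pow_inj (Finset.mem_range.1 hi) (Finset.mem_range.1 hj) hij
  rw [← himg, Finset.prod_image]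
  · exact Finset.prod_congr rfl fun j _ => by rw [mul_comm]
  · intro i hi j hj hij
    exact hq.pow_inj (Finset.mem_range.1 hi) (Finset.mem_range.1 hj) hij

/-- Over b consecutive factors all b-th roots of unity occur, so the products are 1 - T^b above and
1 - (βT)^b = 1 + T^b below. For the first two series, membership in the domain supplies β^b = -1. -/
lemma ratioProd_period {β q : ℂ} {b : ℕ} (hb : 0 < b) (hq : IsPrimitiveRoot q b)
    (hβ : β ^ b = -1) (T : ℂ) (n : ℕ) :
    ratioProd β q T (n + b) = ratioProd β q T n * ((1 - T ^ b) / (1 + T ^ b)) := by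
  have hqn : (q ^ (n + 1)) ^ b = 1 := by
    rw [← pow_mul, mul_comm, pow_mul, hq.pow_eq_one, one_pow]
  rw [ratioProd, Finset.prod_range_add, ratioProd,
    Finset.prod_div_distrib (f := fun x => 1 - T * q ^ (n + x + 1))]
  have h1 : ∏ x ∈ Finset.range b, (1 - T * q ^ (n + x + 1)) = 1 - T ^ b := by
    have h3 : (1 : ℂ) - T ^ b = 1 - (T * q ^ (n + 1)) ^ b := by rw [mul_pow, hqn, mul_one]
    rw [h3, ← prod_one_sub_mul_pow hb hq]
    exact Finset.prod_congr rfl fun j _ => by ring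
  have h2 : ∏ x ∈ Finset.range b, (1 - β * T * q ^ (n + x + 1)) = 1 + T ^ b := by
    have h3 : (1 : ℂ) + T ^ b = 1 - (β * T * q ^ (n + 1)) ^ b := by
      rw [mul_pow, mul_pow, hβ, hqn]
      ring
    rw [h3, ← prod_one_sub_mul_pow hb hq]
    exact Finset.prod_congr rfl fun j _ => by ring
  rw [h1, h2]

lemma summable_of_quasiperiodic {s : ℕ → ℂ} {b : ℕ} (hb : 0 < b) {ρ : ℂ} (hρ : ‖ρ‖ < 1)
    (hs : ∀ n, s (n + b) = ρ * s n) : Summable s := by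
  have : NeZero b := ⟨hb.ne'⟩
  have hm : ∀ m n, s (n + b * m) = ρ ^ m * s n := by
    intro m n
    induction m with
    | zero => simp
    | succ m ih =>
      rw [show n + b * (m + 1) = n + b * m + b by ring, hs, ih]
      ring
  rw [← (Nat.divModEquiv b).symm.summable_iff]
  have h1 : Summable fun x : ℕ × Fin b => ρ ^ x.1 * s x.2 :=
    summable_mul_of_summable_norm (f := fun m : ℕ => ρ ^ m) (g := fun j : Fin b => s j)
      (by simpa using summable_geometric_of_lt_one (norm_nonneg _) hρ) Summable.of_finite
  refine h1.congr fun x => ?_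
  rw [← hm]
  simp [Nat.divModEquiv, add_comm, mul_comm]

lemma tsum_of_quasiperiodic {s : ℕ → ℂ} {b : ℕ} (hb : 0 < b) {ρ : ℂ} (hρ : ‖ρ‖ < 1)
    (hs : ∀ n, s (n + b) = ρ * s n) :
    ∑' n, s n = (∑ n ∈ Finset.range b, s n) / (1 - ρ) := by
  have h1 := (summable_of_quasiperiodic hb hρ hs).sum_add_tsum_nat_add b
  simp only [hs, tsum_mul_left] at h1
  rw [eq_div_iff (one_sub_ne_zero_of_norm_lt hρ)]
  linear_combination -h1

lemma norm_ratio_lt_one {τ : ℝ} (h0 : 0 < τ) (h1 : τ < 1) :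
    ‖((1 - (τ : ℂ)) / (1 + τ)) * τ‖ < 1 := by
  rw [show ((1 - (τ : ℂ)) / (1 + τ)) * τ = (((1 - τ) / (1 + τ) * τ : ℝ) : ℂ) by push_cast; ring,
    Complex.norm_real, Real.norm_of_nonneg
      (mul_nonneg (div_nonneg (by linarith) (by linarith)) h0.le)]
  have h2 : (1 - τ) / (1 + τ) ≤ 1 := by
    rw [div_le_one (by linarith)]
    linarith
  nlinarith

section RootOfUnity

variable {β q : ℂ} {b : ℕ}

lemma ratioProd_mul_pow_period (hb : 0 < b) (hq : IsPrimitiveRoot q b) (hβ : β ^ b = -1)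
    {T : ℂ} {t : ℝ} (hT : T ^ b = (t : ℂ) ^ b) (n : ℕ) :
    ratioProd β q T (n + b) * T ^ (n + b)
      = ((1 - ((t ^ b : ℝ) : ℂ)) / (1 + ((t ^ b : ℝ) : ℂ)) * ((t ^ b : ℝ) : ℂ)) *
        (ratioProd β q T n * T ^ n) := by
  rw [ratioProd_period hb hq hβ, pow_add, hT]
  push_cast
  ring

lemma summable_ratioProd_mul_pow (hb : 0 < b) (hq : IsPrimitiveRoot q b) (hβ : β ^ b = -1)
    {T : ℂ} {t : ℝ} (ht0 : 0 < t) (ht1 : t < 1) (hT : T ^ b = (t : ℂ) ^ b) :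
    Summable fun n => ratioProd β q T n * T ^ n :=
  summable_of_quasiperiodic hb
    (norm_ratio_lt_one (pow_pos ht0 b) (pow_lt_one₀ ht0.le ht1 hb.ne'))
    (ratioProd_mul_pow_period hb hq hβ hT)

lemma tsum_ratioProd_mul_pow (hb : 0 < b) (hq : IsPrimitiveRoot q b) (hβ : β ^ b = -1)
    {t : ℝ} (ht0 : 0 < t) (ht1 : t < 1) :
    ∑' n, ratioProd β q t n * (t : ℂ) ^ n
      = (∑ n ∈ Finset.range b, ratioProd β q t n * (t : ℂ) ^ n) /
        (1 - ((1 - ((t ^ b : ℝ) : ℂ)) / (1 + ((t ^ b : ℝ) : ℂ)) * ((t ^ b : ℝ) : ℂ))) :=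
  tsum_of_quasiperiodic hb
    (norm_ratio_lt_one (pow_pos ht0 b) (pow_lt_one₀ ht0.le ht1 hb.ne'))
    (ratioProd_mul_pow_period hb hq hβ rfl)

lemma norm_eq_one_of_pow_eq_neg_one (hb : 0 < b) (hβ : β ^ b = -1) : ‖β‖ = 1 := by
  refine norm_eq_one_of_pow_eq_one (n := b * 2) ?_ (by omega)
  rw [pow_mul, hβ]
  norm_num

lemma fineHyp_root_of_unity (hb : 0 < b) (hq : IsPrimitiveRoot q b) (hβ : β ^ b = -1)
    {t : ℝ} (ht0 : 0 < t) (ht1 : t < 1) : FineHyp β q t where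
  ne_zero n := by
    refine one_sub_ne_zero_of_norm_lt ?_
    rw [norm_mul, norm_mul, norm_pow, norm_eq_one_of_pow_eq_neg_one hb hβ,
      hq.norm'_eq_one hb.ne', one_pow, mul_one, one_mul, Complex.norm_real,
      Real.norm_of_nonneg ht0.le]
    exact ht1
  summable k := summable_ratioProd_mul_pow hb hq hβ ht0 ht1 (by
    rw [mul_pow, ← pow_mul, mul_comm (k + 1), pow_mul, hq.pow_eq_one, one_pow, mul_one])
  bounded := by
    -- The points tq^(k+1) take at most b values; summing over residues is a crude bound for the
    -- maximum.
    refine ⟨∑ j ∈ Finset.range b, ‖fineSum β q (t * q ^ j)‖, fun k => ?_⟩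
    rw [pow_eq_pow_mod (k + 1) hq.pow_eq_one]
    exact Finset.single_le_sum (f := fun j => ‖fineSum β q (t * q ^ j)‖)
      (fun _ _ => norm_nonneg _) (Finset.mem_range.2 (Nat.mod_lt _ hb))

lemma one_sub_root_ne_zero (hq : IsPrimitiveRoot q b) (hβ : β ^ b = -1) (j : ℕ) :
    1 - β * q ^ j ≠ 0 := by
  intro h
  have h1 : (β * q ^ j) ^ b = 1 := by
    rw [← sub_eq_zero.1 h, one_pow]
  rw [mul_pow, hβ, ← pow_mul, mul_comm j, pow_mul, hq.pow_eq_one, one_pow] at h1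
  norm_num at h1

/-- For t < 1 the quotient is the sum over one period divided by 1 - ρ, with ρ = t^b(1 - t^b)/(1 +
t^b). Since ρ → 0 as t → 1, only the first period survives, which is the terminating strange sum. -/
theorem tendsto_fineSum_div (hb : 0 < b) (hq : IsPrimitiveRoot q b) (hβ : β ^ b = -1) :
    Tendsto (fun t : ℝ => fineSum β q t / (1 - t)) (𝓝[<] 1)
      (𝓝 (∑ n ∈ Finset.range b, ratioProd β q 1 n)) := by
  have hc : ∀ n, ContinuousAt (fun t : ℝ => ratioProd β q t n * (t : ℂ) ^ n) 1 := by
    intro n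
    refine ContinuousAt.mul ?_ (by fun_prop)
    refine tendsto_finsetProd _ fun j _ => ?_
    refine ContinuousAt.div (f := fun t : ℝ => 1 - (t : ℂ) * q ^ (j + 1)) (by fun_prop)
      (by fun_prop) ?_
    simpa using one_sub_root_ne_zero hq hβ (j + 1)
  have h1 : Tendsto (fun t : ℝ =>
      (∑ n ∈ Finset.range b, ratioProd β q t n * (t : ℂ) ^ n) /
        (1 - ((1 - ((t ^ b : ℝ) : ℂ)) / (1 + ((t ^ b : ℝ) : ℂ)) * ((t ^ b : ℝ) : ℂ)))) (𝓝 1)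
      (𝓝 (∑ n ∈ Finset.range b, ratioProd β q 1 n)) := by
    have h2 : Tendsto (fun t : ℝ => ∑ n ∈ Finset.range b, ratioProd β q t n * (t : ℂ) ^ n) (𝓝 1)
        (𝓝 (∑ n ∈ Finset.range b, ratioProd β q 1 n)) := by
      refine tendsto_finsetSum _ fun n _ => ?_
      have := (hc n).tendsto
      simpa using this
    have h3 : ContinuousAt (fun t : ℝ =>
        (1 - ((1 - ((t ^ b : ℝ) : ℂ)) / (1 + ((t ^ b : ℝ) : ℂ)) * ((t ^ b : ℝ) : ℂ)))) 1 := by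
      refine ContinuousAt.sub continuousAt_const (ContinuousAt.mul (ContinuousAt.div ?_ ?_ ?_) ?_)
      · fun_prop
      · fun_prop
      · norm_num
      · fun_prop
    have h4 := h3.tendsto
    simp only [one_pow, Complex.ofReal_one, sub_self, zero_div, zero_mul, sub_zero] at h4
    have h5 := h2.div h4 one_ne_zero
    rw [div_one] at h5
    exact h5
  refine (h1.mono_left nhdsWithin_le_nhds).congr' ?_
  have hmem : Set.Ioo (0 : ℝ) 1 ∈ 𝓝[<] (1 : ℝ) := Ioo_mem_nhdsLT zero_lt_one
  filter_upwards [hmem] with t ht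
  have ht1 : (1 : ℂ) - t ≠ 0 := by
    rw [sub_ne_zero]
    exact_mod_cast ht.2.ne'
  rw [← tsum_ratioProd_mul_pow hb hq hβ ht.1 ht.2, fineSum_eq_mul_tsum
    (summable_ratioProd_mul_pow hb hq hβ ht.1 ht.2 rfl), mul_div_cancel_left₀ _ ht1]

end RootOfUnity

/-! ### The identity inside the unit disc -/

lemma exists_tendsto_prod_one_sub {q : ℂ} (hq : ‖q‖ < 1) {c : ℂ} (hc : ‖c‖ ≤ 1) :
    ∃ P : ℂ, P ≠ 0 ∧
      Tendsto (fun n => ∏ j ∈ Finset.range n, (1 - c * q ^ (j + 1))) atTop (𝓝 P) := by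
  have hs : Summable fun j : ℕ => ‖-(c * q ^ (j + 1))‖ := by
    have h1 := ((summable_nat_add_iff (f := fun n : ℕ => ‖q‖ ^ n) 1).2
      (summable_geometric_of_lt_one (norm_nonneg _) hq)).mul_left ‖c‖
    simpa using h1
  refine ⟨∏' j : ℕ, (1 + -(c * q ^ (j + 1))),
    tprod_one_add_ne_zero_of_summable (fun j => ?_) hs, ?_⟩
  · rw [← sub_eq_add_neg]
    refine one_sub_ne_zero_of_norm_lt ?_
    rw [norm_mul]
    exact mul_lt_one_of_nonneg_of_lt_one_right hc (norm_nonneg _)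
      (norm_pow_lt_one hq (Nat.succ_ne_zero j))
  · have := (multipliable_one_add_of_summable hs).hasProd.tendsto_prod_nat
    simpa only [sub_eq_add_neg] using this

section Disc

variable {β q : ℂ}

lemma one_sub_disc_ne_zero (hq : ‖q‖ < 1) (hβ : ‖β‖ ≤ 1) (n : ℕ) : 1 - β * q ^ (n + 1) ≠ 0 := by
  refine one_sub_ne_zero_of_norm_lt ?_
  rw [norm_mul]
  exact mul_lt_one_of_nonneg_of_lt_one_right hβ (norm_nonneg _)
    (norm_pow_lt_one hq (Nat.succ_ne_zero n))

lemma exists_tendsto_ratioProd (hq : ‖q‖ < 1) (hβ : ‖β‖ ≤ 1) :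
    ∃ E : ℂ, E ≠ 0 ∧ Tendsto (ratioProd β q 1) atTop (𝓝 E) := by
  obtain ⟨P, hP0, hP⟩ := exists_tendsto_prod_one_sub hq (c := 1) (by simp)
  obtain ⟨R, hR0, hR⟩ := exists_tendsto_prod_one_sub hq hβ
  refine ⟨P / R, div_ne_zero hP0 hR0, (hP.div hR hR0).congr fun n => ?_⟩
  rw [ratioProd]
  simp [Finset.prod_div_distrib]

lemma ratioProd_disc_ne_zero (hq : ‖q‖ < 1) (hβ : ‖β‖ ≤ 1) (n : ℕ) : ratioProd β q 1 n ≠ 0 := by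
  refine Finset.prod_ne_zero_iff.2 fun j _ => div_ne_zero ?_ ?_
  · exact one_sub_disc_ne_zero hq (by simp) j
  · simpa using one_sub_disc_ne_zero hq hβ j

/-- The product started at q^k is a quotient of two products started at 1. These converge to a
non-zero limit, so they and their inverses are bounded, uniformly in k. -/
lemma exists_bound_ratioProd (hq : ‖q‖ < 1) (hβ : ‖β‖ ≤ 1) :
    ∃ C, ∀ k n, ‖ratioProd β q (q ^ k) n‖ ≤ C := by
  obtain ⟨E, hE0, hE⟩ := exists_tendsto_ratioProd hq hβ
  obtain ⟨M, hM⟩ := (Metric.isBounded_range_of_tendsto _ hE).exists_norm_le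
  obtain ⟨m, hm⟩ := (Metric.isBounded_range_of_tendsto _ (hE.inv₀ hE0)).exists_norm_le
  refine ⟨m * M, fun k n => ?_⟩
  have h1 : ratioProd β q (q ^ k) n = (ratioProd β q 1 k)⁻¹ * ratioProd β q 1 (n + k) := by
    rw [ratioProd_add, one_mul, inv_mul_cancel_left₀ (ratioProd_disc_ne_zero hq hβ k)]
  rw [h1, norm_mul]
  have h2 := hm _ (Set.mem_range_self k)
  have h3 := hM _ (Set.mem_range_self (n + k))
  exact mul_le_mul h2 h3 (norm_nonneg _) ((norm_nonneg _).trans h2)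

lemma norm_term_le {C : ℝ} (hq : ‖q‖ < 1) (hC : ∀ k n, ‖ratioProd β q (q ^ k) n‖ ≤ C) (k n : ℕ) :
    ‖ratioProd β q (q ^ (k + 1)) n * (q ^ (k + 1)) ^ n‖ ≤ C * ‖q‖ ^ n := by
  rw [norm_mul]
  refine mul_le_mul (hC _ _) ?_ (norm_nonneg _) ((norm_nonneg _).trans (hC 0 0))
  rw [← pow_mul, norm_pow]
  exact pow_le_pow_of_le_one (norm_nonneg _) hq.le (Nat.le_mul_of_pos_left _ (by omega))

lemma fineHyp_disc (hq : ‖q‖ < 1) (hβ : ‖β‖ ≤ 1) : FineHyp β q 1 := by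
  obtain ⟨C, hC⟩ := exists_bound_ratioProd hq hβ
  have hg := (summable_geometric_of_lt_one (norm_nonneg q) hq).mul_left C
  have hs : ∀ k : ℕ, Summable fun n => ratioProd β q (q ^ (k + 1)) n * (q ^ (k + 1)) ^ n :=
    fun k => Summable.of_norm_bounded hg (norm_term_le hq hC k)
  refine ⟨fun n => by simpa using one_sub_disc_ne_zero hq hβ n, by simpa only [one_mul] using hs,
    2 * ∑' n, C * ‖q‖ ^ n, fun k => ?_⟩
  rw [one_mul, fineSum_eq_mul_tsum (hs k), norm_mul]
  refine mul_le_mul ?_ (tsum_of_norm_bounded hg.hasSum (norm_term_le hq hC k)) (norm_nonneg _)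
    zero_le_two
  refine (norm_sub_le _ _).trans ?_
  rw [norm_one]
  linarith [norm_pow_lt_one hq (Nat.succ_ne_zero k)]

/-- At t = 1 the series of differences telescopes, so its sum is the infinite product. This is where
Rogers–Fine becomes an identity between an eta-quotient and a theta series. -/
lemma tendsto_ratioProd_fineSum (hq : ‖q‖ < 1) (hβ : ‖β‖ ≤ 1) :
    Tendsto (ratioProd β q 1) atTop (𝓝 (fineSum β q 1)) := by
  obtain ⟨C, hC⟩ := exists_bound_ratioProd hq hβ
  have hs : Summable fun n => (ratioProd β q 1 (n + 1) - ratioProd β q 1 n) * 1 ^ (n + 1) := by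
    refine Summable.of_norm_bounded (g := fun n : ℕ => (2 * C) * ‖q‖ ^ n)
      ((summable_geometric_of_lt_one (norm_nonneg q) hq).mul_left _) fun n => ?_
    have h1 := hC 0 (n + 1)
    have h2 := hC 0 n
    rw [pow_zero] at h1 h2
    rw [one_pow, mul_one,
      ratioProd_succ_sub (by simpa using one_sub_disc_ne_zero hq hβ n), one_mul, norm_mul,
      norm_pow, mul_comm]
    have h3 : ‖q‖ ^ (n + 1) ≤ ‖q‖ ^ n :=
      pow_le_pow_of_le_one (norm_nonneg _) hq.le (Nat.le_succ n)
    refine mul_le_mul ?_ h3 (by positivity) (by linarith [norm_nonneg (ratioProd β q 1 n)])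
    refine (norm_sub_le _ _).trans ?_
    rw [norm_mul]
    have := mul_le_mul hβ h1 (norm_nonneg _) zero_le_one
    linarith
  have h1 := hs.hasSum.tendsto_sum_nat.const_add 1
  refine h1.congr fun n => ?_
  simp only [one_pow, mul_one]
  rw [Finset.sum_range_sub, ratioProd_zero]
  ring

end Disc

/-! ### The eta-quotients as theta series -/

/-- The theta series `∑ c_n q ^ (r (n + a) ^ 2)`, `n ∈ ℤ`, at `q = e ^ (2 π i z)`. -/
def thetaSeries (c : ℤ → ℂ) (a r : ℝ) (z : ℂ) : ℂ :=
  ∑' n : ℤ, c n * Complex.exp (2 * Real.pi * I * (r * (n + a) ^ 2) * z)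

lemma norm_qpow_lt_one {r : ℝ} (hr : 0 < r) {z : ℂ} (hz : 0 < z.im) : ‖qpow r z‖ < 1 := by
  rw [qpow, Complex.norm_exp, Real.exp_lt_one_iff]
  have : (2 * (Real.pi : ℂ) * I * r * z).re = -(2 * Real.pi * r * z.im) := by
    simp [Complex.mul_re, Complex.mul_im]
  rw [this, neg_lt_zero]
  have := Real.pi_pos
  positivity

lemma norm_qpow_one_lt_one {z : ℂ} (hz : 0 < z.im) : ‖qpow 1 z‖ < 1 := by
  simpa using norm_qpow_lt_one one_pos hz

lemma tendsto_eta {z : ℂ} (hz : 0 < z.im) :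
    Tendsto (fun n => qpow (1 / 24) z * ∏ j ∈ Finset.range n, (1 - qpow 1 z ^ (j + 1))) atTop
      (𝓝 (ModularForm.eta z)) := by
  have h := (ModularForm.multipliableLocallyUniformlyOn_eta.multipliable hz).hasProd.tendsto_prod_nat
  have h1 := h.const_mul (Function.Periodic.qParam 24 z)
  refine h1.congr fun n => ?_
  congr 1
  · rw [Function.Periodic.qParam, qpow]
    congr 1
    push_cast
    ring
  · refine Finset.prod_congr rfl fun j _ => ?_
    rw [ModularForm.eta_q_eq_pow, qpow, mul_one]

lemma eta_add_one (z : ℂ) : ModularForm.eta (z + 1) = zeta 24 * ModularForm.eta z := by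
  have h : ∀ n, ModularForm.eta_q n (z + 1) = ModularForm.eta_q n z := by
    intro n
    rw [ModularForm.eta_q_eq_pow, ModularForm.eta_q_eq_pow, mul_add, mul_one, Complex.exp_add,
      Complex.exp_two_pi_mul_I, mul_one]
  simp only [ModularForm.eta, h, ← mul_assoc]
  congr 1
  rw [Function.Periodic.qParam, Function.Periodic.qParam, zeta, ← Complex.exp_add]
  congr 1
  push_cast
  ring

lemma theta_one_add_one (z : ℂ) : theta 1 (z + 1) = zeta 12 * theta 2 z := by
  have h : zeta 24 ^ 2 = zeta 12 := by
    rw [zeta, zeta, ← Complex.exp_nat_mul]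
    congr 1
    push_cast
    ring
  simp only [theta]
  rw [eta_add_one, mul_pow, h, add_div]
  ring

/-- The third theta function is a translate of the second; its theta series and Eichler integral are
obtained from this. -/
lemma theta_two_eq (z : ℂ) : theta 2 z = (zeta 12)⁻¹ * theta 1 (z + 1) := by
  rw [theta_one_add_one, inv_mul_cancel_left₀ (zeta_ne_zero 12)]

lemma theta_zero_eq_fineSum {z : ℂ} (hz : 0 < z.im) :
    theta 0 z = fineSum (-1) (qpow 1 z) 1 := by
  have hq := norm_qpow_one_lt_one hz
  have hz2 : 0 < (2 * z).im := by simpa using hz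
  have h2 : qpow 1 (2 * z) = qpow 1 z ^ 2 := by
    rw [qpow, qpow, ← Complex.exp_nat_mul]
    congr 1
    push_cast
    ring
  have h24 : qpow (1 / 24) (2 * z) = qpow (1 / 24) z ^ 2 := by
    rw [qpow, qpow, ← Complex.exp_nat_mul]
    congr 1
    push_cast
    ring
  have hlim := ((tendsto_eta hz).pow 2).div (tendsto_eta hz2)
    (ModularForm.eta_ne_zero hz2)
  refine tendsto_nhds_unique hlim
    ((tendsto_ratioProd_fineSum hq (β := -1) (by simp)).congr fun n => ?_)
  simp only [Pi.div_apply]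
  rw [h2, h24, mul_pow, mul_div_mul_left _ _ (pow_ne_zero 2 (qpow_ne_zero _ _)), ratioProd,
    ← Finset.prod_pow, ← Finset.prod_div_distrib]
  refine Finset.prod_congr rfl fun j _ => ?_
  have h3 : 1 - qpow 1 z ^ (j + 1) ≠ 0 := one_sub_ne_zero_of_norm_lt
    (norm_pow_lt_one hq (Nat.succ_ne_zero j))
  have h4 : 1 - -1 * 1 * qpow 1 z ^ (j + 1) ≠ 0 := by
    have := one_sub_disc_ne_zero hq (β := -1) (by simp) j
    simpa using this
  have h5 : 1 - (qpow 1 z ^ 2) ^ (j + 1)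
      = (1 - qpow 1 z ^ (j + 1)) * (1 - -1 * 1 * qpow 1 z ^ (j + 1)) := by ring
  rw [h5, one_mul, sq, mul_div_mul_left _ _ h3]

/-- The product (w;w)_{2n+2} splits into odd powers (w;w²)_{n+1}, which cancel the denominator, and
even powers (w²;w²)_{n+1}. -/
lemma ratioProd_mul_prod {w : ℂ} (hw : ‖w‖ < 1) (n : ℕ) :
    ratioProd w (w ^ 2) 1 n / (1 - w) * ∏ j ∈ Finset.range (2 * n + 2), (1 - w ^ (j + 1))
      = (∏ j ∈ Finset.range n, (1 - (w ^ 2) ^ (j + 1))) *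
        ∏ j ∈ Finset.range (n + 1), (1 - (w ^ 2) ^ (j + 1)) := by
  have hw1 := one_sub_ne_zero_of_norm_lt hw
  induction n with
  | zero =>
    rw [ratioProd_zero, mul_zero, zero_add, Finset.prod_range_succ, Finset.prod_range_one]
    simp only [zero_add, pow_one, Finset.range_zero, Finset.prod_empty, Finset.prod_range_one]
    field_simp
  | succ n ih =>
    have h1 : 1 - w * 1 * (w ^ 2) ^ (n + 1) ≠ 0 := by
      rw [mul_one, ← pow_mul, ← pow_succ']
      exact one_sub_ne_zero_of_norm_lt (norm_pow_lt_one hw (by omega))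
    have h2 : (1 - w ^ (2 * n + 2 + 1)) = 1 - w * 1 * (w ^ 2) ^ (n + 1) := by ring
    rw [ratioProd_succ, show 2 * (n + 1) + 2 = 2 * n + 2 + 1 + 1 by ring, Finset.prod_range_succ,
      Finset.prod_range_succ, Finset.prod_range_succ _ (n + 1), Finset.prod_range_succ _ n, h2,
      show ∀ a b c d e f : ℂ, a * (b / c) / d * (e * c * f) = (a / d * e) * (b * f) * (c / c) by
        intros; ring, div_self h1, ih, Finset.prod_range_succ _ n]
    ring

lemma theta_one_eq_fineSum {z : ℂ} (hz : 0 < z.im) :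
    theta 1 z = qpow (1 / 16) z *
      (fineSum (qpow (1 / 2) z) (qpow (1 / 2) z ^ 2) 1 / (1 - qpow (1 / 2) z)) := by
  set w := qpow (1 / 2) z with hw
  have hw1 : ‖w‖ < 1 := by
    have := norm_qpow_lt_one (r := 1 / 2) (by norm_num) hz
    rw [hw]
    convert this using 3
    push_cast
    rfl
  have hq : ‖w ^ 2‖ < 1 := norm_pow_lt_one hw1 two_ne_zero
  have hz2 : 0 < (z / 2).im := by
    rw [show z / 2 = ((1 / 2 : ℝ) : ℂ) * z by push_cast; ring, Complex.im_ofReal_mul]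
    linarith
  have h2 : qpow 1 (z / 2) = w := by
    rw [hw, qpow, qpow]
    congr 1
    ring
  have hpre : qpow (1 / 24) z * qpow (1 / 24) z = qpow (1 / 16) z * qpow (1 / 24) (z / 2) := by
    rw [qpow, qpow, qpow, ← Complex.exp_add, ← Complex.exp_add]
    congr 1
    ring
  -- The truncations have different lengths, n and n + 1 for the two factors η(z) and 2n + 2 for
  -- η(z/2), to match `ratioProd_mul_prod` exactly.
  have hlim := (((tendsto_eta hz).mul ((tendsto_eta hz).comp (tendsto_add_atTop_nat 1)))).div
    ((tendsto_eta hz2).comp (f := fun n : ℕ => 2 * n + 2)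
      (tendsto_atTop_mono (fun n => by omega : ∀ n : ℕ, n ≤ 2 * n + 2) tendsto_id))
    (ModularForm.eta_ne_zero hz2)
  have hth : theta 1 z = ModularForm.eta z * ModularForm.eta z / ModularForm.eta (z / 2) := by
    rw [← sq]
    rfl
  rw [hth]
  refine tendsto_nhds_unique hlim ((((tendsto_ratioProd_fineSum hq hw1.le).div_const
    (1 - w)).const_mul (qpow (1 / 16) z)).congr fun n => ?_)
  simp only [Pi.div_apply, Function.comp_apply]
  rw [h2, eq_div_iff, qpow_one_eq_sq, ← hw]
  · rw [show ∀ a b c d : ℂ, a * b * (c * d) = a * c * (b * d) by intros; ring, ← hpre,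
      ratioProd_mul_prod hw1]
    ring
  · refine mul_ne_zero (qpow_ne_zero _ _) (Finset.prod_ne_zero_iff.2 fun j _ => ?_)
    exact one_sub_ne_zero_of_norm_lt (norm_pow_lt_one hw1 (Nat.succ_ne_zero j))

lemma qpow_half_norm_lt_one {z : ℂ} (hz : 0 < z.im) : ‖qpow (1 / 2) z‖ < 1 := by
  have := norm_qpow_lt_one (r := 1 / 2) (by norm_num) hz
  convert this using 3
  push_cast
  rfl

lemma exists_pos_le_norm_one_sub {t w : ℂ} (hw : ‖w‖ ≤ 1) (htw : ‖t * w‖ < 1) :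
    ∃ c > 0, ∀ k : ℕ, c ≤ ‖1 - t * w ^ (2 * k + 1)‖ := by
  refine ⟨1 - ‖t * w‖, by linarith, fun k => ?_⟩
  have h1 : ‖t * w ^ (2 * k + 1)‖ ≤ ‖t * w‖ := by
    rw [pow_succ', ← mul_assoc, norm_mul, norm_pow]
    exact mul_le_of_le_one_right (norm_nonneg _) (pow_le_one₀ (norm_nonneg _) hw)
  have h2 := norm_sub_norm_le 1 (t * w ^ (2 * k + 1))
  rw [norm_one] at h2
  linarith

/-- Turning a series over `ℕ` into a symmetric series over `ℤ`. -/
lemma hasSum_int_of_even {f : ℤ → ℂ} {g : ℕ → ℂ} (h1 : ∀ n : ℕ, f n = g n)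
    (h2 : ∀ n : ℕ, f (-n) = g n) (hg : Summable g) : HasSum f (2 * (∑' n, g n) - g 0) := by
  have h3 : HasSum (fun n : ℕ => f n) (∑' n, g n) := by simpa only [h1] using hg.hasSum
  have h4 : HasSum (fun n : ℕ => f (-n)) (∑' n, g n) := by simpa only [h2] using hg.hasSum
  have h5 := HasSum.of_nat_of_neg h3 h4
  have h6 : f 0 = g 0 := by simpa using h1 0
  rwa [h6, ← two_mul] at h5

/-- Meant for the exponents (n + 1/2)², which are invariant under n ↦ -n - 1; each value occurs
twice over ℤ, hence the coefficient 1/2 in the theta series. -/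
lemma hasSum_int_of_half {f : ℤ → ℂ} {g : ℕ → ℂ} (h1 : ∀ n : ℕ, f n = g n / 2)
    (h2 : ∀ n : ℕ, f (-(n + 1)) = g n / 2) (hg : Summable g) : HasSum f (∑' n, g n) := by
  have h3 : HasSum (fun n : ℕ => f n) ((∑' n, g n) / 2) := by
    simpa only [h1] using hg.hasSum.div_const 2
  have h4 : HasSum (fun n : ℕ => f (-(n + 1))) ((∑' n, g n) / 2) := by
    simpa only [h2] using hg.hasSum.div_const 2
  have h5 := HasSum.of_nat_of_neg_add_one h3 h4
  rwa [add_halves] at h5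

/-- The coefficients of the theta series of `θᵢ`. -/
def thetaCoeff : Fin 3 → ℤ → ℂ
  | 0, n => (-1) ^ n
  | 1, _ => 1 / 2
  | 2, n => (zeta 12)⁻¹ * (1 / 2 * Complex.exp (2 * Real.pi * I * (1 / 4 * (n + 1 / 2) ^ 2)))

/-- The shift in the exponents of the theta series of `θᵢ`. -/
def thetaShift : Fin 3 → ℝ
  | 0 => 0
  | 1 => 1 / 2
  | 2 => 1 / 2

/-- The scaling of the exponents of the theta series of `θᵢ`. -/
def thetaScale : Fin 3 → ℝ
  | 0 => 1
  | 1 => 1 / 4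
  | 2 => 1 / 4

lemma thetaScale_pos (i : Fin 3) : 0 < thetaScale i := by
  fin_cases i <;> simp [thetaScale]

lemma norm_thetaCoeff_le (i : Fin 3) (n : ℤ) : ‖thetaCoeff i n‖ ≤ 1 := by
  fin_cases i
  · simp [thetaCoeff]
  · simp [thetaCoeff]
    norm_num
  · have h : ‖Complex.exp (2 * Real.pi * I * (1 / 4 * (n + 1 / 2) ^ 2))‖ = 1 := by
      rw [show 2 * (Real.pi : ℂ) * I * (1 / 4 * (n + 1 / 2) ^ 2)
        = ((2 * Real.pi * (1 / 4 * (n + 1 / 2) ^ 2) : ℝ) : ℂ) * I by push_cast; ring]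
      exact Complex.norm_exp_ofReal_mul_I _
    have h2 : ‖thetaCoeff 2 n‖ = 1 / 2 := by
      rw [thetaCoeff, norm_mul, norm_mul, h, norm_inv, norm_zeta]
      norm_num
    change ‖thetaCoeff 2 n‖ ≤ 1
    rw [h2]
    norm_num

lemma thetaTerm_zero_nat (z : ℂ) (n : ℕ) :
    thetaCoeff 0 n * Complex.exp (2 * Real.pi * I *
      ((thetaScale 0 : ℝ) * (((n : ℤ) : ℂ) + (thetaShift 0 : ℝ)) ^ 2) * z)
      = (-1) ^ n * 1 ^ (2 * n) * qpow 1 z ^ (n ^ 2) := by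
  simp only [thetaCoeff, thetaScale, thetaShift]
  rw [← qpow_nat_mul, qpow, one_pow, mul_one, zpow_natCast]
  congr 2
  push_cast
  ring

lemma theta_zero_eq_thetaSeries {z : ℂ} (hz : 0 < z.im) :
    theta 0 z = thetaSeries (thetaCoeff 0) (thetaShift 0) (thetaScale 0) z := by
  have hq := norm_qpow_one_lt_one hz
  have hs := summable_sq_pow_mul_pow (t := 1) (by simp) hq.le (by simpa using hq)
  rw [theta_zero_eq_fineSum hz, fineSum_neg_one (fineHyp_disc hq (by simp)) (by simp) hq.le
    (by simpa using hq)]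
  refine (HasSum.tsum_eq ?_).symm
  have := hasSum_int_of_even (f := fun n : ℤ => thetaCoeff 0 n * Complex.exp (2 * Real.pi * I *
      ((thetaScale 0 : ℝ) * ((n : ℂ) + (thetaShift 0 : ℝ)) ^ 2) * z))
    (fun n => thetaTerm_zero_nat z n) (fun n => ?_) hs
  · simpa using this
  · rw [← thetaTerm_zero_nat]
    simp only [thetaCoeff, thetaShift]
    rw [zpow_neg, ← inv_zpow, show (-1 : ℂ)⁻¹ = -1 by norm_num]
    congr 3
    push_cast
    ring

lemma thetaTerm_one_nat (z : ℂ) (n : ℕ) :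
    thetaCoeff 1 n * Complex.exp (2 * Real.pi * I *
      ((thetaScale 1 : ℝ) * (((n : ℤ) : ℂ) + (thetaShift 1 : ℝ)) ^ 2) * z)
      = qpow (1 / 16) z * (1 ^ n * qpow (1 / 2) z ^ (n * (n + 1) / 2)) / 2 := by
  simp only [thetaCoeff, thetaScale, thetaShift]
  rw [← qpow_nat_mul, one_pow, one_mul, ← qpow_add, qpow, Nat.cast_div]
  · rw [mul_comm, mul_one_div]
    congr 2
    push_cast
    ring
  · exact (Nat.even_mul_succ_self n).two_dvd
  · norm_num

lemma theta_one_eq_thetaSeries {z : ℂ} (hz : 0 < z.im) :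
    theta 1 z = thetaSeries (thetaCoeff 1) (thetaShift 1) (thetaScale 1) z := by
  have hw := qpow_half_norm_lt_one hz
  have hs := summable_triangular (t := 1) hw.le (by simpa using hw)
  have hq : ‖qpow (1 / 2) z ^ 2‖ < 1 := norm_pow_lt_one hw two_ne_zero
  have h1 := fineSum_sq (fineHyp_disc hq hw.le) hw.le (by simpa using hw)
    (exists_pos_le_norm_one_sub hw.le (by simpa using hw))
  rw [one_mul] at h1
  rw [theta_one_eq_fineSum hz, h1, ← tsum_mul_left]
  refine (HasSum.tsum_eq ?_).symm
  refine hasSum_int_of_half (thetaTerm_one_nat z) (fun n => ?_) (hs.mul_left _)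
  rw [← thetaTerm_one_nat]
  simp only [thetaCoeff, thetaShift]
  congr 2
  push_cast
  ring

lemma theta_two_eq_thetaSeries {z : ℂ} (hz : 0 < z.im) :
    theta 2 z = thetaSeries (thetaCoeff 2) (thetaShift 2) (thetaScale 2) z := by
  have hz1 : 0 < (z + 1).im := by simpa using hz
  rw [theta_two_eq, theta_one_eq_thetaSeries hz1, thetaSeries, thetaSeries, ← tsum_mul_left]
  refine tsum_congr fun n => ?_
  simp only [thetaCoeff, thetaShift, thetaScale]
  rw [mul_add, mul_one, Complex.exp_add]
  push_cast
  ring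

theorem theta_eq_thetaSeries (i : Fin 3) {z : ℂ} (hz : 0 < z.im) :
    theta i z = thetaSeries (thetaCoeff i) (thetaShift i) (thetaScale i) z := by
  fin_cases i
  · exact theta_zero_eq_thetaSeries hz
  · exact theta_one_eq_thetaSeries hz
  · exact theta_two_eq_thetaSeries hz

section

open HurwitzZeta

/-! ### Bounds for theta series -/

lemma evenKernel_nonneg (a : ℝ) {t : ℝ} (ht : 0 < t) : 0 ≤ evenKernel a t :=
  (hasSum_int_evenKernel a ht).nonneg fun _ => (Real.exp_pos _).le

lemma evenKernel_antitone (a : ℝ) {s t : ℝ} (hs : 0 < s) (hst : s ≤ t) :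
    evenKernel a t ≤ evenKernel a s := by
  refine hasSum_le (fun n => ?_) (hasSum_int_evenKernel a (hs.trans_le hst))
    (hasSum_int_evenKernel a hs)
  rw [Real.exp_le_exp]
  have h1 : 0 ≤ Real.pi * ((n : ℝ) + a) ^ 2 := by positivity
  nlinarith

/-- Away from 0 the kernel is decreasing. Near 0 the functional equation rewrites it as t^(-1/2)
times a cosine kernel at 1/t, which is bounded. -/
lemma exists_evenKernel_le (a : ℝ) :
    ∃ C > 0, ∀ t > 0, evenKernel a t ≤ C * (1 + t ^ (-(1 / 2) : ℝ)) := by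
  obtain ⟨p, hp, hO⟩ := isBigO_atTop_cosKernel_sub (a : UnitAddCircle)
  obtain ⟨C, hC⟩ := hO.bound
  obtain ⟨s, hs⟩ := eventually_atTop.1 hC
  set s' := max s 1
  have hs' : 0 < s' := lt_of_lt_of_le one_pos (le_max_right _ _)
  have hE := evenKernel_nonneg a (one_div_pos.2 hs')
  refine ⟨|C| + 1 + evenKernel a (1 / s'), by positivity, fun t ht => ?_⟩
  have ht' : 0 ≤ t ^ (-(1 / 2) : ℝ) := Real.rpow_nonneg ht.le _
  rcases le_total (1 / s') t with h | h
  · have := evenKernel_antitone a (one_div_pos.2 hs') h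
    nlinarith [abs_nonneg C, mul_nonneg (abs_nonneg C) ht', mul_nonneg hE ht']
  · have h1 : s ≤ 1 / t := (le_max_left _ _).trans (by
      rw [le_div_iff₀ ht]
      rwa [le_div_iff₀ hs', mul_comm] at h)
    have h2 := hs _ h1
    have h3 : cosKernel a (1 / t) ≤ |C| + 1 := by
      have h4 : ‖Real.exp (-p * (1 / t))‖ ≤ 1 := by
        rw [Real.norm_of_nonneg (Real.exp_pos _).le, Real.exp_le_one_iff]
        have : 0 < 1 / t := by positivity
        nlinarith
      have h5 : C * ‖Real.exp (-p * (1 / t))‖ ≤ |C| := by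
        refine (mul_le_mul_of_nonneg_right (le_abs_self C) (norm_nonneg _)).trans ?_
        exact mul_le_of_le_one_right (abs_nonneg _) h4
      have h6 := (le_abs_self _).trans (h2.trans h5)
      linarith
    rw [evenKernel_functional_equation, one_div, ← Real.rpow_neg ht.le]
    have := mul_le_mul_of_nonneg_left h3 ht'
    nlinarith [abs_nonneg C, mul_nonneg (abs_nonneg C) ht', mul_nonneg hE ht']

section General

variable {c : ℤ → ℂ} {a r : ℝ}

lemma norm_thetaExp (a r : ℝ) (z : ℂ) (n : ℤ) :
    ‖Complex.exp (2 * Real.pi * I * (r * (n + a) ^ 2) * z)‖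
      = Real.exp (-Real.pi * (n + a) ^ 2 * (2 * r * z.im)) := by
  rw [Complex.norm_exp]
  congr 1
  rw [show 2 * (Real.pi : ℂ) * I * (r * (n + a) ^ 2) * z
    = ((2 * Real.pi * (r * (n + a) ^ 2) : ℝ) : ℂ) * (z * I) by push_cast; ring,
    Complex.re_ofReal_mul, Complex.mul_I_re]
  ring

lemma norm_thetaTerm_le (hc : ∀ n, ‖c n‖ ≤ 1) (z : ℂ) (n : ℤ) :
    ‖c n * Complex.exp (2 * Real.pi * I * (r * (n + a) ^ 2) * z)‖
      ≤ Real.exp (-Real.pi * (n + a) ^ 2 * (2 * r * z.im)) := by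
  rw [norm_mul, norm_thetaExp]
  exact mul_le_of_le_one_left (Real.exp_pos _).le (hc n)

lemma summable_thetaTerm (hc : ∀ n, ‖c n‖ ≤ 1) (hr : 0 < r) {z : ℂ} (hz : 0 < z.im) :
    Summable fun n : ℤ => c n * Complex.exp (2 * Real.pi * I * (r * (n + a) ^ 2) * z) :=
  Summable.of_norm_bounded (hasSum_int_evenKernel a (t := 2 * r * z.im) (by positivity)).summable
    (norm_thetaTerm_le hc z)

lemma norm_thetaSeries_le (hc : ∀ n, ‖c n‖ ≤ 1) (hr : 0 < r) {z : ℂ} (hz : 0 < z.im) :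
    ‖thetaSeries c a r z‖ ≤ evenKernel a (2 * r * z.im) :=
  tsum_of_norm_bounded (hasSum_int_evenKernel a (by positivity)) (norm_thetaTerm_le hc z)

/-- A horizontal shift by s multiplies the n-th term by a phase within 2πr(n+a)²|s| of 1. Half of
the Gaussian absorbs the factor (n+a)² through ye^(-y) ≤ 1, and the other half remains as the kernel
at r·Im z. This controls θ at points slightly off the vertical line above a cusp. -/
lemma norm_thetaSeries_add_sub_le (hc : ∀ n, ‖c n‖ ≤ 1) (hr : 0 < r) {z : ℂ} (hz : 0 < z.im)
    (s : ℝ) :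
    ‖thetaSeries c a r (z + s) - thetaSeries c a r z‖
      ≤ 2 * |s| / z.im * evenKernel a (r * z.im) := by
  have hz' : 0 < (z + s).im := by simpa using hz
  rw [thetaSeries, thetaSeries, ← (summable_thetaTerm hc hr hz').tsum_sub
    (summable_thetaTerm hc hr hz)]
  refine tsum_of_norm_bounded ((hasSum_int_evenKernel a (t := r * z.im)
    (by positivity)).mul_left _) fun n => ?_
  have h1 : c n * Complex.exp (2 * Real.pi * I * (r * (n + a) ^ 2) * (z + s))
      - c n * Complex.exp (2 * Real.pi * I * (r * (n + a) ^ 2) * z)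
      = c n * Complex.exp (2 * Real.pi * I * (r * (n + a) ^ 2) * z) *
        (Complex.exp (I * ((2 * Real.pi * (r * (n + a) ^ 2) * s : ℝ) : ℂ)) - 1) := by
    rw [mul_add, Complex.exp_add]
    push_cast
    ring_nf
  set u : ℝ := r * ((n : ℝ) + a) ^ 2 with hu
  have hu0 : 0 ≤ u := by positivity
  have h2 : ‖Complex.exp (I * ((2 * Real.pi * u * s : ℝ) : ℂ)) - 1‖ ≤ 2 * Real.pi * u * |s| := by
    refine (Real.norm_exp_I_mul_ofReal_sub_one_le).trans ?_
    rw [Real.norm_eq_abs, abs_mul, abs_of_nonneg (by positivity)]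
  rw [h1, norm_mul]
  refine (mul_le_mul (norm_thetaTerm_le hc z n) h2 (norm_nonneg _) (Real.exp_pos _).le).trans ?_
  have h3 : Real.exp (-Real.pi * (n + a) ^ 2 * (2 * r * z.im))
      = Real.exp (-(Real.pi * u * z.im)) * Real.exp (-Real.pi * (n + a) ^ 2 * (r * z.im)) := by
    rw [← Real.exp_add, hu]
    congr 1
    ring
  have h4 : Real.pi * u * z.im * Real.exp (-(Real.pi * u * z.im)) ≤ 1 := by
    rw [Real.exp_neg, ← div_eq_mul_inv, div_le_one (Real.exp_pos _)]
    linarith [Real.add_one_le_exp (Real.pi * u * z.im)]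
  rw [h3]
  calc _ = (Real.pi * u * z.im * Real.exp (-(Real.pi * u * z.im))) *
        (2 * |s| / z.im * Real.exp (-Real.pi * (n + a) ^ 2 * (r * z.im))) := by
        field_simp
    _ ≤ 1 * (2 * |s| / z.im * Real.exp (-Real.pi * (n + a) ^ 2 * (r * z.im))) :=
        mul_le_mul_of_nonneg_right h4 (by positivity)
    _ = _ := one_mul _

lemma thetaExp_I_mul {M : ℝ} (hM : M ≠ 0) (a y : ℝ) (j : ℕ) (l : ℤ) :
    Complex.exp (2 * Real.pi * I * (r * (((j : ℂ) + l * (M : ℂ)) + a) ^ 2) * (I * y))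
      = (Real.exp (-Real.pi * ((l : ℝ) + ((j : ℝ) + a) / M) ^ 2 * (2 * r * M ^ 2 * y)) : ℂ) := by
  have hM' : (M : ℂ) ≠ 0 := by exact_mod_cast hM
  rw [ofReal_exp]
  congr 1
  have h : ((l : ℂ) + ((j : ℂ) + a) / M) * M = (j : ℂ) + l * M + a := by
    field_simp
    ring
  push_cast
  rw [← h]
  linear_combination
    (2 * (Real.pi : ℂ) * r * (((l : ℂ) + ((j : ℂ) + a) / M) * M) ^ 2 * y) * I_sq

lemma exists_residue_equiv {M : ℕ} (hM : 0 < M) :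
    ∃ e : Fin M × ℤ ≃ ℤ, ∀ p, e p = ((p.1 : ℕ) : ℤ) + p.2 * M := by
  have : NeZero M := ⟨hM.ne'⟩
  refine ⟨((Int.divModEquiv M).trans (Equiv.prodComm _ _)).symm, fun p => ?_⟩
  simp [Int.divModEquiv, add_comm]

lemma thetaSeries_I_mul_eq_sum (hc : ∀ n, ‖c n‖ ≤ 1) (hr : 0 < r) {M : ℕ} (hM : 0 < M)
    (hper : ∀ n, c (n + M) = c n) {y : ℝ} (hy : 0 < y) :
    thetaSeries c a r (I * y) = ∑ j : Fin M,
      c (j : ℕ) * evenKernel (((((j : ℕ) : ℝ) + a) / M : ℝ) : UnitAddCircle)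
        (2 * r * M ^ 2 * y) := by
  have hM' : (M : ℝ) ≠ 0 := by exact_mod_cast hM.ne'
  have hM0 : (0 : ℝ) < M := by exact_mod_cast hM
  have hy' : 0 < (I * (y : ℂ)).im := by simpa using hy
  obtain ⟨e, he⟩ := exists_residue_equiv hM
  have hperl : ∀ (j : Fin M) (l : ℤ), c ((j : ℕ) + l * M) = c (j : ℕ) := by
    intro j l
    have := (Function.Periodic.int_mul (f := c) (c := (M : ℤ)) hper l) ((j : ℕ) : ℤ)
    simpa using this
  have hs := summable_thetaTerm (a := a) hc hr hy'
  have hterm : ∀ p : Fin M × ℤ, c (e p) * Complex.exp (2 * Real.pi * I *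
      (r * ((e p : ℤ) + a) ^ 2) * (I * y)) = c (p.1 : ℕ) *
        ((Real.exp (-Real.pi * ((p.2 : ℝ) + (((p.1 : ℕ) : ℝ) + a) / M) ^ 2 *
          (2 * r * M ^ 2 * y)) : ℝ) : ℂ) := by
    intro p
    rw [he, hperl, ← thetaExp_I_mul (r := r) hM' a y p.1 p.2]
    push_cast
    rfl
  have hse := e.summable_iff.2 hs
  simp only [Function.comp_def, hterm] at hse
  rw [thetaSeries, ← e.tsum_eq, tsum_congr hterm, hse.tsum_prod, tsum_fintype]
  refine Finset.sum_congr rfl fun j _ => ?_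
  have ht : 0 < 2 * r * (M : ℝ) ^ 2 * y := by positivity
  have h1 := hasSum_int_evenKernel ((((j : ℕ) : ℝ) + a) / M) ht
  have h2 : HasSum (fun n : ℤ => ((Real.exp (-Real.pi * ((n : ℝ) + (((j : ℕ) : ℝ) + a) / M) ^ 2 *
      (2 * r * M ^ 2 * y)) : ℝ) : ℂ))
      ((evenKernel (((((j : ℕ) : ℝ) + a) / M : ℝ) : UnitAddCircle) (2 * r * M ^ 2 * y) : ℝ) : ℂ) :=
    Complex.hasSum_ofReal.2 h1
  exact (h2.mul_left (c (j : ℕ))).tsum_eq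

/-- Splitting n by residues modulo the period and applying the functional equation, each residue
contributes (Ay)^(-1/2) times 1 plus an exponentially small term. The main terms add up to a
multiple of ∑ c_j, which is zero because antiperiodicity cancels one half of the period against the
other. -/
lemma thetaSeries_decay (hc : ∀ n, ‖c n‖ ≤ 1) (hr : 0 < r) {N : ℕ} (hN : 0 < N)
    (hanti : ∀ n, c (n + N) = -c n) (k : ℕ) :
    ∃ C > 0, ∀ y : ℝ, 0 < y → y ≤ 1 → ‖thetaSeries c a r (I * y)‖ ≤ C * y ^ k := by
  set M := N + N with hMdef
  have hM : 0 < M := by omega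
  have hper : ∀ n, c (n + M) = c n := by
    intro n
    rw [hMdef, Nat.cast_add, ← add_assoc, hanti, hanti, neg_neg]
  have hsum : ∑ j : Fin M, c (j : ℕ) = 0 := by
    rw [Fin.sum_univ_eq_sum_range (fun j => c (j : ℕ)) M, hMdef, Finset.sum_range_add,
      ← Finset.sum_add_distrib]
    refine Finset.sum_eq_zero fun j _ => ?_
    rw [add_comm N j, Nat.cast_add, hanti]
    ring
  set α : Fin M → UnitAddCircle := fun j => (((((j : ℕ) : ℝ) + a) / M : ℝ) : UnitAddCircle)
  have hO : (fun s : ℝ => ∑ j : Fin M, c (j : ℕ) * ((cosKernel (α j) s - 1 : ℝ) : ℂ))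
      =O[atTop] fun s => s ^ (-((k : ℝ) + 1)) := by
    refine Asymptotics.IsBigO.fun_sum fun j _ => Asymptotics.IsBigO.const_mul_left ?_ _
    obtain ⟨p, hp, hO⟩ := isBigO_atTop_cosKernel_sub (α j)
    have h1 := hO.trans (isLittleO_exp_neg_mul_rpow_atTop hp (-((k : ℝ) + 1))).isBigO
    exact (Asymptotics.isBigO_norm_left.1 (by simpa only [Complex.norm_real] using h1.norm_left))
  obtain ⟨C, hC⟩ := hO.bound
  obtain ⟨s₀, hs₀⟩ := eventually_atTop.1 hC
  set s := max s₀ 1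
  have hs : 1 ≤ s := le_max_right _ _
  set A : ℝ := 2 * r * M ^ 2 with hA
  have hMr : 0 < (M : ℝ) := by exact_mod_cast hM
  have hA0 : 0 < A := by positivity
  have hsmall : ∀ y : ℝ, 0 < y → y ≤ 1 / (A * s) →
      ‖thetaSeries c a r (I * y)‖ ≤ |C| * A ^ k * y ^ k := by
    intro y hy hys
    have hX : 0 < A * y := by positivity
    have hXs : A * y ≤ 1 / s := by
      calc A * y ≤ A * (1 / (A * s)) := mul_le_mul_of_nonneg_left hys hA0.le
        _ = 1 / s := by field_simp
    have hX1 : A * y ≤ 1 := hXs.trans (by rw [div_le_one (by linarith)]; exact hs)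
    have hsX : s₀ ≤ 1 / (A * y) := (le_max_left _ _).trans (by
      rw [le_div_iff₀ hX, mul_comm]
      rwa [le_div_iff₀ (by linarith)] at hXs)
    have h1 : thetaSeries c a r (I * y) = (((A * y) ^ (-(1 / 2) : ℝ) : ℝ) : ℂ) *
        ∑ j : Fin M, c (j : ℕ) * ((cosKernel (α j) (1 / (A * y)) - 1 : ℝ) : ℂ) := by
      rw [thetaSeries_I_mul_eq_sum hc hr hM hper hy]
      have h2 : ∀ j : Fin M, c (j : ℕ) * ((cosKernel (α j) (1 / (A * y)) - 1 : ℝ) : ℂ)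
          = c (j : ℕ) * (cosKernel (α j) (1 / (A * y)) : ℂ) - c (j : ℕ) := by
        intro j
        push_cast
        ring
      rw [Finset.sum_congr rfl fun j _ => h2 j, Finset.sum_sub_distrib, hsum, sub_zero,
        Finset.mul_sum]
      refine Finset.sum_congr rfl fun j _ => ?_
      rw [evenKernel_functional_equation, one_div ((2 * r * M ^ 2 * y) ^ (1 / 2 : ℝ)),
        ← Real.rpow_neg (by positivity)]
      push_cast
      ring
    have h3 := hs₀ _ hsX
    rw [h1, norm_mul, Complex.norm_real, Real.norm_of_nonneg (Real.rpow_nonneg hX.le _)]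
    have h4 : ‖(1 / (A * y)) ^ (-((k : ℝ) + 1))‖ = (A * y) ^ ((k : ℝ) + 1) := by
      rw [Real.norm_of_nonneg (Real.rpow_nonneg (by positivity) _), one_div,
        Real.inv_rpow hX.le, ← Real.rpow_neg hX.le, neg_neg]
    rw [h4] at h3
    have h5 : 0 ≤ (A * y) ^ ((k : ℝ) + 1) := Real.rpow_nonneg hX.le _
    calc _ ≤ (A * y) ^ (-(1 / 2) : ℝ) * (|C| * (A * y) ^ ((k : ℝ) + 1)) :=
          mul_le_mul_of_nonneg_left (h3.trans (mul_le_mul_of_nonneg_right (le_abs_self C) h5))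
            (Real.rpow_nonneg hX.le _)
      _ = |C| * (A * y) ^ ((k : ℝ) + 1 / 2) := by
          rw [mul_left_comm, ← Real.rpow_add hX]
          ring_nf
      _ ≤ |C| * (A * y) ^ (k : ℝ) := mul_le_mul_of_nonneg_left
          (Real.rpow_le_rpow_of_exponent_ge hX hX1 (by linarith)) (abs_nonneg C)
      _ = |C| * A ^ k * y ^ k := by
          rw [Real.rpow_natCast, mul_pow, mul_assoc]
  set δ := 1 / (A * s) with hδ
  have hδ0 : 0 < δ := by positivity
  have hE := evenKernel_nonneg a (t := 2 * r * δ) (by positivity)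
  -- The first summand serves y ≤ δ; for y ≥ δ the series is bounded by its kernel at δ, and y^k/δ^k
  -- ≥ 1. The final 1 only ensures positivity.
  refine ⟨|C| * A ^ k + evenKernel a (2 * r * δ) / δ ^ k + 1, by positivity, fun y hy _ => ?_⟩
  have hyk : 0 < y ^ k := pow_pos hy k
  rcases le_total y δ with h | h
  · have := hsmall y hy h
    have h2 : 0 ≤ evenKernel a (2 * r * δ) / δ ^ k * y ^ k := by positivity
    nlinarith
  · have h1 : ‖thetaSeries c a r (I * y)‖ ≤ evenKernel a (2 * r * δ) := by
      refine (norm_thetaSeries_le hc hr (by simpa using hy)).trans ?_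
      refine evenKernel_antitone a (by positivity) ?_
      simp only [Complex.mul_im, I_re, I_im, ofReal_re, ofReal_im, zero_mul, one_mul, zero_add]
      exact mul_le_mul_of_nonneg_left h (by positivity)
    have h2 : evenKernel a (2 * r * δ) ≤ evenKernel a (2 * r * δ) / δ ^ k * y ^ k := by
      rw [div_mul_eq_mul_div, le_div_iff₀ (pow_pos hδ0 k)]
      exact mul_le_mul_of_nonneg_left (pow_le_pow_left₀ hδ0.le h k) hE
    have h3 : 0 ≤ |C| * A ^ k * y ^ k := by positivity
    nlinarith

end General

/-! ### Growth of the theta functions and their decay at cusps -/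

lemma exists_norm_theta_le (i : Fin 3) :
    ∃ C > 0, ∀ z : ℂ, 0 < z.im → ‖theta i z‖ ≤ C * (1 + z.im ^ (-(1 / 2) : ℝ)) := by
  obtain ⟨C, hC0, hC⟩ := exists_evenKernel_le (thetaShift i)
  have hr := thetaScale_pos i
  refine ⟨C * (1 + (2 * thetaScale i) ^ (-(1 / 2) : ℝ)), by positivity, fun z hz => ?_⟩
  rw [theta_eq_thetaSeries i hz]
  refine (norm_thetaSeries_le (norm_thetaCoeff_le i) hr hz).trans
    ((hC _ (by positivity)).trans ?_)
  rw [Real.mul_rpow (by positivity) hz.le, mul_assoc]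
  refine mul_le_mul_of_nonneg_left ?_ hC0.le
  have h1 : 0 ≤ (2 * thetaScale i) ^ (-(1 / 2) : ℝ) := by positivity
  have h2 : 0 ≤ z.im ^ (-(1 / 2) : ℝ) := by positivity
  nlinarith

lemma exists_norm_theta_add_sub_le (i : Fin 3) :
    ∃ C > 0, ∀ z : ℂ, 0 < z.im → ∀ s : ℝ,
      ‖theta i (z + s) - theta i z‖ ≤ C * |s| / z.im * (1 + z.im ^ (-(1 / 2) : ℝ)) := by
  obtain ⟨C, hC0, hC⟩ := exists_evenKernel_le (thetaShift i)
  have hr := thetaScale_pos i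
  refine ⟨2 * (C * (1 + thetaScale i ^ (-(1 / 2) : ℝ))), by positivity, fun z hz s => ?_⟩
  rw [theta_eq_thetaSeries i hz, theta_eq_thetaSeries i (z := z + s) (by simpa using hz)]
  refine (norm_thetaSeries_add_sub_le (norm_thetaCoeff_le i) hr hz s).trans
    ((mul_le_mul_of_nonneg_left (hC _ (by positivity)) (by positivity)).trans ?_)
  rw [Real.mul_rpow hr.le hz.le]
  have h1 : 0 ≤ thetaScale i ^ (-(1 / 2) : ℝ) := by positivity
  have h2 : 0 ≤ z.im ^ (-(1 / 2) : ℝ) := by positivity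
  have h3 : 0 ≤ 2 * |s| / z.im * C := by positivity
  calc 2 * |s| / z.im * (C * (1 + thetaScale i ^ (-(1 / 2) : ℝ) * z.im ^ (-(1 / 2) : ℝ)))
      = 2 * |s| / z.im * C * (1 + thetaScale i ^ (-(1 / 2) : ℝ) * z.im ^ (-(1 / 2) : ℝ)) := by ring
    _ ≤ 2 * |s| / z.im * C *
        ((1 + thetaScale i ^ (-(1 / 2) : ℝ)) * (1 + z.im ^ (-(1 / 2) : ℝ))) :=
        mul_le_mul_of_nonneg_left (by nlinarith) h3
    _ = _ := by ring

/-- The coefficients of the theta series of `θᵢ` on the vertical line through `x`. -/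
def twistedCoeff (i : Fin 3) (x : ℚ) (n : ℤ) : ℂ :=
  thetaCoeff i n * Complex.exp (2 * Real.pi * I * (thetaScale i * (n + thetaShift i) ^ 2) * x)

lemma theta_vertical (i : Fin 3) (x : ℚ) {y : ℝ} (hy : 0 < y) :
    theta i (x + I * y)
      = thetaSeries (twistedCoeff i x) (thetaShift i) (thetaScale i) (I * y) := by
  rw [theta_eq_thetaSeries i (by simpa using hy)]
  refine tsum_congr fun n => ?_
  rw [twistedCoeff, mul_add, Complex.exp_add, ← mul_assoc (thetaCoeff i n)]

lemma norm_twistedCoeff_le (i : Fin 3) (x : ℚ) (n : ℤ) : ‖twistedCoeff i x n‖ ≤ 1 := by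
  rw [twistedCoeff, norm_mul, norm_thetaExp]
  simpa using norm_thetaCoeff_le i n

lemma exp_two_pi_mul_int (m : ℤ) : Complex.exp (2 * Real.pi * I * m) = 1 := by
  rw [mul_comm]
  exact Complex.exp_int_mul_two_pi_mul_I m

lemma den_mul_self_complex (x : ℚ) : (x.den : ℂ) * (x : ℂ) = (x.num : ℂ) := by
  exact_mod_cast congrArg (fun y : ℚ => (y : ℂ)) (den_mul_self_rat x)

lemma twistedCoeff_zero_add (x : ℚ) (hx : x ∈ domain 0) (n : ℤ) :
    twistedCoeff 0 x (n + x.den) = -twistedCoeff 0 x n := by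
  have hd : Odd (x.den : ℤ) := by exact_mod_cast (mem_domain_zero x).1 hx
  have hx' := den_mul_self_complex x
  simp only [twistedCoeff, thetaCoeff, thetaScale, thetaShift]
  rw [zpow_add₀ (by norm_num), hd.neg_one_zpow]
  have h1 : 2 * (Real.pi : ℂ) * I * (((1 : ℝ) : ℂ) * (((n + x.den : ℤ) : ℂ) +
    ((0 : ℝ) : ℂ)) ^ 2) * x
      = 2 * Real.pi * I * (((1 : ℝ) : ℂ) * ((n : ℂ) + ((0 : ℝ) : ℂ)) ^ 2) * x
        + 2 * Real.pi * I * ((2 * n * x.num + x.den * x.num : ℤ) : ℂ) := by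
    push_cast
    rw [← hx']
    ring
  rw [h1, Complex.exp_add, exp_two_pi_mul_int]
  ring

lemma twistedCoeff_one_add (x : ℚ) (hx : x ∈ domain 1) (n : ℤ) :
    twistedCoeff 1 x (n + (2 * x.den : ℕ)) = -twistedCoeff 1 x n := by
  obtain ⟨m, hm⟩ := (mem_domain_one x).1 hx
  have hx' := den_mul_self_complex x
  have hm' : (x.num : ℂ) = 2 * m + 1 := by rw [hm]; push_cast; ring
  simp only [twistedCoeff, thetaCoeff, thetaScale, thetaShift]
  have h1 : 2 * (Real.pi : ℂ) * I * (((1 / 4 : ℝ) : ℂ) *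
      (((n + (2 * x.den : ℕ) : ℤ) : ℂ) + ((1 / 2 : ℝ) : ℂ)) ^ 2) * x
      = 2 * Real.pi * I * (((1 / 4 : ℝ) : ℂ) * ((n : ℂ) + ((1 / 2 : ℝ) : ℂ)) ^ 2) * x
        + (2 * Real.pi * I * ((n * x.num + x.den * x.num + m : ℤ) : ℂ) + Real.pi * I) := by
    push_cast
    linear_combination (2 * (Real.pi : ℂ) * I * (n + 1 / 2 + x.den)) * hx' + Real.pi * I * hm'
  rw [h1, Complex.exp_add, Complex.exp_add, exp_two_pi_mul_int, Complex.exp_pi_mul_I]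
  ring

lemma twistedCoeff_two_eq (x : ℚ) (n : ℤ) :
    twistedCoeff 2 x n = (zeta 12)⁻¹ * twistedCoeff 1 (x + 1) n := by
  simp only [twistedCoeff, thetaCoeff, thetaScale, thetaShift]
  push_cast
  rw [mul_add (2 * (Real.pi : ℂ) * I * (1 / 4 * ((n : ℂ) + 1 / 2) ^ 2)), Complex.exp_add]
  ring_nf

/-- In the first case (-1)^n changes sign under n ↦ n + den for odd den, while the exponential is
unchanged. In the second, n ↦ n + 2·den produces e^(πi·num) = -1 for odd num. The third reduces to
the second at x + 1. Thus the points where the series make sense are cusps where the theta function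
vanishes. -/
lemma exists_antiperiod (i : Fin 3) (x : ℚ) (hx : x ∈ domain i) :
    ∃ N : ℕ, 0 < N ∧ ∀ n : ℤ, twistedCoeff i x (n + N) = -twistedCoeff i x n := by
  fin_cases i
  · exact ⟨x.den, x.pos, twistedCoeff_zero_add x hx⟩
  · exact ⟨2 * x.den, by have := x.pos; omega, twistedCoeff_one_add x hx⟩
  · refine ⟨2 * (x + 1).den, by have := (x + 1).pos; omega, fun n => ?_⟩
    change twistedCoeff 2 x _ = -twistedCoeff 2 x n
    rw [twistedCoeff_two_eq, twistedCoeff_two_eq,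
      twistedCoeff_one_add (x + 1) (add_one_mem_domain_one.2 hx)]
    ring

theorem exists_theta_decay (i : Fin 3) (x : ℚ) (hx : x ∈ domain i) (k : ℕ) :
    ∃ C > 0, ∀ y : ℝ, 0 < y → y ≤ 1 → ‖theta i (x + I * y)‖ ≤ C * y ^ k := by
  obtain ⟨N, hN, hanti⟩ := exists_antiperiod i x hx
  obtain ⟨C, hC0, hC⟩ := thetaSeries_decay (a := thetaShift i) (norm_twistedCoeff_le i x)
    (thetaScale_pos i) hN hanti k
  refine ⟨C, hC0, fun y hy hy1 => ?_⟩
  rw [theta_vertical i x hy]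
  exact hC y hy hy1

end

/-! ### Integrals over the half-line -/

lemma integral_Ioi_zero_of_tendsto {E : Type*} [NormedAddCommGroup E] [NormedSpace ℝ E]
    [CompleteSpace E] {F f : ℝ → E} {l₀ l₁ : E} (hF : ∀ x > 0, HasDerivAt F (f x) x)
    (hf : IntegrableOn f (Set.Ioi 0)) (h₀ : Tendsto F (𝓝[>] 0) (𝓝 l₀))
    (h₁ : Tendsto F atTop (𝓝 l₁)) : ∫ x in Set.Ioi (0 : ℝ), f x = l₁ - l₀ := by
  have hupd : ∀ x > 0, Function.update F 0 l₀ =ᶠ[𝓝 x] F := by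
    intro x hx
    filter_upwards [eventually_ne_nhds hx.ne'] with y hy
    exact Function.update_of_ne hy _ _
  -- The primitive is redefined at 0 by its limit, to be continuous on the closed half-line.
  have h := integral_Ioi_of_hasDerivAt_of_tendsto (f := Function.update F 0 l₀) (f' := f) (a := 0)
    (m := l₁) ?_ (fun x hx => (hF x hx).congr_of_eventuallyEq (hupd x hx)) hf ?_
  · rwa [Function.update_self] at h
  · rw [continuousWithinAt_update_same]
    have : Set.Ici (0 : ℝ) \ {0} = Set.Ioi 0 := by
      ext y
      simp [lt_iff_le_and_ne, eq_comm]
    rwa [this]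
  · refine h₁.congr' ?_
    filter_upwards [eventually_gt_atTop 0] with y hy
    exact (Function.update_of_ne hy.ne' _ _).symm

lemma integrableOn_Ioi_of_bounds {f : ℝ → ℂ} (hf : ContinuousOn f (Set.Ioi 0)) {C : ℝ}
    (h₀ : ∀ u, 0 < u → u ≤ 1 → ‖f u‖ ≤ C * u ^ (-(1 / 2) : ℝ))
    (h₁ : ∀ u, 1 ≤ u → ‖f u‖ ≤ C * u ^ (-(3 / 2) : ℝ)) : IntegrableOn f (Set.Ioi 0) := by
  have hm : AEStronglyMeasurable f (volume.restrict (Set.Ioi 0)) :=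
    hf.aestronglyMeasurable measurableSet_Ioi
  rw [← Set.Ioc_union_Ioi_eq_Ioi (zero_le_one' ℝ)]
  refine IntegrableOn.union ?_ ?_
  · have hg : IntegrableOn (fun u : ℝ => C * u ^ (-(1 / 2) : ℝ)) (Set.Ioc 0 1) := by
      have := (intervalIntegral.intervalIntegrable_rpow' (a := 0) (b := 1)
        (r := -(1 / 2)) (by norm_num)).const_mul C
      rwa [intervalIntegrable_iff_integrableOn_Ioc_of_le zero_le_one] at this
    refine Integrable.mono' hg (hm.mono_set Set.Ioc_subset_Ioi_self) ?_
    exact (ae_restrict_iff' measurableSet_Ioc).2 (ae_of_all _ fun u hu => h₀ u hu.1 hu.2)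
  · have hg : IntegrableOn (fun u : ℝ => C * u ^ (-(3 / 2) : ℝ)) (Set.Ioi 1) :=
      ((integrableOn_Ioi_rpow_iff one_pos).2 (by norm_num)).const_mul C
    refine Integrable.mono' hg (hm.mono_set (Set.Ioi_subset_Ioi zero_le_one)) ?_
    exact (ae_restrict_iff' measurableSet_Ioi).2 (ae_of_all _ fun u hu => h₁ u (le_of_lt hu))

/-! ### A Gaussian integral -/

/-- A primitive of `e ^ (-y ^ 2)`, vanishing at `-∞`. -/
def gaussPrim (x : ℝ) : ℝ := ∫ y in Set.Iic x, Real.exp (-y ^ 2)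

lemma integrable_gauss : Integrable fun y : ℝ => Real.exp (-y ^ 2) := by
  simpa using integrable_exp_neg_mul_sq one_pos

lemma hasDerivAt_gaussPrim (x : ℝ) : HasDerivAt gaussPrim (Real.exp (-x ^ 2)) x := by
  have h1 : gaussPrim = fun x => (∫ y in (0 : ℝ)..x, Real.exp (-y ^ 2)) + gaussPrim 0 := by
    funext x
    have := intervalIntegral.integral_Iic_sub_Iic (a := 0) (b := x)
      integrable_gauss.integrableOn integrable_gauss.integrableOn
    rw [← this, gaussPrim, gaussPrim]
    ring
  rw [h1]
  refine HasDerivAt.add_const _ ?_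
  have hc : Continuous fun y : ℝ => Real.exp (-y ^ 2) := by fun_prop
  exact intervalIntegral.integral_hasDerivAt_right (hc.intervalIntegrable _ _)
    (hc.stronglyMeasurableAtFilter _ _) hc.continuousAt

lemma tendsto_gaussPrim_atTop : Tendsto gaussPrim atTop (𝓝 (Real.sqrt Real.pi)) := by
  have h2 := (aecover_Iic tendsto_id).integral_tendsto_of_countably_generated integrable_gauss
  have h3 : ∫ y : ℝ, Real.exp (-y ^ 2) = Real.sqrt Real.pi := by
    simpa using integral_gaussian 1
  rw [h3] at h2
  exact h2

lemma tendsto_gaussPrim_atBot : Tendsto gaussPrim atBot (𝓝 0) := by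
  have h1 := intervalIntegral_tendsto_integral_Iic (f := fun y : ℝ => Real.exp (-y ^ 2)) 0
    integrable_gauss.integrableOn tendsto_id
  have h2 : gaussPrim = fun x => gaussPrim 0 - ∫ y in x..(0 : ℝ), Real.exp (-y ^ 2) := by
    funext x
    have := intervalIntegral.integral_Iic_sub_Iic (a := x) (b := 0)
      integrable_gauss.integrableOn integrable_gauss.integrableOn
    rw [← this, gaussPrim, gaussPrim]
    ring
  rw [h2]
  have h3 := h1.const_sub (gaussPrim 0)
  rw [gaussPrim, sub_self] at h3
  exact h3

lemma gaussPrim_zero : 2 * gaussPrim 0 = Real.sqrt Real.pi := by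
  have h1 := integral_gaussian_Ioi 1
  have h2 := integral_comp_neg_Iic (0 : ℝ) (fun y : ℝ => Real.exp (-y ^ 2))
  simp only [neg_sq, neg_zero] at h2
  rw [gaussPrim, h2]
  simp only [neg_mul, one_mul, div_one] at h1
  rw [h1]
  ring

section Subordination

variable {A B : ℝ}

/-- A primitive of `u ^ (-3/2) e ^ (-A² / u - B² u)`, up to a constant factor. -/
def subPrim (A B u : ℝ) : ℝ :=
  gaussPrim (A / Real.sqrt u - B * Real.sqrt u) +
    Real.exp (4 * A * B) * gaussPrim (A / Real.sqrt u + B * Real.sqrt u)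

/-- The squares (A/√u ∓ B√u)² equal A²/u + B²u ∓ 2AB, so the weight e^(4AB) makes the two Gaussian
factors equal. The derivatives of ∓B√u then cancel and those of A/√u add. -/
lemma hasDerivAt_subPrim {u : ℝ} (hu : 0 < u) (A B : ℝ) :
    HasDerivAt (fun u => -subPrim A B u)
      (A * Real.exp (2 * A * B) * (u ^ (-(3 / 2) : ℝ) * Real.exp (-A ^ 2 / u - B ^ 2 * u))) u := by
  have hsu : 0 < Real.sqrt u := Real.sqrt_pos.2 hu
  have hsq : Real.sqrt u ^ 2 = u := Real.sq_sqrt hu.le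
  have h1 : HasDerivAt (fun u => Real.sqrt u) (1 / (2 * Real.sqrt u)) u :=
    Real.hasDerivAt_sqrt hu.ne'
  have h2 : HasDerivAt (fun u => A / Real.sqrt u)
      (-A * (1 / (2 * Real.sqrt u)) / Real.sqrt u ^ 2) u := by
    have := (hasDerivAt_const u A).div h1 hsu.ne'
    rw [zero_mul, zero_sub, ← neg_mul] at this
    exact this
  have h3 : HasDerivAt (fun u => B * Real.sqrt u) (B * (1 / (2 * Real.sqrt u))) u := h1.const_mul B
  have h4 := (hasDerivAt_gaussPrim _).comp u (h2.sub h3)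
  have h5 := ((hasDerivAt_gaussPrim _).comp u (h2.add h3)).const_mul (Real.exp (4 * A * B))
  refine (h4.add h5).neg.congr_deriv ?_
  have hAB : A / Real.sqrt u * (B * Real.sqrt u) = A * B := by field_simp
  have hexp : -(A / Real.sqrt u) ^ 2 - (B * Real.sqrt u) ^ 2 = -A ^ 2 / u - B ^ 2 * u := by
    rw [div_pow, mul_pow, hsq]
    ring
  have e1 : Real.exp (-(A / Real.sqrt u - B * Real.sqrt u) ^ 2)
      = Real.exp (2 * A * B) * Real.exp (-A ^ 2 / u - B ^ 2 * u) := by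
    rw [← Real.exp_add]
    congr 1
    linear_combination 2 * hAB + hexp
  have e2 : Real.exp (4 * A * B) * Real.exp (-(A / Real.sqrt u + B * Real.sqrt u) ^ 2)
      = Real.exp (2 * A * B) * Real.exp (-A ^ 2 / u - B ^ 2 * u) := by
    rw [← Real.exp_add, ← Real.exp_add]
    congr 1
    linear_combination -2 * hAB + hexp
  have e3 : u ^ (-(3 / 2) : ℝ) = 1 / (Real.sqrt u ^ 3) := by
    rw [Real.rpow_neg hu.le, Real.sqrt_eq_rpow, ← Real.rpow_natCast, ← Real.rpow_mul hu.le,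
      one_div]
    norm_num
  simp only [Pi.sub_apply, Pi.add_apply]
  rw [e1, ← mul_assoc, e2, e3]
  field_simp
  ring

lemma tendsto_sqrt_nhdsGT : Tendsto Real.sqrt (𝓝[>] 0) (𝓝[>] 0) := by
  refine tendsto_nhdsWithin_iff.2 ⟨?_, ?_⟩
  · have := (Real.continuous_sqrt.tendsto 0).mono_left (nhdsWithin_le_nhds (s := Set.Ioi 0))
    rwa [Real.sqrt_zero] at this
  · filter_upwards [self_mem_nhdsWithin] with u hu
    exact Real.sqrt_pos.2 hu

lemma tendsto_subPrim_zero (hA : 0 < A) (B : ℝ) :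
    Tendsto (fun u => -subPrim A B u) (𝓝[>] 0)
      (𝓝 (-(Real.sqrt Real.pi + Real.exp (4 * A * B) * Real.sqrt Real.pi))) := by
  have h1 : Tendsto (fun u : ℝ => A / Real.sqrt u) (𝓝[>] 0) atTop := by
    simp only [div_eq_mul_inv]
    exact (tendsto_inv_nhdsGT_zero.comp tendsto_sqrt_nhdsGT).const_mul_atTop hA
  have h2 : Tendsto (fun u : ℝ => B * Real.sqrt u) (𝓝[>] 0) (𝓝 (B * 0)) :=
    (tendsto_nhdsWithin_iff.1 tendsto_sqrt_nhdsGT).1.const_mul B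
  have h3 : Tendsto (fun u : ℝ => A / Real.sqrt u - B * Real.sqrt u) (𝓝[>] 0) atTop := by
    simp only [sub_eq_add_neg]
    exact h1.atTop_add h2.neg
  have h4 : Tendsto (fun u : ℝ => A / Real.sqrt u + B * Real.sqrt u) (𝓝[>] 0) atTop :=
    h1.atTop_add h2
  exact ((tendsto_gaussPrim_atTop.comp h3).add
    ((tendsto_gaussPrim_atTop.comp h4).const_mul _)).neg

lemma tendsto_subPrim_atTop (hB : 0 ≤ B) (A : ℝ) :
    Tendsto (fun u => -subPrim A B u) atTop
      (𝓝 (-(Real.exp (4 * A * B) * Real.sqrt Real.pi))) := by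
  have h1 : Tendsto (fun u : ℝ => A / Real.sqrt u) atTop (𝓝 0) :=
    Real.tendsto_sqrt_atTop.const_div_atTop A
  -- For B = 0 the first argument tends to 0 instead of -∞, and 2 `gaussPrim` 0 = √π gives the same
  -- limit. The case does occur: it is the term n = 0 of the first theta series.
  rcases hB.eq_or_lt with rfl | hB
  · have h2 : Tendsto (fun u : ℝ => gaussPrim (A / Real.sqrt u)) atTop (𝓝 (gaussPrim 0)) :=
      (hasDerivAt_gaussPrim 0).continuousAt.tendsto.comp h1
    have h3 := (h2.add h2).neg
    rw [← two_mul, gaussPrim_zero] at h3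
    simpa [subPrim] using h3
  · have h2 : Tendsto (fun u : ℝ => B * Real.sqrt u) atTop atTop :=
      Real.tendsto_sqrt_atTop.const_mul_atTop hB
    have h3 : Tendsto (fun u : ℝ => A / Real.sqrt u - B * Real.sqrt u) atTop atBot := by
      simp only [sub_eq_add_neg]
      exact h1.add_atBot (tendsto_neg_atTop_atBot.comp h2)
    have h4 := ((tendsto_gaussPrim_atBot.comp h3).add
      ((tendsto_gaussPrim_atTop.comp (h1.add_atTop h2)).const_mul (Real.exp (4 * A * B)))).neg
    rw [zero_add] at h4
    exact h4

lemma integrableOn_subordination (hA : 0 < A) (B : ℝ) :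
    IntegrableOn (fun u : ℝ => u ^ (-(3 / 2) : ℝ) * Real.exp (-A ^ 2 / u - B ^ 2 * u))
      (Set.Ioi 0) := by
  have key : IntegrableOn (fun u : ℝ => ((u ^ (-(3 / 2) : ℝ) *
      Real.exp (-A ^ 2 / u - B ^ 2 * u) : ℝ) : ℂ)) (Set.Ioi 0) := by
    have hb : ∀ u : ℝ, 0 < u → Real.exp (-A ^ 2 / u - B ^ 2 * u) ≤ Real.exp (-A ^ 2 / u) := by
      intro u hu
      rw [Real.exp_le_exp]
      nlinarith [mul_nonneg (sq_nonneg B) hu.le]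
    refine integrableOn_Ioi_of_bounds (C := 1 + 1 / A ^ 2) ?_ (fun u hu hu1 => ?_) (fun u hu => ?_)
    · refine continuous_ofReal.comp_continuousOn (ContinuousOn.mul ?_ ?_)
      · exact continuousOn_id.rpow_const fun u hu => Or.inl (ne_of_gt hu)
      · refine Real.continuous_exp.comp_continuousOn (ContinuousOn.sub ?_ (by fun_prop))
        exact continuousOn_const.div continuousOn_id fun u hu => ne_of_gt hu
    · rw [Complex.norm_real, Real.norm_of_nonneg (by positivity)]
      have h1 : Real.exp (-A ^ 2 / u) ≤ u / A ^ 2 := by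
        rw [neg_div, Real.exp_neg, inv_le_comm₀ (Real.exp_pos _) (by positivity), inv_div]
        linarith [Real.add_one_le_exp (A ^ 2 / u)]
      have h2 : u ^ (-(3 / 2) : ℝ) * u = u ^ (-(1 / 2) : ℝ) := by
        rw [← Real.rpow_add_one hu.ne']
        norm_num
      calc u ^ (-(3 / 2) : ℝ) * Real.exp (-A ^ 2 / u - B ^ 2 * u)
          ≤ u ^ (-(3 / 2) : ℝ) * (u / A ^ 2) :=
            mul_le_mul_of_nonneg_left ((hb u hu).trans h1) (by positivity)
        _ = 1 / A ^ 2 * u ^ (-(1 / 2) : ℝ) := by rw [← h2]; ring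
        _ ≤ (1 + 1 / A ^ 2) * u ^ (-(1 / 2) : ℝ) :=
            mul_le_mul_of_nonneg_right (by linarith) (by positivity)
    · have hu0 : 0 < u := by linarith
      rw [Complex.norm_real, Real.norm_of_nonneg (by positivity), mul_comm]
      refine mul_le_mul_of_nonneg_right ?_ (by positivity)
      have h1 : Real.exp (-A ^ 2 / u) ≤ 1 := by
        rw [Real.exp_le_one_iff, neg_div, neg_nonpos]
        positivity
      have h2 : 0 < 1 / A ^ 2 := by positivity
      linarith [hb u hu0]
  simpa only [Complex.ofReal_re] using! key.re

/-- This expresses an exponential linear in B through Gaussians e^(-B²u). With B proportional to |n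
+ a| it connects Abel factors e^(-s|n+a|) with theta terms. -/
lemma integral_subordination (hA : 0 < A) (hB : 0 ≤ B) :
    ∫ u in Set.Ioi (0 : ℝ), u ^ (-(3 / 2) : ℝ) * Real.exp (-A ^ 2 / u - B ^ 2 * u)
      = Real.sqrt Real.pi / A * Real.exp (-(2 * A * B)) := by
  have h := integral_Ioi_zero_of_tendsto (fun u hu => hasDerivAt_subPrim hu A B)
    ((integrableOn_subordination hA B).const_mul _) (tendsto_subPrim_zero hA B)
    (tendsto_subPrim_atTop hB A)
  rw [integral_const_mul] at h
  have hE := Real.exp_pos (2 * A * B)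
  rw [Real.exp_neg, eq_comm, div_mul_eq_mul_div, div_eq_iff hA.ne', ← div_eq_mul_inv,
    div_eq_iff hE.ne']
  linear_combination -h

end Subordination

/-! ### The strange series as Eichler integrals -/

lemma differentiableAt_theta (i : Fin 3) {z : ℂ} (hz : 0 < z.im) :
    DifferentiableAt ℂ (theta i) z := by
  have hη : ∀ {w : ℂ}, 0 < w.im → DifferentiableAt ℂ ModularForm.eta w := fun hw =>
    ModularForm.differentiableAt_eta_of_mem_upperHalfPlaneSet hw
  have hη0 : ∀ {w : ℂ}, 0 < w.im → ModularForm.eta w ≠ 0 := fun hw => ModularForm.eta_ne_zero hw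
  have h2 : 0 < (2 * z).im := by simpa using hz
  have h3 : 0 < (z / 2).im := by
    rw [show z / 2 = ((1 / 2 : ℝ) : ℂ) * z by push_cast; ring, Complex.im_ofReal_mul]
    linarith
  have h4 : 0 < (z / 2 + 1 / 2).im := by
    rw [Complex.add_im, show (1 / 2 : ℂ) = ((1 / 2 : ℝ) : ℂ) by push_cast; rfl, Complex.ofReal_im]
    linarith
  fin_cases i
  · exact ((hη hz).pow 2).div ((hη h2).comp z (by fun_prop)) (hη0 h2)
  · exact ((hη hz).pow 2).div ((hη h3).comp z (f := fun z => z / 2) (by fun_prop)) (hη0 h3)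
  · exact ((hη hz).pow 2).div ((hη h4).comp z (f := fun z => z / 2 + 1 / 2) (by fun_prop)) (hη0 h4)

lemma continuousOn_theta_vertical (i : Fin 3) (x : ℂ) (hx : x.im = 0) :
    ContinuousOn (fun u : ℝ => theta i (x + I * u)) (Set.Ioi 0) := by
  intro u hu
  refine ContinuousAt.continuousWithinAt ?_
  refine ContinuousAt.comp (x := u) (g := theta i) (f := fun u : ℝ => x + I * (u : ℂ)) ?_
    (by fun_prop)
  exact (differentiableAt_theta i (by simpa [hx] using hu)).continuousAt

lemma continuousOn_rpow_cast (p : ℝ) :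
    ContinuousOn (fun u : ℝ => ((u ^ p : ℝ) : ℂ)) (Set.Ioi 0) :=
  continuous_ofReal.comp_continuousOn
    (continuousOn_id.rpow_const fun _ hu => Or.inl (ne_of_gt hu))

lemma norm_rpow_cast {u : ℝ} (hu : 0 < u) (p : ℝ) : ‖((u ^ p : ℝ) : ℂ)‖ = u ^ p := by
  rw [Complex.norm_real, Real.norm_of_nonneg (Real.rpow_nonneg hu.le _)]

lemma one_add_rpow_le_two {u : ℝ} (hu : 1 ≤ u) : 1 + u ^ (-(1 / 2) : ℝ) ≤ 2 := by
  have := Real.rpow_le_one_of_one_le_of_nonpos hu (z := (-(1 / 2) : ℝ)) (by norm_num)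
  linarith

/-- At infinity θ is bounded. At 0 the singularity u^(-3/2) is tamed by the vanishing of θ at the
cusp, of which first order already suffices. -/
lemma integrableOn_eichler (i : Fin 3) (x : ℚ) (hx : x ∈ domain i) :
    IntegrableOn (fun u : ℝ => theta i (x + I * u) * ((u ^ (-(3 / 2) : ℝ) : ℝ) : ℂ))
      (Set.Ioi 0) := by
  obtain ⟨C, hC0, hC⟩ := exists_norm_theta_le i
  obtain ⟨K, hK0, hK⟩ := exists_theta_decay i x hx 1
  have him : ∀ u : ℝ, ((x : ℂ) + I * u).im = u := fun u => by simp
  refine integrableOn_Ioi_of_bounds (C := K + C * 2) ((continuousOn_theta_vertical i x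
    (by simp)).mul
    (continuousOn_rpow_cast _)) (fun u hu hu1 => ?_) (fun u hu => ?_)
  · rw [norm_mul, norm_rpow_cast hu]
    have h1 := hK u hu hu1
    rw [pow_one] at h1
    have h2 : u * u ^ (-(3 / 2) : ℝ) = u ^ (-(1 / 2) : ℝ) := by
      rw [mul_comm, ← Real.rpow_add_one hu.ne']
      norm_num
    have h3 : 0 ≤ u ^ (-(1 / 2) : ℝ) := by positivity
    calc _ ≤ K * u * u ^ (-(3 / 2) : ℝ) := mul_le_mul_of_nonneg_right h1 (by positivity)
      _ = K * u ^ (-(1 / 2) : ℝ) := by rw [mul_assoc, h2]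
      _ ≤ _ := mul_le_mul_of_nonneg_right (by linarith) h3
  · have hu0 : 0 < u := by linarith
    rw [norm_mul, norm_rpow_cast hu0]
    refine mul_le_mul_of_nonneg_right ?_ (by positivity)
    have h1 := hC (x + I * u) (by rw [him]; exact hu0)
    rw [him] at h1
    have := mul_le_mul_of_nonneg_left (one_add_rpow_le_two hu) hC0.le
    linarith

/-! ### Abel sums as integrals of theta series -/

section Abel

variable {c : ℤ → ℂ} {a r : ℝ}

lemma summable_exp_neg_abs (a : ℝ) {s : ℝ} (hs : 0 < s) :
    Summable fun n : ℤ => Real.exp (-(s * |(n : ℝ) + a|)) := by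
  have hnat : Summable fun n : ℕ => Real.exp (-(s * n)) := by
    have := Real.summable_exp_nat_mul_iff (a := -s)
    refine (this.2 (by linarith)).congr fun n => ?_
    congr 1
    ring
  have h1 : Summable fun n : ℤ => Real.exp (-(s * |(n : ℝ)|)) :=
    Summable.of_nat_of_neg (by simpa using hnat) (by simpa using hnat)
  refine Summable.of_nonneg_of_le (fun n => (Real.exp_pos _).le) (fun n => ?_)
    (h1.mul_left (Real.exp (s * |a|)))
  rw [← Real.exp_add, Real.exp_le_exp]
  have h2 : |(n : ℝ)| ≤ |(n : ℝ) + a| + |a| := by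
    have := abs_sub (n + a : ℝ) a
    simpa using this
  nlinarith

lemma thetaExp_I (a r u : ℝ) (n : ℤ) :
    Complex.exp (2 * Real.pi * I * (r * (n + a) ^ 2) * (I * u))
      = ((Real.exp (-(2 * Real.pi * r * (n + a) ^ 2 * u)) : ℝ) : ℂ) := by
  rw [ofReal_exp]
  congr 1
  push_cast
  linear_combination (2 * (Real.pi : ℂ) * r * (n + a) ^ 2 * u) * I_sq

lemma tsum_abel_eq_integral (hc : ∀ n, ‖c n‖ ≤ 1) (hr : 0 < r) {s : ℝ} (hs : 0 < s) :
    ∑' n : ℤ, c n * ((Real.exp (-(s * |(n : ℝ) + a|)) : ℝ) : ℂ)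
      = (s / (2 * Real.pi * Real.sqrt (2 * r)) : ℝ) *
        ∫ u in Set.Ioi (0 : ℝ), ((Real.exp (-(s ^ 2 / (8 * Real.pi * r)) / u) : ℝ) : ℂ) *
          (thetaSeries c a r (I * u) * ((u ^ (-(3 / 2) : ℝ) : ℝ) : ℂ)) := by
  have hpi := Real.pi_pos
  set κ := Real.sqrt (2 * Real.pi * r) with hκ
  have hκ0 : 0 < κ := Real.sqrt_pos.2 (by positivity)
  have hκ2 : κ ^ 2 = 2 * Real.pi * r := Real.sq_sqrt (by positivity)
  -- The choice makes 2AB equal to s|n + a| and B² equal to 2πr(n + a)², the exponent of the n-th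
  -- theta term on the imaginary axis.
  set A := s / (2 * κ) with hA
  have hA0 : 0 < A := by positivity
  have hA2 : A ^ 2 = s ^ 2 / (8 * Real.pi * r) := by
    rw [hA, div_pow, mul_pow, hκ2]
    congr 1
    ring
  set B : ℤ → ℝ := fun n => κ * |(n : ℝ) + a| with hB
  have hB0 : ∀ n, 0 ≤ B n := fun n => by positivity
  have hB2 : ∀ n, B n ^ 2 = 2 * Real.pi * r * (n + a) ^ 2 := by
    intro n
    rw [hB, mul_pow, hκ2, sq_abs]
  have hAB : ∀ n, 2 * A * B n = s * |(n : ℝ) + a| := by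
    intro n
    simp only [hA, hB]
    field_simp
  have hconst : A / Real.sqrt Real.pi = s / (2 * Real.pi * Real.sqrt (2 * r)) := by
    have h1 : κ = Real.sqrt Real.pi * Real.sqrt (2 * r) := by
      rw [hκ, ← Real.sqrt_mul hpi.le]
      congr 1
      ring
    have h2 : Real.sqrt Real.pi ^ 2 = Real.pi := Real.sq_sqrt hpi.le
    have h3 : 0 < Real.sqrt Real.pi := Real.sqrt_pos.2 hpi
    have h4 : 0 < Real.sqrt (2 * r) := Real.sqrt_pos.2 (by positivity)
    rw [hA, h1, div_div]
    congr 1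
    linear_combination (2 * Real.sqrt (2 * r)) * h2
  set F : ℤ → ℝ → ℂ := fun n u =>
    c n * ((u ^ (-(3 / 2) : ℝ) * Real.exp (-A ^ 2 / u - B n ^ 2 * u) : ℝ) : ℂ) with hF
  have hFint : ∀ n, Integrable (F n) (volume.restrict (Set.Ioi 0)) := fun n =>
    ((integrableOn_subordination hA0 (B n)).ofReal).const_mul (c n)
  have hFnorm : ∀ n, ∫ u in Set.Ioi (0 : ℝ), ‖F n u‖
      = ‖c n‖ * (Real.sqrt Real.pi / A * Real.exp (-(s * |(n : ℝ) + a|))) := by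
    intro n
    rw [← hAB, ← integral_subordination hA0 (hB0 n), ← integral_const_mul]
    refine setIntegral_congr_fun measurableSet_Ioi fun u hu => ?_
    simp only [hF, norm_mul, Complex.norm_real]
    rw [Real.norm_of_nonneg (Real.rpow_nonneg (le_of_lt hu) _),
      Real.norm_of_nonneg (Real.exp_pos _).le]
  have hsum : Summable fun n => ∫ u in Set.Ioi (0 : ℝ), ‖F n u‖ := by
    refine Summable.of_nonneg_of_le (fun n => integral_nonneg fun u => norm_nonneg _) (fun n => ?_)
      ((summable_exp_neg_abs a hs).mul_left (Real.sqrt Real.pi / A))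
    rw [hFnorm]
    exact mul_le_of_le_one_left (by positivity) (hc n)
  have key := hasSum_integral_of_summable_integral_norm hFint hsum
  have h1 : ∀ n, ∫ u in Set.Ioi (0 : ℝ), F n u
      = ((Real.sqrt Real.pi / A : ℝ) : ℂ) *
        (c n * ((Real.exp (-(s * |(n : ℝ) + a|)) : ℝ) : ℂ)) := by
    intro n
    simp only [hF]
    have h0 : ∫ u in Set.Ioi (0 : ℝ),
        ((u ^ (-(3 / 2) : ℝ) * Real.exp (-A ^ 2 / u - B n ^ 2 * u) : ℝ) : ℂ)
        = ((∫ u in Set.Ioi (0 : ℝ),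
          u ^ (-(3 / 2) : ℝ) * Real.exp (-A ^ 2 / u - B n ^ 2 * u) : ℝ) : ℂ) := integral_ofReal
    rw [integral_const_mul, h0, integral_subordination hA0 (hB0 n), hAB, Complex.ofReal_mul]
    ring
  have h2 : ∫ u in Set.Ioi (0 : ℝ), ∑' n, F n u
      = ∫ u in Set.Ioi (0 : ℝ), ((Real.exp (-(s ^ 2 / (8 * Real.pi * r)) / u) : ℝ) : ℂ) *
          (thetaSeries c a r (I * u) * ((u ^ (-(3 / 2) : ℝ) : ℝ) : ℂ)) := by
    refine setIntegral_congr_fun measurableSet_Ioi fun u _ => ?_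
    simp only [hF, thetaSeries]
    rw [← tsum_mul_right, ← tsum_mul_left]
    refine tsum_congr fun n => ?_
    rw [thetaExp_I, sub_eq_add_neg, Real.exp_add, hB2, hA2]
    push_cast
    ring
  have h3 := key.tsum_eq
  simp only [h1] at h3
  rw [tsum_mul_left, h2] at h3
  rw [← h3, ← mul_assoc, ← hconst, ← Complex.ofReal_mul]
  have h5 : A / Real.sqrt Real.pi * (Real.sqrt Real.pi / A) = 1 := by
    have h3 : 0 < Real.sqrt Real.pi := Real.sqrt_pos.2 hpi
    field_simp
  rw [h5, Complex.ofReal_one, one_mul]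

/-- Dominated convergence: in `tsum_abel_eq_integral` the extra factor e^(-s²/(8πru)) is at most 1
and tends to 1 as s → 0. The assumed integrability is where cusp decay enters. -/
lemma tendsto_abel (hc : ∀ n, ‖c n‖ ≤ 1) (hr : 0 < r)
    (hInt : IntegrableOn (fun u : ℝ => thetaSeries c a r (I * u) *
      ((u ^ (-(3 / 2) : ℝ) : ℝ) : ℂ)) (Set.Ioi 0)) :
    Tendsto (fun s : ℝ => (∑' n : ℤ, c n * ((Real.exp (-(s * |(n : ℝ) + a|)) : ℝ) : ℂ)) / s)
      (𝓝[>] 0) (𝓝 ((1 / (2 * Real.pi * Real.sqrt (2 * r)) : ℝ) *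
        ∫ u in Set.Ioi (0 : ℝ), thetaSeries c a r (I * u) * ((u ^ (-(3 / 2) : ℝ) : ℝ) : ℂ))) := by
  have hpi := Real.pi_pos
  have hlim : Tendsto (fun s : ℝ =>
      ∫ u in Set.Ioi (0 : ℝ), ((Real.exp (-(s ^ 2 / (8 * Real.pi * r)) / u) : ℝ) : ℂ) *
          (thetaSeries c a r (I * u) * ((u ^ (-(3 / 2) : ℝ) : ℝ) : ℂ))) (𝓝[>] 0)
      (𝓝 (∫ u in Set.Ioi (0 : ℝ), thetaSeries c a r (I * u) *
        ((u ^ (-(3 / 2) : ℝ) : ℝ) : ℂ))) := by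
    refine tendsto_integral_filter_of_dominated_convergence
      (fun u => ‖thetaSeries c a r (I * u) * ((u ^ (-(3 / 2) : ℝ) : ℝ) : ℂ)‖) ?_ ?_ hInt.norm ?_
    · refine Eventually.of_forall fun s => AEStronglyMeasurable.mul ?_ hInt.aestronglyMeasurable
      refine Measurable.aestronglyMeasurable ?_
      fun_prop
    · refine Eventually.of_forall fun s => (ae_restrict_iff' measurableSet_Ioi).2
        (ae_of_all _ fun u hu => ?_)
      rw [norm_mul]
      refine mul_le_of_le_one_left (norm_nonneg _) ?_
      rw [Complex.norm_real, Real.norm_of_nonneg (Real.exp_pos _).le, Real.exp_le_one_iff, neg_div,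
        neg_nonpos]
      have : 0 < u := hu
      positivity
    · refine (ae_restrict_iff' measurableSet_Ioi).2 (ae_of_all _ fun u hu => ?_)
      have h1 : Tendsto (fun s : ℝ => ((Real.exp (-(s ^ 2 / (8 * Real.pi * r)) / u) : ℝ) : ℂ))
          (𝓝 0) (𝓝 ((Real.exp (-((0 : ℝ) ^ 2 / (8 * Real.pi * r)) / u) : ℝ) : ℂ)) := by
        refine Continuous.tendsto (f := fun s : ℝ =>
          ((Real.exp (-(s ^ 2 / (8 * Real.pi * r)) / u) : ℝ) : ℂ)) ?_ 0
        fun_prop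
      have h2 := (h1.mono_left (nhdsWithin_le_nhds (s := Set.Ioi 0))).mul_const
        (thetaSeries c a r (I * u) * ((u ^ (-(3 / 2) : ℝ) : ℝ) : ℂ))
      simpa using h2
  refine (hlim.const_mul _).congr' ?_
  filter_upwards [self_mem_nhdsWithin] with s hs
  have hs' : (s : ℂ) ≠ 0 := by exact_mod_cast (ne_of_gt hs : s ≠ 0)
  rw [tsum_abel_eq_integral hc hr hs]
  generalize (∫ u in Set.Ioi (0 : ℝ), ((Real.exp (-(s ^ 2 / (8 * Real.pi * r)) / u) : ℝ) : ℂ) *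
          (thetaSeries c a r (I * u) * ((u ^ (-(3 / 2) : ℝ) : ℝ) : ℂ))) = J
  rw [div_eq_mul_one_div s, Complex.ofReal_mul, mul_assoc (s : ℂ),
    mul_div_cancel_left₀ _ hs']

end Abel

/-! ### The strange series as Abel limits -/

lemma tendsto_exp_neg_mul {c : ℝ} (hc : 0 < c) :
    Tendsto (fun s : ℝ => Real.exp (-(c * s))) (𝓝[>] 0) (𝓝[<] 1) := by
  refine tendsto_nhdsWithin_iff.2 ⟨?_, ?_⟩
  · have h : ContinuousAt (fun s : ℝ => Real.exp (-(c * s))) 0 := by fun_prop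
    have h1 : Tendsto (fun s : ℝ => Real.exp (-(c * s))) (𝓝 0) (𝓝 1) := by
      simpa [ContinuousAt] using h
    exact h1.mono_left nhdsWithin_le_nhds
  · filter_upwards [self_mem_nhdsWithin] with s hs
    have : 0 < c * s := mul_pos hc hs
    simpa using this

lemma tendsto_one_sub_exp_div (c : ℝ) :
    Tendsto (fun s : ℝ => (1 - (Real.exp (-(c * s)) : ℂ)) / s) (𝓝[>] 0) (𝓝 c) := by
  have h : HasDerivAt (fun s : ℝ => 1 - Real.exp (-(c * s))) c 0 := by
    have h1 : HasDerivAt (fun s : ℝ => -(c * s)) (-(c * 1)) 0 :=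
      ((hasDerivAt_id (0 : ℝ)).const_mul c).neg
    have h2 := (h1.exp).const_sub 1
    simpa using h2
  have h2 := (hasDerivAt_iff_tendsto_slope.1 h).mono_left
    (nhdsWithin_mono 0 (fun s (hs : (0 : ℝ) < s) => ne_of_gt hs : Set.Ioi (0 : ℝ) ⊆ {0}ᶜ))
  have h3 := (continuous_ofReal.tendsto c).comp h2
  refine h3.congr fun s => ?_
  simp only [Function.comp_apply, slope_def_field]
  push_cast
  simp

lemma tendsto_fineSum_exp {β q : ℂ} {b : ℕ} {c : ℝ} (hc : 0 < c) (hb : 0 < b)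
    (hq : IsPrimitiveRoot q b) (hβ : β ^ b = -1) :
    Tendsto (fun s : ℝ => fineSum β q (Real.exp (-(c * s)) : ℝ) / s) (𝓝[>] 0)
      (𝓝 ((∑ n ∈ Finset.range b, ratioProd β q 1 n) * c)) := by
  have h1 := ((tendsto_fineSum_div hb hq hβ).comp (tendsto_exp_neg_mul hc)).mul
    (tendsto_one_sub_exp_div c)
  refine h1.congr' ?_
  filter_upwards [(tendsto_exp_neg_mul hc).eventually self_mem_nhdsWithin] with s hs
  have hs' : Real.exp (-(c * s)) < 1 := hs
  have h2 : (1 : ℂ) - (Real.exp (-(c * s)) : ℝ) ≠ 0 := by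
    rw [← Complex.ofReal_one, ← Complex.ofReal_sub]
    exact_mod_cast (by linarith : (1 : ℝ) - Real.exp (-(c * s)) ≠ 0)
  simp only [Function.comp_apply]
  rw [div_mul_div_comm, mul_comm (1 - _) (s : ℂ), mul_div_mul_right _ _ h2]

lemma qPoch_self_div (β q : ℂ) (n : ℕ) : qPoch q q n / qPoch (β * q) q n = ratioProd β q 1 n := by
  rw [qPoch, qPoch, ratioProd, ← Finset.prod_div_distrib]
  refine Finset.prod_congr rfl fun j _ => ?_
  rw [pow_succ']
  ring_nf

lemma phi_zero_eq (x : ℚ) :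
    phi x 0 = ∑ n ∈ Finset.range x.den, ratioProd (-1) (qpow 1 x) 1 n := by
  rw [phi_eq_sum]
  refine Finset.sum_congr rfl fun n _ => ?_
  simp only [strangeTerm, strangePrefactor, strangeDen]
  rw [one_mul, ← qPoch_self_div, neg_one_mul]

lemma phi_one_eq (x : ℚ) :
    phi x 1 = qpow (1 / 16) x / (1 - qpow (1 / 2) x) *
      ∑ n ∈ Finset.range x.den, ratioProd (qpow (1 / 2) x) (qpow 1 x) 1 n := by
  rw [phi_eq_sum, Finset.mul_sum]
  refine Finset.sum_congr rfl fun n _ => ?_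
  simp only [strangeTerm, strangePrefactor, strangeDen]
  rw [← qPoch_self_div]
  have h : qPoch (qpow (1 / 2) x) (qpow 1 x) (n + 1)
      = (1 - qpow (1 / 2) x) * qPoch (qpow (1 / 2) x * qpow 1 x) (qpow 1 x) n := by
    rw [qPoch, Finset.prod_range_succ', mul_comm, qPoch]
    congr 1
    · simp
    · refine Finset.prod_congr rfl fun j _ => ?_
      ring
  rw [h]
  simp only [div_eq_mul_inv, mul_inv]
  ring

lemma tsum_twistedCoeff_zero (x : ℚ) (hx : x ∈ domain 0) {s : ℝ} (hs : 0 < s) :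
    ∑' n : ℤ, twistedCoeff 0 x n * ((Real.exp (-(s * |(n : ℝ) + thetaShift 0|)) : ℝ) : ℂ)
      = fineSum (-1) (qpow 1 x) (Real.exp (-(1 / 2 * s)) : ℝ) := by
  -- The series of `fineSum_neg_one` carries t^(2n), which has to match e^(-sn).
  set t := Real.exp (-(1 / 2 * s)) with ht
  have ht0 : 0 < t := Real.exp_pos _
  have ht1 : t < 1 := by rw [ht]; simpa using hs
  have hq : ‖qpow 1 (x : ℂ)‖ = 1 := by simpa using norm_qpow_of_real 1 x
  have htn : ‖(t : ℂ)‖ < 1 := by rwa [Complex.norm_real, Real.norm_of_nonneg ht0.le]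
  have htq : ‖(t : ℂ) * qpow 1 x‖ < 1 := by rwa [norm_mul, hq, mul_one]
  have hβ : (-1 : ℂ) ^ x.den = -1 := ((mem_domain_zero x).1 hx).neg_one_pow
  rw [fineSum_neg_one (fineHyp_root_of_unity x.pos (isPrimitiveRoot_qpow x) hβ ht0 ht1) htn.le
    hq.le htq]
  have hterm : ∀ n : ℕ, twistedCoeff 0 x n *
      ((Real.exp (-(s * |((n : ℤ) : ℝ) + thetaShift 0|)) : ℝ) : ℂ)
      = (-1) ^ n * (t : ℂ) ^ (2 * n) * qpow 1 (x : ℂ) ^ (n ^ 2) := by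
    intro n
    have h1 : Real.exp (-(s * |((n : ℤ) : ℝ) + thetaShift 0|)) = t ^ (2 * n) := by
      rw [ht, ← Real.exp_nat_mul]
      congr 1
      simp only [thetaShift]
      push_cast
      rw [add_zero, abs_of_nonneg (Nat.cast_nonneg n)]
      ring
    rw [twistedCoeff, thetaTerm_zero_nat, h1, one_pow]
    push_cast
    ring
  have hsum := hasSum_int_of_even (f := fun n : ℤ => twistedCoeff 0 x n *
      ((Real.exp (-(s * |(n : ℝ) + thetaShift 0|)) : ℝ) : ℂ)) hterm (fun n => ?_)
    (summable_sq_pow_mul_pow htn.le hq.le htq)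
  · rw [hsum.tsum_eq]
    simp
  · rw [← hterm]
    simp only [twistedCoeff, thetaCoeff, thetaShift]
    rw [zpow_neg, ← inv_zpow, show (-1 : ℂ)⁻¹ = -1 by norm_num]
    push_cast
    rw [add_zero, add_zero, add_zero, add_zero, abs_neg, neg_sq]

lemma qpow_half_pow_den (x : ℚ) (hx : x ∈ domain 1) : qpow (1 / 2) (x : ℂ) ^ x.den = -1 := by
  obtain ⟨m, hm⟩ := (mem_domain_one x).1 hx
  have hm' : (x.num : ℂ) = 2 * m + 1 := by rw [hm]; push_cast; ring
  have hx' := den_mul_self_complex x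
  rw [← qpow_nat_mul, qpow]
  have h : 2 * (Real.pi : ℂ) * I * (x.den * (1 / 2)) * x = 2 * Real.pi * I * m + Real.pi * I := by
    linear_combination Real.pi * I * (hx' + hm')
  rw [h, Complex.exp_add, exp_two_pi_mul_int, Complex.exp_pi_mul_I, one_mul]

lemma tsum_twistedCoeff_one (x : ℚ) (hx : x ∈ domain 1) {s : ℝ} (hs : 0 < s) :
    ∑' n : ℤ, twistedCoeff 1 x n * ((Real.exp (-(s * |(n : ℝ) + thetaShift 1|)) : ℝ) : ℂ)
      = Real.exp (-(s / 2)) * qpow (1 / 16) x *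
        (fineSum (qpow (1 / 2) x) (qpow 1 x) (Real.exp (-(1 * s)) : ℝ) /
          (1 - (Real.exp (-(1 * s)) : ℝ) * qpow (1 / 2) x)) := by
  set w := qpow (1 / 2) (x : ℂ) with hw
  -- Here the n-th term carries t^n, which matches e^(-sn); the shift by 1/2 in |n + 1/2| accounts
  -- for the separate factor e^(-s/2).
  set t := Real.exp (-(1 * s)) with ht
  have ht0 : 0 < t := Real.exp_pos _
  have ht1 : t < 1 := by rw [ht]; simpa using hs
  have hwn : ‖w‖ = 1 := by simpa [hw] using norm_qpow_of_real (1 / 2) x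
  have htn : ‖(t : ℂ)‖ < 1 := by rwa [Complex.norm_real, Real.norm_of_nonneg ht0.le]
  have htw : ‖(t : ℂ) * w‖ < 1 := by rwa [norm_mul, hwn, mul_one]
  have hyp := fineHyp_root_of_unity x.pos (isPrimitiveRoot_qpow x) (qpow_half_pow_den x hx) ht0 ht1
  rw [qpow_one_eq_sq, ← hw] at hyp
  rw [qpow_one_eq_sq, ← hw, fineSum_sq hyp hwn.le htw (exists_pos_le_norm_one_sub hwn.le htw),
    ← tsum_mul_left]
  have hterm : ∀ n : ℕ, twistedCoeff 1 x n *
      ((Real.exp (-(s * |((n : ℤ) : ℝ) + thetaShift 1|)) : ℝ) : ℂ)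
      = (Real.exp (-(s / 2)) * qpow (1 / 16) x *
        ((t : ℂ) ^ n * w ^ (n * (n + 1) / 2))) / 2 := by
    intro n
    have h1 : Real.exp (-(s * |((n : ℤ) : ℝ) + thetaShift 1|)) = Real.exp (-(s / 2)) * t ^ n := by
      rw [ht, ← Real.exp_nat_mul, ← Real.exp_add]
      congr 1
      simp only [thetaShift]
      push_cast
      rw [abs_of_nonneg (by positivity)]
      ring
    rw [twistedCoeff, thetaTerm_one_nat, h1, one_pow, ← hw]
    push_cast
    ring
  refine (hasSum_int_of_half hterm (fun n => ?_) ((summable_triangular hwn.le htw).mul_left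
    _)).tsum_eq
  rw [← hterm]
  simp only [twistedCoeff, thetaCoeff, thetaShift]
  have h2 : |((-((n : ℤ) + 1) : ℤ) : ℝ) + 1 / 2| = |((n : ℤ) : ℝ) + 1 / 2| := by
    rw [← abs_neg]
    congr 1
    push_cast
    ring
  rw [h2]
  congr 3
  push_cast
  ring

lemma tendsto_twistedCoeff (i : Fin 3) (x : ℚ) (hx : x ∈ domain i) :
    Tendsto (fun s : ℝ => (∑' n : ℤ, twistedCoeff i x n *
        ((Real.exp (-(s * |(n : ℝ) + thetaShift i|)) : ℝ) : ℂ)) / s) (𝓝[>] 0)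
      (𝓝 ((1 / (2 * Real.pi * Real.sqrt (2 * thetaScale i)) : ℝ) *
        ∫ u in Set.Ioi (0 : ℝ), theta i (x + I * u) * ((u ^ (-(3 / 2) : ℝ) : ℝ) : ℂ))) := by
  have hcongr : Set.EqOn (fun u : ℝ => theta i (x + I * u) * ((u ^ (-(3 / 2) : ℝ) : ℝ) : ℂ))
      (fun u : ℝ => thetaSeries (twistedCoeff i x) (thetaShift i) (thetaScale i) (I * u) *
        ((u ^ (-(3 / 2) : ℝ) : ℝ) : ℂ)) (Set.Ioi 0) := by
    intro u hu
    simp only [theta_vertical i x hu]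
  rw [setIntegral_congr_fun measurableSet_Ioi hcongr]
  exact tendsto_abel (norm_twistedCoeff_le i x) (thetaScale_pos i)
    ((integrableOn_eichler i x hx).congr_fun hcongr measurableSet_Ioi)

/-- One Abel sum divided by s has two limits: half the strange series, through Rogers–Fine with t =
e^(-s/2), and the integral, through subordination. The factor 1/2 compensates the scale 1 as against
1/4, so the second entry has the same constant. -/
lemma phi_zero_eq_eichler (x : ℚ) (hx : x ∈ domain 0) :
    phi x 0 = ((1 / (Real.pi * Real.sqrt 2) : ℝ) : ℂ) *
      ∫ u in Set.Ioi (0 : ℝ), theta 0 (x + I * u) * ((u ^ (-(3 / 2) : ℝ) : ℝ) : ℂ) := by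
  have hβ : (-1 : ℂ) ^ x.den = -1 := ((mem_domain_zero x).1 hx).neg_one_pow
  have h1 := tendsto_twistedCoeff 0 x hx
  have h2 := tendsto_fineSum_exp (c := 1 / 2) (by norm_num) x.pos (isPrimitiveRoot_qpow x) hβ
  rw [← phi_zero_eq] at h2
  have h3 := tendsto_nhds_unique (h1.congr' (by
    filter_upwards [self_mem_nhdsWithin] with s hs
    rw [tsum_twistedCoeff_zero x hx hs])) h2
  have h4 : (1 / (2 * Real.pi * Real.sqrt (2 * thetaScale 0)) : ℝ)
      = 1 / (Real.pi * Real.sqrt 2) * (1 / 2) := by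
    simp only [thetaScale]
    rw [mul_one, mul_assoc, one_div, mul_inv]
    ring
  rw [h4, Complex.ofReal_mul] at h3
  push_cast at h3 ⊢
  linear_combination (-2) * h3

lemma phi_one_eq_eichler (x : ℚ) (hx : x ∈ domain 1) :
    phi x 1 = ((1 / (Real.pi * Real.sqrt 2) : ℝ) : ℂ) *
      ∫ u in Set.Ioi (0 : ℝ), theta 1 (x + I * u) * ((u ^ (-(3 / 2) : ℝ) : ℝ) : ℂ) := by
  have hβ := qpow_half_pow_den x hx
  have hw1 : 1 - qpow (1 / 2) (x : ℂ) ≠ 0 := by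
    simpa using one_sub_root_ne_zero (isPrimitiveRoot_qpow x) hβ 0
  have h1 := tendsto_twistedCoeff 1 x hx
  have h2 := tendsto_fineSum_exp (c := 1) one_pos x.pos (isPrimitiveRoot_qpow x) hβ
  have h3 : Tendsto (fun s : ℝ => Real.exp (-(s / 2)) * qpow (1 / 16) x /
      (1 - (Real.exp (-(1 * s)) : ℝ) * qpow (1 / 2) x)) (𝓝[>] 0)
      (𝓝 (qpow (1 / 16) x / (1 - qpow (1 / 2) x))) := by
    have h5 : ContinuousAt (fun s : ℝ => ((Real.exp (-(s / 2)) : ℝ) : ℂ) * qpow (1 / 16) x /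
      (1 - (Real.exp (-(1 * s)) : ℝ) * qpow (1 / 2) x)) 0 := by
      refine ContinuousAt.div (by fun_prop) (by fun_prop) ?_
      simpa using hw1
    have h6 := h5.tendsto.mono_left (nhdsWithin_le_nhds (s := Set.Ioi 0))
    simpa using h6
  have h4 := tendsto_nhds_unique (h1.congr' (by
    filter_upwards [self_mem_nhdsWithin] with s hs
    rw [tsum_twistedCoeff_one x hx hs]
    exact show _ = Real.exp (-(s / 2)) * qpow (1 / 16) x /
      (1 - (Real.exp (-(1 * s)) : ℝ) * qpow (1 / 2) x) *
        (fineSum (qpow (1 / 2) x) (qpow 1 x) (Real.exp (-(1 * s)) : ℝ) / s) by ring)) (h3.mul h2)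
  have h7 : (1 / (2 * Real.pi * Real.sqrt (2 * thetaScale 1)) : ℝ)
      = 1 / (Real.pi * Real.sqrt 2) := by
    have h8 : Real.sqrt (2 * (1 / 4)) = Real.sqrt 2 / 2 := by
      rw [show (2 : ℝ) * (1 / 4) = 2 / 2 ^ 2 by norm_num, Real.sqrt_div' _ (by positivity),
        Real.sqrt_sq (by norm_num)]
    simp only [thetaScale]
    rw [h8]
    congr 1
    ring
  rw [h7] at h4
  rw [h4, phi_one_eq, Complex.ofReal_one, mul_one]

theorem phi_eq_eichler (i : Fin 3) (x : ℚ) (hx : x ∈ domain i) :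
    phi x i = ((1 / (Real.pi * Real.sqrt 2) : ℝ) : ℂ) *
      ∫ u in Set.Ioi (0 : ℝ), theta i (x + I * u) * ((u ^ (-(3 / 2) : ℝ) : ℝ) : ℂ) := by
  fin_cases i
  · exact phi_zero_eq_eichler x hx
  · exact phi_one_eq_eichler x hx
  · have hx1 : x + 1 ∈ domain 1 := add_one_mem_domain_one.2 hx
    have h1 := phi_one_eq_eichler (x + 1) hx1
    rw [phi_add_one_one] at h1
    have h2 : ∀ u : ℝ, theta 2 (x + I * u) * ((u ^ (-(3 / 2) : ℝ) : ℝ) : ℂ)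
        = (zeta 12)⁻¹ * (theta 1 ((x + 1 : ℚ) + I * u) * ((u ^ (-(3 / 2) : ℝ) : ℝ) : ℂ)) := by
      intro u
      rw [theta_two_eq, mul_assoc]
      congr 3
      push_cast
      ring
    change phi x 2 = _ * ∫ u in Set.Ioi (0 : ℝ), theta 2 (x + I * u) * _
    simp only [h2]
    rw [integral_const_mul, mul_left_comm, ← h1, inv_mul_cancel_left₀ (zeta_ne_zero 12)]

/-! ### The transformation laws of the theta functions -/

/-- The branch `(z / i) ^ (1 / 2)` on the upper half plane. -/
def halfRoot (z : ℂ) : ℂ := Complex.exp (Complex.log (-I * z) / 2)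

lemma neg_I_mul_re (z : ℂ) : (-I * z).re = z.im := by simp

lemma neg_I_mul_ne_zero {z : ℂ} (hz : 0 < z.im) : -I * z ≠ 0 := by
  intro h
  have := neg_I_mul_re z
  rw [h, Complex.zero_re] at this
  linarith

lemma halfRoot_sq {z : ℂ} (hz : 0 < z.im) : halfRoot z ^ 2 = -I * z := by
  rw [halfRoot, ← Complex.exp_nat_mul]
  push_cast
  rw [mul_div_cancel₀ _ two_ne_zero, Complex.exp_log (neg_I_mul_ne_zero hz)]

lemma halfRoot_ne_zero (z : ℂ) : halfRoot z ≠ 0 := Complex.exp_ne_zero _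

lemma abs_log_neg_I_mul_im {z : ℂ} (hz : 0 < z.im) : |(Complex.log (-I * z)).im| < Real.pi / 2 := by
  rw [Complex.log_im]
  exact Complex.abs_arg_lt_pi_div_two_iff.2 (Or.inl (by rwa [neg_I_mul_re]))

lemma exp_re_pos {w : ℂ} (hw : |w.im| < Real.pi / 2) : 0 < (Complex.exp w).re := by
  rw [Complex.exp_re]
  have := abs_lt.1 hw
  exact mul_pos (Real.exp_pos _) (Real.cos_pos_of_mem_Ioo ⟨this.1, this.2⟩)

lemma halfRoot_re_pos {z : ℂ} (hz : 0 < z.im) : 0 < (halfRoot z).re := by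
  refine exp_re_pos ?_
  have := abs_log_neg_I_mul_im hz
  rw [show Complex.log (-I * z) / 2 = ((1 / 2 : ℝ) : ℂ) * Complex.log (-I * z) by push_cast; ring,
    Complex.im_ofReal_mul, abs_mul, abs_of_pos (by norm_num : (0 : ℝ) < 1 / 2)]
  have hpi := Real.pi_pos
  linarith

lemma halfRoot_mul_re_pos {z w : ℂ} (hz : 0 < z.im) (hw : 0 < w.im) :
    0 < (halfRoot z * halfRoot w).re := by
  rw [halfRoot, halfRoot, ← Complex.exp_add]
  refine exp_re_pos ?_
  have h1 := abs_lt.1 (abs_log_neg_I_mul_im hz)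
  have h2 := abs_lt.1 (abs_log_neg_I_mul_im hw)
  rw [show Complex.log (-I * z) / 2 + Complex.log (-I * w) / 2
    = ((1 / 2 : ℝ) : ℂ) * (Complex.log (-I * z) + Complex.log (-I * w)) by push_cast; ring,
    Complex.im_ofReal_mul, Complex.add_im, abs_lt]
  constructor <;> linarith [h1.1, h1.2, h2.1, h2.2]

/-- All choices of branch for square roots in this part are settled by comparing squares and
checking that both sides lie in the right half plane. -/
lemma eq_of_sq_eq_of_re_pos {u v : ℂ} (h : u ^ 2 = v ^ 2) (hu : 0 < u.re) (hv : 0 < v.re) :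
    u = v := by
  rcases sq_eq_sq_iff_eq_or_eq_neg.1 h with h | h
  · exact h
  · rw [h, Complex.neg_re] at hu
    linarith

lemma halfRoot_mul_real {c : ℝ} (hc : 0 < c) {z : ℂ} (hz : 0 < z.im) :
    halfRoot (c * z) = Real.sqrt c * halfRoot z := by
  have hcz : 0 < ((c : ℂ) * z).im := by
    rw [Complex.im_ofReal_mul]
    positivity
  refine eq_of_sq_eq_of_re_pos ?_ (halfRoot_re_pos hcz) ?_
  · rw [mul_pow, halfRoot_sq hcz, halfRoot_sq hz, ← Complex.ofReal_pow, Real.sq_sqrt hc.le]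
    ring
  · rw [Complex.re_ofReal_mul]
    exact mul_pos (Real.sqrt_pos.2 hc) (halfRoot_re_pos hz)

lemma continuousAt_halfRoot {z : ℂ} (hz : 0 < z.im) : ContinuousAt halfRoot z := by
  refine ContinuousAt.comp (g := Complex.exp) Complex.continuous_exp.continuousAt ?_
  refine ContinuousAt.div_const ?_ 2
  refine ContinuousAt.clog (by fun_prop) (Or.inl ?_)
  rwa [neg_I_mul_re]

lemma neg_one_div_im_pos {z : ℂ} (hz : 0 < z.im) : 0 < (-1 / z).im := by
  rw [neg_div, one_div, Complex.neg_im, Complex.inv_im, neg_div, neg_neg]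
  refine div_pos hz (Complex.normSq_pos.2 ?_)
  intro h
  simp [h] at hz

lemma sqrt_eq_mul_halfRoot {z : ℂ} (hz : 0 < z.im) :
    Complex.sqrt z = Complex.sqrt I * halfRoot z := by
  have h0 : z ≠ 0 := by
    intro h
    simp [h] at hz
  have h1 : Complex.log z = Complex.log I + Complex.log (-I * z) := by
    rw [← Complex.log_mul I_ne_zero (neg_I_mul_ne_zero hz)]
    · congr 1
      linear_combination z * I_sq
    · have h2 := abs_lt.1 (abs_log_neg_I_mul_im hz)
      rw [Complex.log_im] at h2
      rw [Complex.arg_I]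
      constructor <;> linarith [h2.1, h2.2, Real.pi_pos]
  rw [Complex.sqrt, Complex.sqrt, Complex.cpow_def_of_ne_zero h0,
    Complex.cpow_def_of_ne_zero I_ne_zero, h1, add_mul, Complex.exp_add, halfRoot]
  rfl

lemma eta_neg_one_div {z : ℂ} (hz : 0 < z.im) :
    ModularForm.eta (-1 / z) = halfRoot z * ModularForm.eta z := by
  have h := ModularForm.eta_comp_eq_csqrt_I_inv hz
  simp only [Function.comp_apply, Pi.smul_apply, Pi.mul_apply, smul_eq_mul] at h
  rw [h, sqrt_eq_mul_halfRoot hz, mul_assoc, inv_mul_cancel_left₀]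
  rw [Complex.sqrt, Complex.cpow_def_of_ne_zero I_ne_zero]
  exact Complex.exp_ne_zero _

lemma theta_zero_neg_one_div {z : ℂ} (hz : 0 < z.im) :
    theta 0 (-1 / z) = Real.sqrt 2 * halfRoot z * theta 1 z := by
  have hz2 : 0 < (z / 2).im := by
    rw [show z / 2 = ((1 / 2 : ℝ) : ℂ) * z by push_cast; ring, Complex.im_ofReal_mul]
    linarith
  have h1 : halfRoot z = Real.sqrt 2 * halfRoot (z / 2) := by
    rw [← halfRoot_mul_real two_pos hz2]
    congr 1
    push_cast
    ring
  simp only [theta]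
  rw [eta_neg_one_div hz, show 2 * (-1 / z) = -1 / (z / 2) by field_simp, eta_neg_one_div hz2]
  have h2 := ModularForm.eta_ne_zero hz2
  have h3 := halfRoot_ne_zero (z / 2)
  rw [h1]
  field_simp

lemma theta_one_neg_one_div {z : ℂ} (hz : 0 < z.im) :
    theta 1 (-1 / z) = 1 / Real.sqrt 2 * halfRoot z * theta 0 z := by
  have hz2 : 0 < (2 * z).im := by simpa using hz
  have h1 : halfRoot (2 * z) = Real.sqrt 2 * halfRoot z := by
    rw [← halfRoot_mul_real two_pos hz]
    norm_num
  simp only [theta]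
  rw [eta_neg_one_div hz, show -1 / z / 2 = -1 / (2 * z) by ring, eta_neg_one_div hz2]
  have h2 := ModularForm.eta_ne_zero hz2
  have h3 := halfRoot_ne_zero z
  have h4 : ((Real.sqrt 2 : ℝ) : ℂ) ≠ 0 := by
    exact_mod_cast (Real.sqrt_pos.2 two_pos).ne'
  rw [h1]
  field_simp

lemma theta_zero_add_one (z : ℂ) : theta 0 (z + 1) = theta 0 z := by
  have h2 : zeta 24 ≠ 0 := zeta_ne_zero 24
  simp only [theta]
  rw [show 2 * (z + 1) = 2 * z + 1 + 1 by ring]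
  simp only [eta_add_one]
  field_simp

lemma theta_two_add_one (z : ℂ) : theta 2 (z + 1) = zeta 24 * theta 1 z := by
  have h2 : zeta 24 ≠ 0 := zeta_ne_zero 24
  simp only [theta]
  rw [show (z + 1) / 2 + 1 / 2 = z / 2 + 1 by ring]
  simp only [eta_add_one]
  field_simp

lemma zeta_mul_zeta_mul_halfRoot {z : ℂ} (hz : 0 < z.im) :
    zeta 12 * zeta 24 * halfRoot z = Complex.sqrt z := by
  have h : Complex.sqrt I = zeta 12 * zeta 24 := by
    rw [Complex.sqrt, Complex.cpow_def_of_ne_zero I_ne_zero, Complex.log_I, zeta, zeta,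
      ← Complex.exp_add]
    congr 1
    push_cast
    ring
  rw [sqrt_eq_mul_halfRoot hz, h]

lemma sqrt_sq_and_re_pos {z : ℂ} (hz : 0 < z.im) :
    Complex.sqrt z ^ 2 = z ∧ 0 < (Complex.sqrt z).re := by
  have h0 : z ≠ 0 := by
    intro h
    simp [h] at hz
  rw [Complex.sqrt, Complex.cpow_def_of_ne_zero h0]
  constructor
  · rw [← Complex.exp_nat_mul]
    push_cast
    rw [mul_comm, mul_assoc, inv_mul_cancel₀ two_ne_zero, mul_one, Complex.exp_log h0]
  · refine exp_re_pos ?_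
    rw [show Complex.log z * 2⁻¹ = ((1 / 2 : ℝ) : ℂ) * Complex.log z by push_cast; ring,
      Complex.im_ofReal_mul, Complex.log_im, abs_mul, abs_of_pos (by norm_num : (0 : ℝ) < 1 / 2)]
    have h1 : |z.arg| < Real.pi := by
      rw [abs_lt]
      refine ⟨Complex.neg_pi_lt_arg z, lt_of_le_of_ne (Complex.arg_le_pi z) fun h => ?_⟩
      have := (Complex.arg_eq_pi_iff.1 h).2
      linarith
    linarith

/-- Write θ₃(-1/z) through θ₂ at -1/z + 1 = -1/(z/(1 - z)). Inversion leads to θ₁ at z/(1 - z) =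
-1/(z - 1) - 1, a translation and a second inversion to θ₂(z - 1), which is θ₃(z) up to ζ₂₄. The
accumulated half roots multiply to ζ₁₂ζ₂₄ times that of z, which is √z. -/
lemma theta_two_neg_one_div {z : ℂ} (hz : 0 < z.im) :
    theta 2 (-1 / z) = halfRoot z * theta 2 z := by
  have h0 : z ≠ 0 := by
    intro h
    simp [h] at hz
  have h1 : z - 1 ≠ 0 := by
    intro h
    rw [sub_eq_zero] at h
    simp [h] at hz
  have h1' : 1 - z ≠ 0 := fun h => h1 (by linear_combination -h)
  have hz1 : 0 < (z - 1).im := by simpa using hz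
  have hu : z / (1 - z) = -1 / (z - 1) - 1 := by
    field_simp
    ring
  have hz2 : 0 < (z / (1 - z)).im := by
    rw [hu]
    simpa using neg_one_div_im_pos hz1
  have e1 : -1 / z + 1 = -1 / (z / (1 - z)) := by
    field_simp
    ring
  have e2 : theta 0 (z / (1 - z)) = theta 0 (-1 / (z - 1)) := by
    rw [← theta_zero_add_one (z / (1 - z)), hu, sub_add_cancel]
  have e3 : theta 2 z = zeta 24 * theta 1 (z - 1) := by
    rw [← theta_two_add_one, sub_add_cancel]
  have h4 : ((Real.sqrt 2 : ℝ) : ℂ) ≠ 0 := by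
    exact_mod_cast (Real.sqrt_pos.2 two_pos).ne'
  have hroot : halfRoot (z / (1 - z)) * halfRoot (z - 1) = zeta 12 * zeta 24 * halfRoot z := by
    rw [zeta_mul_zeta_mul_halfRoot hz]
    obtain ⟨hs, hre⟩ := sqrt_sq_and_re_pos hz
    refine eq_of_sq_eq_of_re_pos ?_ (halfRoot_mul_re_pos hz2 hz1) hre
    rw [mul_pow, halfRoot_sq hz2, halfRoot_sq hz1, hs]
    field_simp
    linear_combination (z - 1) * I_sq
  rw [theta_two_eq, e1, theta_one_neg_one_div hz2, e2, theta_zero_neg_one_div hz1, e3]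
  have h12 := zeta_ne_zero 12
  field_simp
  linear_combination theta 1 (z - 1) * hroot

lemma theta_neg_one_div (i : Fin 3) {z : ℂ} (hz : 0 < z.im) :
    theta i (-1 / z) = halfRoot z * matS.mulVec (fun j => theta j z) i := by
  rw [matS_mulVec]
  fin_cases i
  · change theta 0 (-1 / z) = halfRoot z * (Real.sqrt 2 * theta 1 z)
    rw [theta_zero_neg_one_div hz]
    ring
  · change theta 1 (-1 / z) = halfRoot z * (1 / Real.sqrt 2 * theta 0 z)
    rw [theta_one_neg_one_div hz]
    ring
  · exact theta_two_neg_one_div hz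

lemma theta_add_one (i : Fin 3) (z : ℂ) :
    theta i (z + 1) = matT.mulVec (fun j => theta j z) i := by
  rw [matT_mulVec]
  fin_cases i
  · exact theta_zero_add_one z
  · exact theta_one_add_one z
  · exact theta_two_add_one z

/-! ### The period integrals -/

/-- The form `θᵢ(τ) ((τ - x) / i) ^ (-3/2)` whose integrals give the strange series and the
period integrals. -/
def eichlerForm (i : Fin 3) (x τ : ℂ) : ℂ := theta i τ * (-I * (τ - x)) ^ (-(3 / 2) : ℂ)

lemma neg_I_mul_sub_re (x : ℝ) (τ : ℂ) : (-I * (τ - x)).re = τ.im := by simp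

lemma neg_I_mul_sub_mem_slitPlane (x : ℝ) {τ : ℂ} (hτ : 0 < τ.im) :
    -I * (τ - x) ∈ slitPlane := Or.inl (by rwa [neg_I_mul_sub_re])

lemma differentiableAt_eichlerForm (i : Fin 3) (x : ℝ) {τ : ℂ} (hτ : 0 < τ.im) :
    DifferentiableAt ℂ (eichlerForm i x) τ :=
  (differentiableAt_theta i hτ).mul
    (DifferentiableAt.cpow (by fun_prop) (by fun_prop) (neg_I_mul_sub_mem_slitPlane x hτ))

lemma norm_eichlerForm (i : Fin 3) (x τ : ℂ) :
    ‖eichlerForm i x τ‖ = ‖theta i τ‖ * ‖τ - x‖ ^ (-(3 / 2) : ℝ) := by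
  have h := Complex.norm_cpow_real (-I * (τ - x)) (-(3 / 2) : ℝ)
  push_cast at h
  rw [eichlerForm, norm_mul, h, norm_mul, norm_neg, norm_I, one_mul]

lemma norm_eichlerForm_le (i : Fin 3) (x : ℂ) {τ : ℂ} {M d : ℝ} (hM : ‖theta i τ‖ ≤ M)
    (hd : 0 < d) (hdτ : d ≤ ‖τ - x‖) : ‖eichlerForm i x τ‖ ≤ M * d ^ (-(3 / 2) : ℝ) := by
  rw [norm_eichlerForm]
  exact mul_le_mul hM (Real.rpow_le_rpow_of_nonpos hd hdτ (by norm_num)) (by positivity)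
    ((norm_nonneg _).trans hM)

lemma eichlerForm_vertical (i : Fin 3) (x : ℂ) {t : ℝ} (ht : 0 < t) :
    eichlerForm i x (x + I * t) = theta i (x + I * t) * ((t ^ (-(3 / 2) : ℝ) : ℝ) : ℂ) := by
  rw [eichlerForm, Complex.ofReal_cpow ht.le]
  congr 2
  · linear_combination (-(t : ℂ)) * I_sq
  · push_cast
    rfl

lemma continuousOn_eichlerForm_comp (i : Fin 3) (x : ℝ) {c : ℝ → ℂ} {s : Set ℝ}
    (hc : ContinuousOn c s) (hs : ∀ t ∈ s, 0 < (c t).im) :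
    ContinuousOn (fun t => eichlerForm i x (c t)) s := fun t ht =>
  ContinuousAt.comp_continuousWithinAt (g := eichlerForm i x)
    (differentiableAt_eichlerForm i x (hs t ht)).continuousAt (hc t ht)

lemma abs_le_norm_I_mul_sub (x t : ℝ) : |x| ≤ ‖I * (t : ℂ) - x‖ := by
  have := Complex.abs_re_le_norm (I * (t : ℂ) - x)
  simpa using this

lemma le_norm_I_mul_sub (x t : ℝ) : t ≤ ‖I * (t : ℂ) - x‖ := by
  have := (le_abs_self _).trans (Complex.abs_im_le_norm (I * (t : ℂ) - x))
  simpa using this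

/-- For x ≠ 0 the power is bounded near t = 0 and the growth t^(-1/2) of θ is integrable. For x = 0
one needs 0 to be a cusp in `domain i`, which excludes the second entry. -/
lemma integrableOn_eichlerForm (i : Fin 3) (x : ℝ) (hx : x ≠ 0 ∨ i ≠ 1) :
    IntegrableOn (fun t : ℝ => eichlerForm i x (I * t)) (Set.Ioi 0) := by
  rcases eq_or_ne x 0 with rfl | hx0
  · have h0 : (0 : ℚ) ∈ domain i := by
      have hi : i ≠ 1 := by simpa using hx
      fin_cases i
      · exact (mem_domain_zero 0).2 (by simp)
      · exact absurd rfl hi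
      · exact (mem_domain_two 0).2 (by simp)
    refine (integrableOn_eichler i 0 h0).congr_fun (fun t ht => ?_) measurableSet_Ioi
    have := eichlerForm_vertical i 0 ht
    simp only [zero_add] at this
    simp [this]
  · obtain ⟨C, hC0, hC⟩ := exists_norm_theta_le i
    have hθ : ∀ t : ℝ, 0 < t → ‖theta i (I * t)‖ ≤ C * (1 + t ^ (-(1 / 2) : ℝ)) := fun t ht => by
      simpa using hC (I * t) (by simpa using ht)
    have hx' : 0 < |x| := abs_pos.2 hx0
    set P := |x| ^ (-(3 / 2) : ℝ) with hP
    have hP0 : 0 < P := Real.rpow_pos_of_pos hx' _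
    refine integrableOn_Ioi_of_bounds (C := C * 2 * P + C * 2)
      (continuousOn_eichlerForm_comp i x (by fun_prop) fun t ht => by simpa using ht)
      (fun u hu hu1 => ?_) (fun u hu => ?_)
    · refine (norm_eichlerForm_le i x (hθ u hu) hx' (abs_le_norm_I_mul_sub x u)).trans ?_
      have h1 : 1 ≤ u ^ (-(1 / 2) : ℝ) :=
        Real.one_le_rpow_of_pos_of_le_one_of_nonpos hu hu1 (by norm_num)
      have h2 : C * (1 + u ^ (-(1 / 2) : ℝ)) ≤ C * 2 * u ^ (-(1 / 2) : ℝ) := by nlinarith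
      have h3 : 0 ≤ C * 2 * u ^ (-(1 / 2) : ℝ) := by positivity
      calc _ ≤ C * 2 * u ^ (-(1 / 2) : ℝ) * P := mul_le_mul_of_nonneg_right h2 hP0.le
        _ ≤ _ := by linarith
    · have hu0 : 0 < u := by linarith
      refine (norm_eichlerForm_le i x (hθ u hu0) hu0 (le_norm_I_mul_sub x u)).trans ?_
      refine mul_le_mul_of_nonneg_right ?_ (by positivity)
      have h1 := mul_le_mul_of_nonneg_left (one_add_rpow_le_two hu) hC0.le
      have h2 : 0 ≤ C * 2 * P := by positivity
      linarith

/-- Since -i(it - x) has positive real part, multiplying it by i adds πi/2 to the principal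
logarithm. The constant is i·i^(-3/2). -/
lemma periodIntegrand_eq (i : Fin 3) (x : ℝ) {t : ℝ} (ht : 0 < t) :
    periodIntegrand i x t = Complex.exp (-(Real.pi / 4 * I)) * eichlerForm i x (I * t) := by
  have him : 0 < (I * (t : ℂ)).im := by simpa using ht
  have h0 : -I * (I * (t : ℂ) - x) ≠ 0 := slitPlane_ne_zero (neg_I_mul_sub_mem_slitPlane x him)
  have h1 : I * (t : ℂ) - x = I * (-I * (I * t - x)) := by
    linear_combination (I * (t : ℂ) - x) * I_sq
  have hlog : Complex.log (I * (t : ℂ) - x) = Real.pi / 2 * I + Complex.log (-I * (I * t - x)) := by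
    rw [← Complex.log_I]
    nth_rewrite 1 [h1]
    refine Complex.log_mul I_ne_zero h0 ?_
    have h2 : |Complex.arg (-I * (I * (t : ℂ) - x))| < Real.pi / 2 :=
      Complex.abs_arg_lt_pi_div_two_iff.2 (Or.inl (by rwa [neg_I_mul_sub_re]))
    have h3 := abs_lt.1 h2
    rw [Complex.arg_I]
    constructor <;> linarith [h3.1, h3.2, Real.pi_pos]
  have h4 : I * (t : ℂ) - x ≠ 0 := by
    rw [h1]
    exact mul_ne_zero I_ne_zero h0
  have h5 : ((I * (t : ℂ) - x) ^ (3 / 2 : ℂ))⁻¹ * I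
      = Complex.exp (-(Real.pi / 4 * I)) * (-I * (I * t - x)) ^ (-(3 / 2) : ℂ) := by
    rw [Complex.cpow_def_of_ne_zero h4, Complex.cpow_def_of_ne_zero h0, hlog, ← Complex.exp_neg]
    generalize Complex.log (-I * (I * t - x)) = L
    calc _ = Complex.exp (-((Real.pi / 2 * I + L) * (3 / 2))) * Complex.exp (Real.pi / 2 * I) := by
          rw [Complex.exp_pi_div_two_mul_I]
      _ = _ := by
          rw [← Complex.exp_add, ← Complex.exp_add]
          congr 1
          ring
  rw [periodIntegrand, eichlerForm, div_eq_mul_inv, mul_assoc, h5]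
  ring

theorem integrableOn_periodIntegrand (i : Fin 3) (x : ℝ) (hx : x ≠ 0 ∨ i ≠ 1) :
    IntegrableOn (periodIntegrand i x) (Set.Ioi 0) :=
  IntegrableOn.congr_fun
    ((integrableOn_eichlerForm i x hx).const_mul (Complex.exp (-(Real.pi / 4 * I)))) (fun _ ht =>
      (periodIntegrand_eq i x ht).symm) measurableSet_Ioi

lemma exp_neg_pi_div_four : Complex.exp (-(Real.pi / 4 * I)) = (1 - I) / Real.sqrt 2 := by
  have h2 : Real.sqrt 2 ^ 2 = 2 := Real.sq_sqrt (by norm_num)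
  have h0 : Real.sqrt 2 ≠ 0 := (Real.sqrt_pos.2 two_pos).ne'
  have h3 : Real.sqrt 2 / 2 = 1 / Real.sqrt 2 := by
    field_simp
    exact h2
  have h1 : -((Real.pi : ℂ) / 4 * I) = ((-(Real.pi / 4) : ℝ) : ℂ) * I := by push_cast; ring
  rw [h1, Complex.exp_mul_I, ← Complex.ofReal_cos, ← Complex.ofReal_sin, Real.cos_neg, Real.sin_neg,
    Real.cos_pi_div_four, Real.sin_pi_div_four, h3]
  push_cast
  ring

/-- The normalisation i/(π(1 + i)) is what removes the phase e^(-πi/4) and leaves the constant of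
`phi_eq_eichler`. -/
lemma g_eq (i : Fin 3) (x : ℝ) :
    g x i = ((1 / (Real.pi * Real.sqrt 2) : ℝ) : ℂ) *
      ∫ t in Set.Ioi (0 : ℝ), eichlerForm i x (I * t) := by
  have h0 : (1 : ℂ) + I ≠ 0 := by
    intro h
    simpa using congrArg Complex.re h
  have h1 : ((Real.sqrt 2 : ℝ) : ℂ) ≠ 0 := by
    exact_mod_cast (Real.sqrt_pos.2 two_pos).ne'
  have hpi : (Real.pi : ℂ) ≠ 0 := by exact_mod_cast Real.pi_ne_zero
  rw [g, setIntegral_congr_fun measurableSet_Ioi fun t ht => periodIntegrand_eq i x ht,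
    integral_const_mul, exp_neg_pi_div_four, ← mul_assoc]
  congr 1
  push_cast
  field_simp
  linear_combination -I_sq

/-! ### The contour argument -/

/-- Improper integrals are truncated at cε and 1/ε so that the endpoints of different paths can be
compared. The freedom in c is needed at the cusp x, where inversion scales heights by x². -/
lemma tendsto_sub_of_hasDerivAt {G f : ℝ → ℂ} (hG : ∀ t > 0, HasDerivAt G (f t) t)
    (hf : IntegrableOn f (Set.Ioi 0)) {c : ℝ} (hc : 0 < c) :
    Tendsto (fun ε => G ε⁻¹ - G (c * ε)) (𝓝[>] 0) (𝓝 (∫ t in Set.Ioi (0 : ℝ), f t)) := by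
  have ha : Tendsto (fun ε : ℝ => c * ε) (𝓝[>] 0) (𝓝 0) := by
    have : ContinuousAt (fun ε : ℝ => c * ε) 0 := by fun_prop
    simpa [ContinuousAt] using this.tendsto.mono_left (nhdsWithin_le_nhds (s := Set.Ioi 0))
  have hb : Tendsto (fun ε : ℝ => ε⁻¹) (𝓝[>] 0) atTop := tendsto_inv_nhdsGT_zero
  have hcov : AECover (volume.restrict (Set.Ioi (0 : ℝ))) (𝓝[>] (0 : ℝ))
      fun ε : ℝ => Set.Ioc (c * ε) ε⁻¹ := by
    refine ⟨(ae_restrict_iff' measurableSet_Ioi).2 (ae_of_all _ fun t ht => ?_),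
      fun _ => measurableSet_Ioc⟩
    filter_upwards [ha.eventually (gt_mem_nhds ht), hb.eventually (eventually_ge_atTop t)]
      with ε h1 h2 using ⟨h1, h2⟩
  refine (hcov.integral_tendsto_of_countably_generated hf).congr' ?_
  filter_upwards [ha.eventually (gt_mem_nhds one_pos), hb.eventually (eventually_ge_atTop 1),
    self_mem_nhdsWithin] with ε h1 h2 h3
  have hε : 0 < c * ε := mul_pos hc h3
  have hle : c * ε ≤ ε⁻¹ := h1.le.trans h2
  rw [Measure.restrict_restrict measurableSet_Ioc, Set.inter_eq_left.2
    (Set.Ioc_subset_Ioi_self.trans (Set.Ioi_subset_Ioi hε.le)),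
      ← intervalIntegral.integral_of_le hle]
  refine intervalIntegral.integral_eq_sub_of_hasDerivAt (fun t ht => hG t ?_) ?_
  · rw [Set.uIcc_of_le hle] at ht
    exact hε.trans_le ht.1
  · rw [intervalIntegrable_iff_integrableOn_Ioc_of_le hle]
    exact hf.mono_set fun t ht => hε.trans ht.1

lemma tendsto_sub_zero_of_deriv_bound {F f : ℂ → ℂ} (hF : ∀ τ : ℂ, 0 < τ.im → HasDerivAt F (f τ) τ)
    {p q : ℝ → ℂ} {r M : ℝ → ℝ} (hpq : ∀ᶠ ε in 𝓝[>] (0 : ℝ), ‖p ε - q ε‖ ≤ r ε)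
    (him : ∀ᶠ ε in 𝓝[>] (0 : ℝ), ∀ τ : ℂ, ‖τ - q ε‖ ≤ r ε → 0 < τ.im ∧ ‖f τ‖ ≤ M ε)
    (hlim : Tendsto (fun ε => M ε * r ε) (𝓝[>] 0) (𝓝 0)) :
    Tendsto (fun ε => F (p ε) - F (q ε)) (𝓝[>] 0) (𝓝 0) := by
  refine squeeze_zero_norm' ?_ hlim
  filter_upwards [hpq, him] with ε h1 h2
  have h0 : 0 ≤ r ε := (norm_nonneg _).trans h1
  have hq : ‖q ε - q ε‖ ≤ r ε := by simpa using h0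
  have hM : 0 ≤ M ε := (norm_nonneg _).trans (h2 _ hq).2
  have h3 := Convex.norm_image_sub_le_of_norm_hasDerivWithin_le (f := F) (f' := f)
    (s := Metric.closedBall (q ε) (r ε)) (C := M ε) (x := q ε) (y := p ε)
    (fun τ hτ => (hF τ (h2 τ (mem_closedBall_iff_norm.1 hτ)).1).hasDerivWithinAt)
    (fun τ hτ => (h2 τ (mem_closedBall_iff_norm.1 hτ)).2) (convex_closedBall _ _)
    (mem_closedBall_iff_norm.2 hq) (mem_closedBall_iff_norm.2 h1)
  exact h3.trans (mul_le_mul_of_nonneg_left h1 hM)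

/-- The form is holomorphic on the convex upper half plane. A primitive replaces Cauchy's theorem
for the closed contour: only differences at nearby endpoints remain to be estimated. -/
lemma exists_primitive_eichlerForm (i : Fin 3) (x : ℝ) :
    ∃ F : ℂ → ℂ, ∀ τ : ℂ, 0 < τ.im → HasDerivAt F (eichlerForm i x τ) τ := by
  have hconv : Convex ℝ {τ : ℂ | 0 < τ.im} := convex_halfSpace_im_gt 0
  have hopen : IsOpen {τ : ℂ | 0 < τ.im} := isOpen_lt continuous_const Complex.continuous_im
  obtain ⟨F, hF⟩ := hconv.exists_forall_hasDerivWithinAt (f := eichlerForm i x)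
    fun τ hτ => (differentiableAt_eichlerForm i x hτ).differentiableWithinAt
  exact ⟨F, fun τ hτ => (hF τ hτ).hasDerivAt (hopen.mem_nhds hτ)⟩

lemma im_ge_of_norm_sub_le {τ q : ℂ} {r : ℝ} (h : ‖τ - q‖ ≤ r) : q.im - r ≤ τ.im := by
  have := (abs_le.1 ((Complex.abs_im_le_norm (τ - q)).trans h)).1
  rw [Complex.sub_im] at this
  linarith

lemma exists_norm_theta_le_of_le_im (i : Fin 3) : ∃ C > 0, ∀ (τ : ℂ) (h : ℝ), 0 < h → h ≤ 1 →
    h ≤ τ.im → ‖theta i τ‖ ≤ C * h ^ (-(1 / 2) : ℝ) := by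
  obtain ⟨C, hC0, hC⟩ := exists_norm_theta_le i
  refine ⟨C * 2, by positivity, fun τ h h0 h1 hτ => (hC τ (h0.trans_le hτ)).trans ?_⟩
  have h2 : 1 ≤ h ^ (-(1 / 2) : ℝ) :=
    Real.one_le_rpow_of_pos_of_le_one_of_nonpos h0 h1 (by norm_num)
  have h3 : τ.im ^ (-(1 / 2) : ℝ) ≤ h ^ (-(1 / 2) : ℝ) :=
    Real.rpow_le_rpow_of_nonpos h0 hτ (by norm_num)
  rw [mul_assoc]
  exact mul_le_mul_of_nonneg_left (by linarith) hC0.le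

lemma im_le_norm_sub_ofReal (τ : ℂ) (x : ℝ) : τ.im ≤ ‖τ - x‖ := by
  have := (le_abs_self _).trans (Complex.abs_im_le_norm (τ - x))
  simpa using this

lemma eventually_mul_le (a : ℝ) {b : ℝ} (hb : 0 < b) : ∀ᶠ ε in 𝓝[>] (0 : ℝ), a * ε ≤ b := by
  have h : Tendsto (fun ε : ℝ => a * ε) (𝓝 0) (𝓝 (a * 0)) :=
    Continuous.tendsto (f := fun ε : ℝ => a * ε) (by fun_prop) 0
  rw [mul_zero] at h
  filter_upwards [(h.mono_left (nhdsWithin_le_nhds (s := Set.Ioi 0))).eventually (gt_mem_nhds hb)]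
    with ε hε using le_of_lt hε

/-- The two endpoints stay at distance |x|, while at height about 1/ε the form is O(ε^(3/2)). -/
lemma tendsto_eichler_infinity (i : Fin 3) (x : ℝ) {F : ℂ → ℂ}
    (hF : ∀ τ : ℂ, 0 < τ.im → HasDerivAt F (eichlerForm i x τ) τ) :
    Tendsto (fun ε : ℝ => F (I * (ε⁻¹ : ℝ)) - F (x + I * (ε⁻¹ : ℝ))) (𝓝[>] 0) (𝓝 0) := by
  obtain ⟨C, hC0, hC⟩ := exists_norm_theta_le_of_le_im i
  refine tendsto_sub_zero_of_deriv_bound hF (r := fun _ => |x|)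
    (M := fun ε => C * (2 * ε) ^ (3 / 2 : ℝ)) (Eventually.of_forall fun ε => ?_) ?_ ?_
  · simp
  · filter_upwards [eventually_mul_le (2 * |x|) one_pos, eventually_mul_le 2 one_pos,
      self_mem_nhdsWithin] with ε h1 h2 hε τ hτ
    have hε : 0 < ε := hε
    have h3 := im_ge_of_norm_sub_le hτ
    have h4 : ((x : ℂ) + I * ((ε⁻¹ : ℝ) : ℂ)).im = ε⁻¹ := by simp
    have h5 : 2 * |x| ≤ ε⁻¹ := by rwa [← one_div, le_div_iff₀ hε]
    have h6 : 2 ≤ ε⁻¹ := by rwa [← one_div, le_div_iff₀ hε]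
    have h7 : (2 * ε)⁻¹ ≤ τ.im := by
      rw [mul_inv]
      rw [h4] at h3
      linarith
    have h8 : 1 ≤ τ.im := by
      rw [h4] at h3
      linarith
    refine ⟨by linarith, ?_⟩
    have h9 := hC τ 1 one_pos le_rfl h8
    rw [Real.one_rpow, mul_one] at h9
    have h10 := norm_eichlerForm_le i x h9 (d := (2 * ε)⁻¹) (by positivity)
      (h7.trans (im_le_norm_sub_ofReal τ x))
    rwa [Real.inv_rpow (by positivity), Real.rpow_neg (by positivity), inv_inv] at h10
  · have h : ContinuousAt (fun ε : ℝ => C * (2 * ε) ^ (3 / 2 : ℝ) * |x|) 0 := by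
      refine ContinuousAt.mul (continuousAt_const.mul ?_) continuousAt_const
      exact ContinuousAt.rpow_const (by fun_prop) (Or.inr (by norm_num))
    have h1 := h.tendsto.mono_left (nhdsWithin_le_nhds (s := Set.Ioi 0))
    simpa [Real.zero_rpow (by norm_num : (3 / 2 : ℝ) ≠ 0)] using h1

/-- The two endpoints differ by O(ε²), and near iε the form is O(1/ε), the factor (τ - x)^(-3/2)
being bounded there. -/
lemma tendsto_eichler_zero (i : Fin 3) {x : ℝ} (hx : x ≠ 0) {F : ℂ → ℂ}
    (hF : ∀ τ : ℂ, 0 < τ.im → HasDerivAt F (eichlerForm i x τ) τ) :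
    Tendsto (fun ε : ℝ => F (-1 / (-1 / (x : ℂ) + I * (ε⁻¹ : ℝ))) - F (I * ε)) (𝓝[>] 0) (𝓝 0) := by
  obtain ⟨C, hC0, hC⟩ := exists_norm_theta_le_of_le_im i
  have hx' : 0 < |x| := abs_pos.2 hx
  have hxC : (x : ℂ) ≠ 0 := by exact_mod_cast hx
  set P := (|x| / 2) ^ (-(3 / 2) : ℝ) with hP
  have hP0 : 0 < P := Real.rpow_pos_of_pos (by positivity) _
  refine tendsto_sub_zero_of_deriv_bound hF (r := fun ε => |x|⁻¹ * ε ^ 2)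
    (M := fun ε => C * (2 / ε) * P) ?_ ?_ ?_
  · filter_upwards [self_mem_nhdsWithin] with ε hε
    have hε : 0 < ε := hε
    have hεC : (ε : ℂ) ≠ 0 := by exact_mod_cast hε.ne'
    have h1 : 1 ≤ ‖-(ε : ℂ) / x + I‖ := by
      have h2 := Complex.abs_im_le_norm (((-ε / x : ℝ) : ℂ) + I)
      rw [Complex.add_im, Complex.ofReal_im, Complex.I_im, zero_add, abs_one] at h2
      push_cast at h2
      exact h2
    have h0 : -(ε : ℂ) / x + I ≠ 0 := by
      intro h
      rw [h, norm_zero] at h1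
      linarith
    have h0' : -1 / (x : ℂ) + I * (ε⁻¹ : ℝ) = (-(ε : ℂ) / x + I) / ε := by
      push_cast
      field_simp
    have h3 : -1 / (-1 / (x : ℂ) + I * (ε⁻¹ : ℝ)) - I * ε
        = (I * (ε ^ 2 / x : ℝ)) / (-(ε : ℂ) / x + I) := by
      rw [h0', eq_div_iff h0, sub_mul]
      rw [show -1 / ((-(ε : ℂ) / x + I) / ε) * (-(ε : ℂ) / x + I)
        = -ε * ((-(ε : ℂ) / x + I) / (-(ε : ℂ) / x + I)) by rw [div_div_eq_mul_div]; ring,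
        div_self h0]
      push_cast
      linear_combination (-(ε : ℂ)) * I_sq
    rw [h3, norm_div, norm_mul, norm_I, one_mul, Complex.norm_real, norm_div, Real.norm_eq_abs,
      Real.norm_eq_abs, abs_of_nonneg (sq_nonneg ε)]
    refine (div_le_self (by positivity) h1).trans (le_of_eq ?_)
    ring
  · filter_upwards [eventually_mul_le (2 * |x|⁻¹) one_pos, eventually_mul_le 1 one_pos,
      eventually_mul_le 4 hx', self_mem_nhdsWithin] with ε h1 h2 h3 hε τ hτ
    have hε : 0 < ε := hε
    have h4 := im_ge_of_norm_sub_le hτ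
    have h5 : (I * (ε : ℂ)).im = ε := by simp
    rw [h5] at h4
    have h6 : |x|⁻¹ * ε ^ 2 ≤ ε / 2 := by nlinarith
    have h7 : ε / 2 ≤ τ.im := by linarith
    refine ⟨by linarith, ?_⟩
    have h8 : |x| / 2 ≤ ‖τ - x‖ := by
      have e1 : ‖τ‖ ≤ ‖τ - I * ε‖ + ‖I * (ε : ℂ)‖ := by
        simpa using norm_add_le (τ - I * ε) (I * ε)
      have e2 : ‖I * (ε : ℂ)‖ = ε := by
        rw [norm_mul, norm_I, one_mul, Complex.norm_real, Real.norm_of_nonneg hε.le]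
      have e3 := norm_sub_norm_le (x : ℂ) τ
      rw [Complex.norm_real, Real.norm_eq_abs, norm_sub_rev] at e3
      linarith
    have h9 : ‖theta i τ‖ ≤ C * (2 / ε) := by
      refine (hC τ (ε / 2) (by positivity) (by linarith) h7).trans
        (mul_le_mul_of_nonneg_left ?_ hC0.le)
      have := Real.rpow_le_rpow_of_exponent_ge (x := ε / 2) (by positivity) (by linarith)
        (by norm_num : (-1 : ℝ) ≤ -(1 / 2))
      rwa [Real.rpow_neg_one, inv_div] at this
    exact norm_eichlerForm_le i x h9 (by positivity) h8
  · have h : ContinuousAt (fun ε : ℝ => C * 2 * P * |x|⁻¹ * ε) 0 := by fun_prop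
    have h1 := h.tendsto.mono_left (nhdsWithin_le_nhds (s := Set.Ioi 0))
    rw [mul_zero] at h1
    refine h1.congr' ?_
    filter_upwards [self_mem_nhdsWithin] with ε hε
    have hε : ε ≠ 0 := ne_of_gt hε
    field_simp

/-- The endpoint -1/(-1/x + iε) is x + ix²ε + O(ε²). With h of order ε, the form there is at most of
order h^(1/2)·h^(-3/2) = 1/h, and the disc of radius O(ε²) makes the difference vanish. -/
lemma tendsto_eichler_cusp (i : Fin 3) {x : ℚ} (hx : x ∈ domain i) (hx0 : x ≠ 0) {F : ℂ → ℂ}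
    (hF : ∀ τ : ℂ, 0 < τ.im → HasDerivAt F (eichlerForm i (x : ℝ) τ) τ) :
    Tendsto (fun ε : ℝ => F (-1 / (-1 / (x : ℂ) + I * ε)) - F (x + I * ((x ^ 2 : ℝ) * ε : ℝ)))
      (𝓝[>] 0) (𝓝 0) := by
  obtain ⟨C, hC0, hC⟩ := exists_norm_theta_add_sub_le i
  obtain ⟨K, hK0, hK⟩ := exists_theta_decay i x hx 1
  have hxR : (x : ℝ) ≠ 0 := by exact_mod_cast hx0
  have hx' : 0 < |(x : ℝ)| := abs_pos.2 hxR
  have hxC : (x : ℂ) ≠ 0 := by exact_mod_cast hx0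
  set B := K * 3 + C * (8 / |(x : ℝ)|) with hB
  have hx2 : |(x : ℝ)| ^ 2 = (x : ℝ) ^ 2 := sq_abs _
  have hx2' : 0 < (x : ℝ) ^ 2 := by positivity
  refine tendsto_sub_zero_of_deriv_bound hF (r := fun ε => |(x : ℝ)| ^ 3 * ε ^ 2)
    (M := fun ε => B / ((x : ℝ) ^ 2 * ε / 2)) ?_ ?_ ?_
  · filter_upwards [self_mem_nhdsWithin] with ε hε
    have h1 : 1 ≤ ‖1 - I * (ε * x : ℝ)‖ := by
      have h2 := Complex.abs_re_le_norm (1 - I * ((ε * x : ℝ) : ℂ))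
      have h3 : (1 - I * ((ε * x : ℝ) : ℂ)).re = 1 := by simp
      rwa [h3, abs_one] at h2
    have h0 : 1 - I * ((ε * x : ℝ) : ℂ) ≠ 0 := by
      intro h
      rw [h, norm_zero] at h1
      linarith
    have h3 : -1 / (-1 / (x : ℂ) + I * ε) - (x + I * ((x ^ 2 : ℝ) * ε : ℝ))
        = (-(x ^ 3 * ε ^ 2 : ℝ)) / (1 - I * (ε * x : ℝ)) := by
      have h4 : -1 / (x : ℂ) + I * ε = (1 - I * (ε * x : ℝ)) * (-1 / x) := by
        push_cast
        field_simp
        ring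
      have h5 : -1 / ((1 - I * ((ε * x : ℝ) : ℂ)) * (-1 / x)) * (1 - I * ((ε * x : ℝ) : ℂ))
          = x * ((1 - I * ((ε * x : ℝ) : ℂ)) / (1 - I * ((ε * x : ℝ) : ℂ))) := by
        rw [mul_div, div_div_eq_mul_div]
        generalize 1 - I * ((ε * x : ℝ) : ℂ) = w
        ring
      rw [h4, eq_div_iff h0, sub_mul, h5, div_self h0]
      push_cast
      linear_combination ((x : ℂ) ^ 3 * ε ^ 2) * I_sq
    rw [h3, norm_div, norm_neg, Complex.norm_real, norm_mul, norm_pow, norm_pow, Real.norm_eq_abs,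
      Real.norm_eq_abs, sq_abs]
    exact div_le_self (by positivity) h1
  · filter_upwards [eventually_mul_le (2 * |(x : ℝ)|) one_pos,
      eventually_mul_le (2 * (x : ℝ) ^ 2) one_pos, self_mem_nhdsWithin] with ε h1 h2 hε τ hτ
    have hε : 0 < ε := hε
    set h := (x : ℝ) ^ 2 * ε / 2 with hh
    have hh0 : 0 < h := by positivity
    have hr : |(x : ℝ)| ^ 3 * ε ^ 2 = 4 * h ^ 2 / |(x : ℝ)| := by
      rw [hh, ← hx2]
      field_simp
      ring
    have hrh : |(x : ℝ)| ^ 3 * ε ^ 2 ≤ h := by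
      have e1 : |(x : ℝ)| ^ 3 * ε ^ 2 = h * (2 * |(x : ℝ)| * ε) := by
        rw [hh, ← hx2]
        ring
      rw [e1]
      exact mul_le_of_le_one_right hh0.le h1
    have hkey : ∀ y : ℝ, ((x : ℂ) + I * (y : ℂ)).im = y ∧ ((x : ℂ) + I * (y : ℂ)).re = x := by
      intro y
      simp
    have h3 : ((x : ℂ) + I * ((x ^ 2 : ℝ) * ε : ℝ)).im = 2 * h := by
      rw [(hkey _).1, hh]
      ring
    have h3' : ((x : ℂ) + I * ((x ^ 2 : ℝ) * ε : ℝ)).re = x := (hkey _).2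
    have h4 := (abs_le.1 ((Complex.abs_im_le_norm _).trans hτ))
    rw [Complex.sub_im, h3] at h4
    have h5 := (Complex.abs_re_le_norm _).trans hτ
    rw [Complex.sub_re, h3'] at h5
    have h6 : h ≤ τ.im := by linarith [h4.1]
    have h7 : τ.im ≤ 3 * h := by linarith [h4.2]
    have him : 0 < τ.im := by linarith
    refine ⟨him, ?_⟩
    -- Cusp decay is known only on the vertical line above x; the horizontal displacement, of size
    -- O(h²), is handled by `exists_norm_theta_add_sub_le`.
    have hsplit : τ = ((x : ℂ) + I * τ.im) + ((τ.re - x : ℝ) : ℂ) := by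
      apply Complex.ext <;> simp
    have h8 := hC ((x : ℂ) + I * τ.im) (by simpa using him) (τ.re - x)
    rw [← hsplit] at h8
    have h9 : ((x : ℂ) + I * τ.im).im = τ.im := by simp
    rw [h9] at h8
    have h10 := hK τ.im him (by linarith)
    rw [pow_one] at h10
    have hq1 : 1 ≤ h ^ (-(1 / 2) : ℝ) :=
      Real.one_le_rpow_of_pos_of_le_one_of_nonpos hh0 (by linarith) (by norm_num)
    have hq2 : τ.im ^ (-(1 / 2) : ℝ) ≤ h ^ (-(1 / 2) : ℝ) :=
      Real.rpow_le_rpow_of_nonpos hh0 h6 (by norm_num)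
    have hq3 : h * h ^ (-(1 / 2) : ℝ) = h ^ (1 / 2 : ℝ) := by
      rw [mul_comm, ← Real.rpow_add_one hh0.ne']
      norm_num
    have hq4 : h ≤ h ^ (1 / 2 : ℝ) := by
      rw [← hq3]
      exact le_mul_of_one_le_right hh0.le hq1
    have h11 : C * |τ.re - x| / τ.im * (1 + τ.im ^ (-(1 / 2) : ℝ))
        ≤ C * (8 / |(x : ℝ)|) * h ^ (1 / 2 : ℝ) := by
      calc _ ≤ C * (4 * h ^ 2 / |(x : ℝ)|) / h * (2 * h ^ (-(1 / 2) : ℝ)) := by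
            rw [hr] at h5
            gcongr
            linarith
        _ = C * (8 / |(x : ℝ)|) * (h * h ^ (-(1 / 2) : ℝ)) := by
            field_simp
            ring
        _ = _ := by rw [hq3]
    have h12 : ‖theta i τ‖ ≤ B * h ^ (1 / 2 : ℝ) := by
      have e1 : ‖theta i τ‖ ≤ ‖theta i (x + I * τ.im)‖ + ‖theta i τ - theta i (x + I * τ.im)‖ := by
        simpa using norm_add_le (theta i (x + I * τ.im)) (theta i τ - theta i (x + I * τ.im))
      have e2 : K * τ.im ≤ K * 3 * h ^ (1 / 2 : ℝ) := by
        rw [mul_assoc]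
        exact mul_le_mul_of_nonneg_left (by linarith) hK0.le
      rw [hB, add_mul]
      linarith
    have h13 := norm_eichlerForm_le i (x : ℝ) h12 hh0 (h6.trans (im_le_norm_sub_ofReal τ x))
    refine h13.trans (le_of_eq ?_)
    rw [mul_assoc, ← Real.rpow_add hh0, show (1 / 2 : ℝ) + -(3 / 2) = -1 by norm_num,
      Real.rpow_neg_one, div_eq_mul_inv]
  · have h : ContinuousAt (fun ε : ℝ => B * 2 * |(x : ℝ)| * ε) 0 := by fun_prop
    have h1 := h.tendsto.mono_left (nhdsWithin_le_nhds (s := Set.Ioi 0))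
    rw [mul_zero] at h1
    refine h1.congr' ?_
    filter_upwards [self_mem_nhdsWithin] with ε hε
    have hε : ε ≠ 0 := ne_of_gt hε
    rw [← hx2]
    field_simp

/-! ### The inversion law -/

lemma log_neg_I_mul {τ : ℂ} (hτ : 0 < τ.im) :
    Complex.log (-I * τ) = Complex.log τ - Real.pi / 2 * I := by
  have h : Complex.log τ = Complex.log I + Complex.log (-I * τ) := by
    rw [← Complex.log_mul I_ne_zero (neg_I_mul_ne_zero hτ)]
    · congr 1
      linear_combination τ * I_sq
    · have h2 := abs_lt.1 (abs_log_neg_I_mul_im hτ)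
      rw [Complex.log_im] at h2
      rw [Complex.arg_I]
      constructor <;> linarith [h2.1, h2.2, Real.pi_pos]
  rw [h, Complex.log_I]
  ring

lemma log_neg_of_im_pos {τ : ℂ} (hτ : 0 < τ.im) :
    Complex.log (-τ) = Complex.log τ - Real.pi * I := by
  rw [Complex.log, Complex.log, norm_neg, Complex.arg_neg_eq_arg_sub_pi_of_im_pos hτ]
  push_cast
  ring

lemma ne_zero_of_im_pos {τ : ℂ} (hτ : 0 < τ.im) : τ ≠ 0 := by
  rintro rfl
  simp at hτ

lemma inversion_phase {x u : ℝ} (hx : x ≠ 0) (hu : 0 < u) {τ : ℂ} (hτ : 0 < τ.im) :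
    (halfRoot τ)⁻¹ * ((u * x : ℝ) * τ) ^ (-(3 / 2) : ℂ) * (I * τ ^ 2)
      = -I * (I * x) ^ (-(3 / 2) : ℂ) * ((u ^ (-(3 / 2) : ℝ) : ℝ) : ℂ) := by
  have hτ0 := ne_zero_of_im_pos hτ
  have hxC : (x : ℂ) ≠ 0 := by exact_mod_cast hx
  have huC : (u : ℂ) ≠ 0 := by exact_mod_cast hu.ne'
  have hI : I = Complex.exp (Real.pi / 2 * I) := Complex.exp_pi_div_two_mul_I.symm
  have hI' : -I = Complex.exp (-(Real.pi / 2 * I)) := by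
    rw [Complex.exp_neg, Complex.exp_pi_div_two_mul_I, Complex.inv_I]
  have h1 : (halfRoot τ)⁻¹ = Complex.exp (-((Complex.log τ - Real.pi / 2 * I) / 2)) := by
    rw [halfRoot, log_neg_I_mul hτ, Complex.exp_neg]
  have h2 : τ ^ 2 = Complex.exp (2 * Complex.log τ) := by
    rw [two_mul, Complex.exp_add, Complex.exp_log hτ0, sq]
  have h3 : ((u ^ (-(3 / 2) : ℝ) : ℝ) : ℂ) = Complex.exp (-(3 / 2) * Real.log u) := by
    rw [Real.rpow_def_of_pos hu]
    push_cast
    rw [mul_comm]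
  have h4 : I * τ ^ 2 = Complex.exp (Real.pi / 2 * I + 2 * Complex.log τ) := by
    rw [Complex.exp_add, ← h2, Complex.exp_pi_div_two_mul_I]
  have h5 : ((u * x : ℝ) : ℂ) * τ ≠ 0 := by
    push_cast
    exact mul_ne_zero (mul_ne_zero huC hxC) hτ0
  rw [h4, h1, h3, hI', Complex.cpow_def_of_ne_zero h5,
    Complex.cpow_def_of_ne_zero (mul_ne_zero I_ne_zero hxC)]
  simp only [← Complex.exp_add]
  rw [Complex.exp_eq_exp_iff_exists_int]
  -- For either sign of x the two exponents differ by exactly 2πi.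
  refine ⟨1, ?_⟩
  rcases lt_or_gt_of_ne hx with hneg | hpos
  · have h6 : Complex.log (((u * x : ℝ) : ℂ) * τ)
        = Real.log u + Real.log (-x) + (Complex.log τ - Real.pi * I) := by
      rw [show ((u * x : ℝ) : ℂ) * τ = ((u * -x : ℝ) : ℂ) * -τ by push_cast; ring,
        Complex.log_ofReal_mul (by nlinarith) (neg_ne_zero.2 hτ0), log_neg_of_im_pos hτ,
        Real.log_mul hu.ne' (by linarith)]
      push_cast
      ring
    have h7 : Complex.log (I * x) = Real.log (-x) - Real.pi / 2 * I := by
      rw [show I * (x : ℂ) = ((-x : ℝ) : ℂ) * -I by push_cast; ring,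
        Complex.log_ofReal_mul (by linarith) (neg_ne_zero.2 I_ne_zero), Complex.log_neg_I]
      ring
    rw [h6, h7]
    push_cast
    ring
  · have h6 : Complex.log (((u * x : ℝ) : ℂ) * τ)
        = Real.log u + Real.log x + Complex.log τ := by
      rw [Complex.log_ofReal_mul (by positivity) hτ0, Real.log_mul hu.ne' hx]
      push_cast
      ring
    have h7 : Complex.log (I * x) = Real.log x + Real.pi / 2 * I := by
      rw [mul_comm, Complex.log_ofReal_mul hpos I_ne_zero, Complex.log_I]
    rw [h6, h7]
    push_cast
    ring

/-- Pulling back the form at `x` under `τ ↦ -1 / τ` gives the form at `-1 / x`. -/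
lemma eichlerForm_pullback {i j : Fin 3} {m : ℂ}
    (hθ : ∀ τ : ℂ, 0 < τ.im → theta i (-1 / τ) = halfRoot τ * (m * theta j τ))
    {x u : ℝ} (hx : x ≠ 0) (hu : 0 < u) :
    m * (eichlerForm j x (-1 / (-1 / (x : ℂ) + I * u)) * (I / (-1 / (x : ℂ) + I * u) ^ 2))
      = -I * (I * x) ^ (-(3 / 2) : ℂ) *
        (theta i (-1 / (x : ℂ) + I * u) * ((u ^ (-(3 / 2) : ℝ) : ℝ) : ℂ)) := by
  have hxC : (x : ℂ) ≠ 0 := by exact_mod_cast hx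
  set σ := -1 / (x : ℂ) + I * u with hσ
  have hσim : 0 < σ.im := by
    have : σ.im = u := by
      rw [hσ, show -1 / (x : ℂ) = ((-1 / x : ℝ) : ℂ) by push_cast; rfl]
      simp
    rwa [this]
  have hσ0 := ne_zero_of_im_pos hσim
  set τ := -1 / σ with hτ
  have hτim : 0 < τ.im := neg_one_div_im_pos hσim
  have hστ : σ = -1 / τ := by
    rw [hτ]
    field_simp
  have h1 : -I * (τ - x) = (u * x : ℝ) * τ := by
    rw [hτ]
    have h2 : x * σ = -1 + I * u * x := by
      rw [hσ, mul_add, mul_div_cancel₀ _ hxC]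
      ring
    push_cast
    rw [show -1 / σ - (x : ℂ) = (-1 - x * σ) / σ by field_simp, h2]
    field_simp
    linear_combination (u * x : ℂ) * I_sq
  have h3 : I / σ ^ 2 = I * τ ^ 2 := by
    rw [hτ]
    field_simp
  have h4 : m * theta j τ = theta i σ * (halfRoot τ)⁻¹ := by
    have h5 := halfRoot_ne_zero τ
    rw [hστ, hθ τ hτim]
    field_simp
  rw [eichlerForm, h1, h3]
  linear_combination (((u * x : ℝ) : ℂ) * τ) ^ (-(3 / 2) : ℂ) * (I * τ ^ 2) * h4 +
    theta i σ * inversion_phase hx hu hτim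

/-- The form based at x is integrated along three paths: the imaginary axis from 0 to i∞, the
vertical line from x to i∞, and the image under inversion of the vertical line above -1/x, which
runs from x to 0. They give the period integral, the Eichler integral at x and, by
`eichlerForm_pullback`, the one at -1/x. Axis plus image minus vertical line is zero because the
endpoint gaps vanish in the limit. -/
theorem phi_neg_one_div {i j : Fin 3} {m : ℂ}
    (hθ : ∀ τ : ℂ, 0 < τ.im → theta i (-1 / τ) = halfRoot τ * (m * theta j τ))
    {x : ℚ} (hx0 : x ≠ 0) (hi : -1 / x ∈ domain i) (hj : x ∈ domain j) :
    (I * (x : ℂ)) ^ (-(3 / 2) : ℂ) * phi (-1 / x) i + m * phi x j = m * g (x : ℝ) j := by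
  have hxR : (x : ℝ) ≠ 0 := by exact_mod_cast hx0
  have hxC : (x : ℂ) ≠ 0 := by exact_mod_cast hx0
  have hcast : (((x : ℝ)) : ℂ) = (x : ℂ) := by simp
  obtain ⟨F, hF⟩ := exists_primitive_eichlerForm j (x : ℝ)
  have hcurve : ∀ (c : ℝ) (t : ℝ), HasDerivAt (fun t : ℝ => (c : ℂ) + I * (t : ℂ)) I t := by
    intro c t
    have h := ((hasDerivAt_id t).ofReal_comp.const_mul I).const_add (c : ℂ)
    simpa using h
  have hvert : ∀ (c : ℝ) (t : ℝ), 0 < t → HasDerivAt (fun t : ℝ => F (c + I * (t : ℂ)))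
      (eichlerForm j (x : ℝ) (c + I * t) * I) t := fun c t ht =>
    (hF (c + I * t) (by simpa using ht)).comp_of_eq t (hcurve c t) rfl
  have hT0 := tendsto_sub_of_hasDerivAt (hvert 0)
    (by simpa [IntegrableOn] using (integrableOn_eichlerForm j (x : ℝ)
      (Or.inl hxR)).mul_const I) one_pos
  have hE : Set.EqOn (fun t : ℝ => eichlerForm j (x : ℝ) ((x : ℝ) + I * t) * I)
      (fun t : ℝ => theta j (x + I * t) * ((t ^ (-(3 / 2) : ℝ) : ℝ) : ℂ) * I) (Set.Ioi 0) := by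
    intro t ht
    simp only [eichlerForm_vertical j _ ht, hcast]
  have hTx := tendsto_sub_of_hasDerivAt (hvert x)
    (IntegrableOn.congr_fun ((integrableOn_eichler j x hj).mul_const I) hE.symm measurableSet_Ioi)
    (c := (x : ℝ) ^ 2) (by positivity)
  have him : ∀ t : ℝ, 0 < t → 0 < (-1 / (x : ℂ) + I * t).im := by
    intro t ht
    rw [← hcast, show -1 / ((x : ℝ) : ℂ) = ((-1 / (x : ℝ) : ℝ) : ℂ) by push_cast; rfl]
    simpa using ht
  have hJ : ∀ t : ℝ, 0 < t → HasDerivAt (fun t : ℝ => F (-1 / (-1 / (x : ℂ) + I * (t : ℂ))))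
      (eichlerForm j (x : ℝ) (-1 / (-1 / (x : ℂ) + I * t)) * (I / (-1 / (x : ℂ) + I * t) ^ 2)) t :=
        by
    intro t ht
    refine (hF _ (neg_one_div_im_pos (him t ht))).comp_of_eq t ?_ rfl
    have h1 := hcurve (-1 / (x : ℝ)) t
    push_cast at h1
    have h2 := (h1.inv (ne_zero_of_im_pos (him t ht))).neg
    refine (h2.congr_deriv (by ring)).congr_of_eventuallyEq (Eventually.of_forall fun t => ?_)
    simp [div_eq_mul_inv]
  have hmap : Set.EqOn (fun t : ℝ => m * (eichlerForm j (x : ℝ) (-1 / (-1 / (x : ℂ) + I * t)) *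
        (I / (-1 / (x : ℂ) + I * t) ^ 2)))
      (fun t : ℝ => -I * (I * (x : ℂ)) ^ (-(3 / 2) : ℂ) *
        (theta i ((-1 / x : ℚ) + I * t) * ((t ^ (-(3 / 2) : ℝ) : ℝ) : ℂ))) (Set.Ioi 0) := by
    intro t ht
    have := eichlerForm_pullback hθ hxR ht
    push_cast at this ⊢
    exact this
  have hmJ : ∀ t : ℝ, t > 0 → HasDerivAt (fun t : ℝ => m * F (-1 / (-1 / (x : ℂ) + I * (t : ℂ))))
      (m * (eichlerForm j (x : ℝ) (-1 / (-1 / (x : ℂ) + I * t)) *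
        (I / (-1 / (x : ℂ) + I * t) ^ 2))) t := fun t ht => (hJ t ht).const_mul m
  have hTJ := tendsto_sub_of_hasDerivAt hmJ
    (IntegrableOn.congr_fun ((integrableOn_eichler i (-1 / x) hi).const_mul
      (-I * (I * (x : ℂ)) ^ (-(3 / 2) : ℂ))) hmap.symm measurableSet_Ioi) one_pos
  have hsum := ((hT0.const_mul m).add hTJ).sub (hTx.const_mul m)
  have hzero := (((tendsto_eichler_infinity j (x : ℝ) hF).add
    (tendsto_eichler_zero j hxR hF)).sub (tendsto_eichler_cusp j hj hx0 hF)).const_mul m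
  have hkey := tendsto_nhds_unique hsum (hzero.congr fun ε => by
    simp only [hcast, ofReal_zero, zero_add, one_mul]
    ring)
  rw [setIntegral_congr_fun measurableSet_Ioi hE, setIntegral_congr_fun measurableSet_Ioi hmap,
    integral_mul_const, integral_mul_const, integral_const_mul] at hkey
  simp only [ofReal_zero, zero_add, add_zero, sub_zero, mul_zero] at hkey
  rw [g_eq, phi_eq_eichler i _ hi, phi_eq_eichler j _ hj]
  generalize (∫ t in Set.Ioi (0 : ℝ), eichlerForm j (x : ℝ) (I * t)) = A at hkey ⊢
  generalize (∫ t in Set.Ioi (0 : ℝ), theta j (x + I * t) * ((t ^ (-(3 / 2) : ℝ) : ℝ) : ℂ)) = B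
    at hkey ⊢
  generalize (∫ t in Set.Ioi (0 : ℝ), theta i ((-1 / x : ℚ) + I * t) *
    ((t ^ (-(3 / 2) : ℝ) : ℝ) : ℂ)) = D at hkey ⊢
  generalize ((1 / (Real.pi * Real.sqrt 2) : ℝ) : ℂ) = κ
  generalize (I * (x : ℂ)) ^ (-(3 / 2) : ℂ) = w at hkey ⊢
  linear_combination (κ * I) * hkey + (κ * (w * D + m * B - m * A)) * I_sq

/-! ### Parity and the inversion law -/

/-- The linear form in numerator and denominator whose parity decides about membership in
`domain i`. -/
def parityForm : Fin 3 → ℤ → ℤ → ℤ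
  | 0, _, b => b
  | 1, a, _ => a
  | 2, a, b => a + b

lemma mem_domain_iff_parityForm (i : Fin 3) (x : ℚ) :
    x ∈ domain i ↔ Odd (parityForm i x.num x.den) := by
  fin_cases i
  · exact (mem_domain_zero x).trans (by simp [parityForm])
  · exact mem_domain_one x
  · refine (mem_domain_two x).trans ?_
    have h := odd_num_or_odd_den x
    change Even (x.num * x.den) ↔ Odd (x.num + (x.den : ℤ))
    have h' : Odd x.num ∨ Odd (x.den : ℤ) := by simpa using h
    rw [Int.even_mul, Int.odd_add, ← Int.not_odd_iff_even, ← Int.not_odd_iff_even]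
    tauto

/-- Parity ignores signs, so the criterion holds for any coprime representation, also with negative
denominator. This makes it usable after a Möbius map. -/
lemma mem_domain_div (i : Fin 3) {a b : ℤ} (hab : IsCoprime a b) (hb : b ≠ 0) :
    (a : ℚ) / b ∈ domain i ↔ Odd (parityForm i a b) := by
  have key : ∀ {a b : ℤ}, IsCoprime a b → 0 < b →
      ((a : ℚ) / b ∈ domain i ↔ Odd (parityForm i a b)) := by
    intro a b hab hb
    have hc : a.natAbs.Coprime b.natAbs := Int.isCoprime_iff_gcd_eq_one.1 hab
    rw [mem_domain_iff_parityForm, Rat.num_div_eq_of_coprime hb hc, Rat.den_div_eq_of_coprime hb hc]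
  rcases lt_or_gt_of_ne hb with h | h
  · have h1 := key (hab.neg_neg) (by linarith : 0 < -b)
    have h2 : ((-a : ℤ) : ℚ) / ((-b : ℤ) : ℚ) = a / b := by
      push_cast
      rw [neg_div_neg_eq]
    rw [h2] at h1
    rw [h1]
    fin_cases i
    · exact odd_neg
    · exact odd_neg
    · change Odd (-a + -b) ↔ Odd (a + b)
      rw [← neg_add, odd_neg]
  · exact key hab h

lemma isCoprime_num_den (x : ℚ) : IsCoprime x.num (x.den : ℤ) :=
  Int.isCoprime_iff_gcd_eq_one.2 x.reduced

lemma neg_one_div_mem_domain (i : Fin 3) {z : ℚ} (hz : z ≠ 0) :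
    -1 / z ∈ domain i ↔ z ∈ domain (![1, 0, 2] i) := by
  have hn : z.num ≠ 0 := Rat.num_ne_zero.2 hz
  have h1 : -1 / z = ((-(z.den : ℤ) : ℤ) : ℚ) / (z.num : ℚ) := by
    nth_rewrite 1 [← Rat.num_div_den z]
    push_cast
    rw [div_div_eq_mul_div, neg_one_mul]
  rw [h1, mem_domain_div i (isCoprime_num_den z).symm.neg_left hn, mem_domain_iff_parityForm]
  fin_cases i
  · exact Iff.rfl
  · exact odd_neg
  · change Odd (-(z.den : ℤ) + z.num) ↔ Odd (z.num + (z.den : ℤ))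
    rw [Int.odd_add', Int.odd_add, even_neg]

lemma matS_mulVec_eq (i : Fin 3) : ∃ m : ℂ, ∀ v : Fin 3 → ℂ,
    matS.mulVec v i = m * v (![1, 0, 2] i) := by
  fin_cases i
  · exact ⟨Real.sqrt 2, fun v => by rw [matS_mulVec]; rfl⟩
  · exact ⟨1 / Real.sqrt 2, fun v => by rw [matS_mulVec]; rfl⟩
  · exact ⟨1, fun v => by rw [matS_mulVec, one_mul]; rfl⟩

lemma matS_apply_ne_zero {i j : Fin 3} (h : matS i j ≠ 0) : j = ![1, 0, 2] i := by
  fin_cases i <;> fin_cases j <;> first | rfl | exact absurd rfl h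

theorem inversion_law (z : ℚ) (hz : z ≠ 0) (i : Fin 3) (hi : -1 / z ∈ domain i) :
    (∀ j, matS i j ≠ 0 → z ∈ domain j) ∧
      (((z : ℂ) / (-I)) ^ (-(3 / 2) : ℂ) • phi (-1 / z) + matS.mulVec (phi z)) i =
        matS.mulVec (g (z : ℝ)) i := by
  have hj := (neg_one_div_mem_domain i hz).1 hi
  refine ⟨fun j h => by rwa [matS_apply_ne_zero h], ?_⟩
  obtain ⟨m, hm⟩ := matS_mulVec_eq i
  have h1 : (z : ℂ) / (-I) = I * z := by
    rw [div_neg, div_I]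
    ring
  rw [Pi.add_apply, Pi.smul_apply, smul_eq_mul, hm, hm, h1]
  refine phi_neg_one_div (fun τ hτ => ?_) hz hi hj
  rw [theta_neg_one_div i hτ, hm]

/-! ### Regularity of the period integrals -/

/-- The integral `∫_0^∞ w(t) (t + i z) ^ (-p) dt`. -/
def powerTransform (w : ℝ → ℂ) (p : ℝ) (z : ℂ) : ℂ :=
  ∫ t in Set.Ioi (0 : ℝ), w t * ((t : ℂ) + I * z) ^ (-p : ℂ)

lemma norm_cpow_neg (w : ℂ) (p : ℝ) : ‖w ^ (-p : ℂ)‖ = ‖w‖ ^ (-p) := by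
  have := Complex.norm_cpow_real w (-p)
  push_cast at this
  exact this

lemma hasDerivAt_power (p t : ℝ) {z : ℂ} (h : (t : ℂ) + I * z ∈ slitPlane) :
    HasDerivAt (fun z : ℂ => ((t : ℂ) + I * z) ^ (-p : ℂ))
      (-p * I * ((t : ℂ) + I * z) ^ (-((p + 1 : ℝ) : ℂ))) z := by
  have h1 : HasDerivAt (fun z : ℂ => (t : ℂ) + I * z) I z := by
    simpa using ((hasDerivAt_id z).const_mul I).const_add (t : ℂ)
  refine (h1.cpow_const (c := (-p : ℂ)) h).congr_deriv ?_
  rw [show (-p : ℂ) - 1 = -((p + 1 : ℝ) : ℂ) by push_cast; ring]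
  ring

lemma mem_slitPlane_of_re_ne_zero (t : ℝ) {z : ℂ} (hz : z.re ≠ 0) :
    (t : ℂ) + I * z ∈ slitPlane := by
  refine Or.inr ?_
  simpa using hz

lemma mem_slitPlane_of_pos {t : ℝ} (ht : 0 < t) (x : ℝ) : (t : ℂ) + I * x ∈ slitPlane := by
  refine Or.inl ?_
  simpa using ht

lemma continuousOn_power {p : ℝ} {z : ℂ} {s : Set ℝ} (h : ∀ t ∈ s, (t : ℂ) + I * z ∈ slitPlane) :
    ContinuousOn (fun t : ℝ => ((t : ℂ) + I * z) ^ (-p : ℂ)) s := by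
  intro t ht
  refine ContinuousAt.continuousWithinAt ?_
  exact ContinuousAt.cpow (by fun_prop) (by fun_prop) (h t ht)

lemma abs_re_le_norm_add_I_mul (t : ℝ) (z : ℂ) : |z.re| ≤ ‖(t : ℂ) + I * z‖ := by
  have := Complex.abs_im_le_norm ((t : ℂ) + I * z)
  simpa using this

/-- For fixed z off the imaginary axis, |t + i Re z| is at most a constant multiple of |t + iz| for
all t, since |t + iz| ≥ |Re z|. Integrability thus reduces to real parameters. -/
lemma integrable_power_of_re_ne_zero {w : ℝ → ℂ} (hw : ContinuousOn w (Set.Ioi 0)) {p : ℝ}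
    (hp : 0 ≤ p)
    (hInt : ∀ x : ℝ, x ≠ 0 →
      IntegrableOn (fun t : ℝ => w t * ((t : ℂ) + I * x) ^ (-p : ℂ)) (Set.Ioi 0))
    {z : ℂ} (hz : z.re ≠ 0) :
    IntegrableOn (fun t : ℝ => w t * ((t : ℂ) + I * z) ^ (-p : ℂ)) (Set.Ioi 0) := by
  have hr : 0 < |z.re| := abs_pos.2 hz
  set c := 1 + |z.im| / |z.re| with hc
  have hc0 : 0 < c := by positivity
  refine Integrable.mono' ((hInt z.re hz).norm.const_mul (c ^ p))
    ((hw.mul (continuousOn_power fun t _ => mem_slitPlane_of_re_ne_zero t hz)).aestronglyMeasurable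
      measurableSet_Ioi) (ae_of_all _ fun t => ?_)
  rw [norm_mul, norm_mul, norm_cpow_neg, norm_cpow_neg, mul_left_comm]
  refine mul_le_mul_of_nonneg_left ?_ (norm_nonneg _)
  have h1 := abs_re_le_norm_add_I_mul t z
  have h2 : ‖(t : ℂ) + I * (z.re : ℝ)‖ ≤ c * ‖(t : ℂ) + I * z‖ := by
    have e1 : (t : ℂ) + I * (z.re : ℝ) = ((t : ℂ) + I * z) + z.im := by
      nth_rewrite 2 [← Complex.re_add_im z]
      linear_combination (-(z.im : ℂ)) * I_sq
    have e2 : |z.im| ≤ |z.im| / |z.re| * ‖(t : ℂ) + I * z‖ := by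
      calc |z.im| = |z.im| / |z.re| * |z.re| := by field_simp
        _ ≤ _ := mul_le_mul_of_nonneg_left h1 (by positivity)
    rw [e1]
    refine (norm_add_le _ _).trans ?_
    rw [Complex.norm_real, Real.norm_eq_abs, hc, add_mul, one_mul]
    linarith
  have h3 : 0 < ‖(t : ℂ) + I * (z.re : ℝ)‖ :=
    norm_pos_iff.2 (slitPlane_ne_zero (mem_slitPlane_of_re_ne_zero t (by simpa using hz)))
  have h5 : 0 < ‖(t : ℂ) + I * z‖ := hr.trans_le h1
  have h4 := Real.rpow_le_rpow_of_nonpos h3 h2 (neg_nonpos.2 hp)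
  rw [Real.mul_rpow hc0.le h5.le, Real.rpow_neg hc0.le] at h4
  rwa [inv_mul_le_iff₀ (by positivity)] at h4

lemma differentiableAt_powerTransform {w : ℝ → ℂ} (hw : ContinuousOn w (Set.Ioi 0)) {p : ℝ}
    (hp : 0 ≤ p)
    (hInt : ∀ x : ℝ, x ≠ 0 →
      IntegrableOn (fun t : ℝ => w t * ((t : ℂ) + I * x) ^ (-p : ℂ)) (Set.Ioi 0))
    {z : ℂ} (hz : z.re ≠ 0) : DifferentiableAt ℂ (powerTransform w p) z := by
  set δ := |z.re| / 2 with hδ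
  have hδ0 : 0 < δ := by
    have := abs_pos.2 hz
    positivity
  have hball : ∀ y ∈ Metric.ball z δ, δ ≤ |y.re| ∧ ‖y - z‖ ≤ δ := by
    intro y hy
    have h1 : ‖y - z‖ < δ := mem_ball_iff_norm.1 hy
    have h2 := (Complex.abs_re_le_norm (y - z)).trans h1.le
    rw [Complex.sub_re] at h2
    have h3 := abs_sub_abs_le_abs_sub z.re y.re
    rw [abs_sub_comm] at h3
    exact ⟨by linarith, h1.le⟩
  have hne : ∀ y ∈ Metric.ball z δ, y.re ≠ 0 := fun y hy =>
    abs_pos.1 (hδ0.trans_le (hball y hy).1)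
  have h := hasDerivAt_integral_of_dominated_loc_of_deriv_le (𝕜 := ℂ)
    (μ := volume.restrict (Set.Ioi (0 : ℝ)))
    (F := fun (y : ℂ) (t : ℝ) => w t * ((t : ℂ) + I * y) ^ (-p : ℂ))
    (F' := fun (y : ℂ) (t : ℝ) => w t * (-p * I * ((t : ℂ) + I * y) ^ (-((p + 1 : ℝ) : ℂ))))
    (x₀ := z) (s := Metric.ball z δ)
    -- p comes from differentiating the power, δ⁻¹ bounds the additional inverse factor, and 2^p
    -- compares |t + iy| with |t + iz| on the ball of radius δ.
    (bound := fun t => p * δ⁻¹ * 2 ^ p * ‖w t * ((t : ℂ) + I * z) ^ (-p : ℂ)‖)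
    (Metric.ball_mem_nhds z hδ0) ?_ (integrable_power_of_re_ne_zero hw hp hInt hz) ?_ ?_
    ((integrable_power_of_re_ne_zero hw hp hInt hz).norm.const_mul _) ?_
  · exact h.2.differentiableAt
  · filter_upwards [Metric.ball_mem_nhds z hδ0] with y hy
    exact (hw.mul (continuousOn_power fun t _ =>
      mem_slitPlane_of_re_ne_zero t (hne y hy))).aestronglyMeasurable measurableSet_Ioi
  · exact (hw.mul (continuousOn_const.mul (continuousOn_power fun t _ =>
      mem_slitPlane_of_re_ne_zero t hz))).aestronglyMeasurable measurableSet_Ioi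
  · refine ae_of_all _ fun t y hy => ?_
    obtain ⟨h1, h2⟩ := hball y hy
    have h3 := h1.trans (abs_re_le_norm_add_I_mul t y)
    have h4 : ‖(t : ℂ) + I * z‖ ≤ 2 * ‖(t : ℂ) + I * y‖ := by
      have e1 : (t : ℂ) + I * z = ((t : ℂ) + I * y) - I * (y - z) := by ring
      rw [e1]
      refine (norm_sub_le _ _).trans ?_
      rw [norm_mul I, norm_I, one_mul]
      linarith
    have h5 : 0 < ‖(t : ℂ) + I * y‖ := hδ0.trans_le h3
    have h6 : 0 < ‖(t : ℂ) + I * z‖ :=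
      norm_pos_iff.2 (slitPlane_ne_zero (mem_slitPlane_of_re_ne_zero t hz))
    have h7 := Real.rpow_le_rpow_of_nonpos h6 h4 (neg_nonpos.2 hp)
    rw [Real.mul_rpow two_pos.le h5.le, Real.rpow_neg two_pos.le,
      inv_mul_le_iff₀ (by positivity)] at h7
    have h8 : ‖(t : ℂ) + I * y‖⁻¹ ≤ δ⁻¹ := inv_anti₀ hδ0 h3
    rw [norm_mul, norm_mul, norm_mul, norm_mul, norm_cpow_neg, norm_cpow_neg, norm_neg, norm_I,
      mul_one, Complex.norm_real, Real.norm_of_nonneg hp, neg_add, Real.rpow_add h5,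
      Real.rpow_neg_one]
    calc ‖w t‖ * (p * (‖(t : ℂ) + I * y‖ ^ (-p) * ‖(t : ℂ) + I * y‖⁻¹))
        ≤ ‖w t‖ * (p * ((2 ^ p * ‖(t : ℂ) + I * z‖ ^ (-p)) * δ⁻¹)) := by gcongr
      _ = _ := by ring
  · exact ae_of_all _ fun t y hy =>
      (hasDerivAt_power p t (mem_slitPlane_of_re_ne_zero t (hne y hy))).const_mul (w t)

/-- The integral is holomorphic off the imaginary axis, an open set that contains the non-zero
reals. -/
lemma analyticOnNhd_powerTransform {w : ℝ → ℂ} (hw : ContinuousOn w (Set.Ioi 0)) {p : ℝ}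
    (hp : 0 ≤ p)
    (hInt : ∀ x : ℝ, x ≠ 0 →
      IntegrableOn (fun t : ℝ => w t * ((t : ℂ) + I * x) ^ (-p : ℂ)) (Set.Ioi 0)) :
    AnalyticOnNhd ℝ (fun x : ℝ => powerTransform w p x) {0}ᶜ := by
  intro x hx
  have hx0 : x ≠ 0 := hx
  have hopen : IsOpen {z : ℂ | z.re ≠ 0} := isOpen_ne_fun Complex.continuous_re continuous_const
  have h1 : AnalyticAt ℂ (powerTransform w p) (x : ℂ) :=
    DifferentiableOn.analyticAt (s := {z : ℂ | z.re ≠ 0})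
      (fun z hz => (differentiableAt_powerTransform hw hp hInt hz).differentiableWithinAt)
      (hopen.mem_nhds (by simpa using hx0))
  exact (h1.restrictScalars (𝕜 := ℝ)).comp_of_eq (Complex.ofRealCLM.analyticAt x) rfl

lemma eichlerForm_I_mul (i : Fin 3) (x t : ℝ) : eichlerForm i x (I * t)
    = theta i (I * t) * ((t : ℂ) + I * x) ^ (-((3 / 2 : ℝ) : ℂ)) := by
  rw [eichlerForm]
  congr 2
  · linear_combination (-(t : ℂ)) * I_sq
  · push_cast
    rfl

lemma continuousOn_theta_I (i : Fin 3) : ContinuousOn (fun t : ℝ => theta i (I * t)) (Set.Ioi 0) :=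
    by
  simpa using continuousOn_theta_vertical i 0 (by simp)

lemma g_eq_powerTransform (i : Fin 3) (x : ℝ) : g x i =
    ((1 / (Real.pi * Real.sqrt 2) : ℝ) : ℂ) *
      powerTransform (fun t => theta i (I * t)) (3 / 2) x := by
  rw [g_eq]
  simp only [eichlerForm_I_mul]
  rfl

theorem analyticOnNhd_g (i : Fin 3) : AnalyticOnNhd ℝ (fun x => g x i) {0}ᶜ := by
  simp only [g_eq_powerTransform]
  refine analyticOnNhd_const.mul (analyticOnNhd_powerTransform (continuousOn_theta_I i)
    (by norm_num) fun x hx => ?_)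
  simpa only [eichlerForm_I_mul] using integrableOn_eichlerForm i x (Or.inl hx)

/-! ### Smoothness at the origin -/

/-- Weights on the half-line that are bounded near `∞` and vanish to infinite order at `0`. -/
structure FlatWeight (w : ℝ → ℂ) : Prop where
  continuousOn : ContinuousOn w (Set.Ioi 0)
  bounded : ∃ C, ∀ t, 1 ≤ t → ‖w t‖ ≤ C
  flat : ∀ k : ℕ, ∃ C, ∀ t, 0 < t → t ≤ 1 → ‖w t‖ ≤ C * t ^ k

lemma FlatWeight.integrableOn {w : ℝ → ℂ} (hw : FlatWeight w) {p : ℝ} (hp : 3 / 2 ≤ p) :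
    IntegrableOn (fun t : ℝ => w t * ((t ^ (-p) : ℝ) : ℂ)) (Set.Ioi 0) := by
  obtain ⟨C, hC⟩ := hw.bounded
  obtain ⟨k, hk⟩ := exists_nat_ge p
  obtain ⟨K, hK⟩ := hw.flat k
  have hC0 : 0 ≤ C := (norm_nonneg _).trans (hC 1 le_rfl)
  have hK0 : 0 ≤ K := by
    have := (norm_nonneg _).trans (hK 1 one_pos le_rfl)
    simpa using this
  refine integrableOn_Ioi_of_bounds (C := K + C) (hw.continuousOn.mul (continuousOn_rpow_cast _))
    (fun t ht ht1 => ?_) (fun t ht => ?_)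
  · rw [norm_mul, norm_rpow_cast ht]
    have h1 : t ^ k * t ^ (-p) ≤ 1 := by
      rw [← Real.rpow_natCast, ← Real.rpow_add ht]
      exact Real.rpow_le_one ht.le ht1 (by linarith)
    have h2 : 1 ≤ t ^ (-(1 / 2) : ℝ) :=
      Real.one_le_rpow_of_pos_of_le_one_of_nonpos ht ht1 (by norm_num)
    calc _ ≤ K * t ^ k * t ^ (-p) := mul_le_mul_of_nonneg_right (hK t ht ht1) (by positivity)
      _ = K * (t ^ k * t ^ (-p)) := by ring
      _ ≤ K * 1 := mul_le_mul_of_nonneg_left h1 hK0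
      _ ≤ (K + C) * t ^ (-(1 / 2) : ℝ) := by nlinarith
  · have ht0 : 0 < t := by linarith
    rw [norm_mul, norm_rpow_cast ht0]
    have h1 : t ^ (-p) ≤ t ^ (-(3 / 2) : ℝ) := Real.rpow_le_rpow_of_exponent_le ht (by linarith)
    exact mul_le_mul ((hC t ht).trans (by linarith)) h1 (by positivity) (by linarith)

lemma le_norm_add_I_mul (t x : ℝ) : t ≤ ‖(t : ℂ) + I * x‖ := by
  have := (le_abs_self _).trans (Complex.abs_re_le_norm ((t : ℂ) + I * x))
  simpa using this

lemma norm_power_le {t : ℝ} (ht : 0 < t) (x : ℝ) {p : ℝ} (hp : 0 ≤ p) :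
    ‖((t : ℂ) + I * x) ^ (-p : ℂ)‖ ≤ t ^ (-p) := by
  rw [norm_cpow_neg]
  exact Real.rpow_le_rpow_of_nonpos ht (le_norm_add_I_mul t x) (by linarith)

lemma FlatWeight.aestronglyMeasurable {w : ℝ → ℂ} (hw : FlatWeight w) (p x : ℝ) :
    AEStronglyMeasurable (fun t : ℝ => w t * ((t : ℂ) + I * x) ^ (-p : ℂ))
      (volume.restrict (Set.Ioi 0)) :=
  (hw.continuousOn.mul (continuousOn_power fun _ ht =>
    mem_slitPlane_of_pos ht x)).aestronglyMeasurable measurableSet_Ioi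

lemma FlatWeight.integrableOn_power {w : ℝ → ℂ} (hw : FlatWeight w) {p : ℝ} (hp : 3 / 2 ≤ p)
    (x : ℝ) : IntegrableOn (fun t : ℝ => w t * ((t : ℂ) + I * x) ^ (-p : ℂ)) (Set.Ioi 0) := by
  refine Integrable.mono' (hw.integrableOn hp).norm (hw.aestronglyMeasurable p x)
    ((ae_restrict_iff' measurableSet_Ioi).2 (ae_of_all _ fun t ht => ?_))
  rw [norm_mul, norm_mul, norm_rpow_cast ht]
  exact mul_le_mul_of_nonneg_left (norm_power_le ht x (by linarith)) (norm_nonneg _)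

lemma FlatWeight.hasDerivAt {w : ℝ → ℂ} (hw : FlatWeight w) {p : ℝ} (hp : 3 / 2 ≤ p) (x : ℝ) :
    HasDerivAt (fun x : ℝ => powerTransform w p x) (-p * I * powerTransform w (p + 1) x) x := by
  have h := hasDerivAt_integral_of_dominated_loc_of_deriv_le (𝕜 := ℝ)
    (μ := volume.restrict (Set.Ioi (0 : ℝ)))
    (F := fun (y : ℝ) (t : ℝ) => w t * ((t : ℂ) + I * y) ^ (-p : ℂ))
    (F' := fun (y : ℝ) (t : ℝ) => w t * (-p * I * ((t : ℂ) + I * y) ^ (-((p + 1 : ℝ) : ℂ))))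
    (x₀ := x) (s := Set.univ) (bound := fun t => p * ‖w t * ((t ^ (-(p + 1)) : ℝ) : ℂ)‖)
    Filter.univ_mem (Eventually.of_forall fun y => hw.aestronglyMeasurable p y)
    (hw.integrableOn_power hp x) ?_ ?_ ((hw.integrableOn (by linarith)).norm.const_mul p) ?_
  · refine h.2.congr_deriv ?_
    rw [powerTransform, ← integral_const_mul]
    refine integral_congr_ae (ae_of_all _ fun t => ?_)
    simp only
    ring
  · refine ((hw.aestronglyMeasurable (p + 1) x).const_mul (-p * I : ℂ)).congr
      (ae_of_all _ fun t => ?_)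
    simp only
    ring
  · refine (ae_restrict_iff' measurableSet_Ioi).2 (ae_of_all _ fun t ht y _ => ?_)
    rw [norm_mul, norm_mul, norm_mul, norm_mul, norm_neg, norm_I, mul_one, Complex.norm_real,
      Real.norm_of_nonneg (by linarith), norm_rpow_cast ht, mul_left_comm]
    refine mul_le_mul_of_nonneg_left ?_ (by linarith)
    exact mul_le_mul_of_nonneg_left (norm_power_le ht y (by linarith)) (norm_nonneg _)
  · refine (ae_restrict_iff' measurableSet_Ioi).2 (ae_of_all _ fun t ht y _ => ?_)
    exact ((hasDerivAt_power p t (mem_slitPlane_of_pos ht y)).comp_ofReal).const_mul (w t)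

/-- Differentiation raises p by one and stays within the same class of integrals. Infinite flatness
of the weight at 0 dominates t^(-p) for every p. -/
lemma FlatWeight.contDiff {w : ℝ → ℂ} (hw : FlatWeight w) {p : ℝ} (hp : 3 / 2 ≤ p) :
    ContDiff ℝ ((⊤ : ℕ∞) : WithTop ℕ∞) (fun x : ℝ => powerTransform w p x) := by
  rw [contDiff_infty]
  intro n
  induction n generalizing p with
  | zero =>
    have h : Differentiable ℝ (fun x : ℝ => powerTransform w p x) :=
      fun x => (hw.hasDerivAt hp x).differentiableAt
    exact contDiff_zero.2 h.continuous
  | succ n ih =>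
    have hd : deriv (fun x : ℝ => powerTransform w p x)
        = fun x : ℝ => -p * I * powerTransform w (p + 1) x :=
      funext fun x => (hw.hasDerivAt hp x).deriv
    push_cast
    refine contDiff_succ_iff_deriv.2
      ⟨fun x => (hw.hasDerivAt hp x).differentiableAt, fun h => absurd h (by simp), ?_⟩
    rw [hd]
    exact contDiff_const.mul (ih (by linarith))

lemma flatWeight_theta (i : Fin 3) (hi : i ≠ 1) : FlatWeight fun t => theta i (I * t) := by
  obtain ⟨C, hC0, hC⟩ := exists_norm_theta_le_of_le_im i
  have h0 : (0 : ℚ) ∈ domain i := by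
    fin_cases i
    · exact (mem_domain_zero 0).2 (by simp)
    · exact absurd rfl hi
    · exact (mem_domain_two 0).2 (by simp)
  refine ⟨continuousOn_theta_I i, ⟨C, fun t ht => ?_⟩, fun k => ?_⟩
  · simpa using hC (I * t) 1 one_pos le_rfl (by simpa using ht)
  · obtain ⟨K, _, hK⟩ := exists_theta_decay i 0 h0 k
    exact ⟨K, fun t ht ht1 => by simpa using hK t ht ht1⟩

theorem contDiff_g (i : Fin 3) (hi : i ≠ 1) :
    ContDiff ℝ ((⊤ : ℕ∞) : WithTop ℕ∞) (fun x => g x i) := by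
  simp only [g_eq_powerTransform]
  exact contDiff_const.mul ((flatWeight_theta i hi).contDiff le_rfl)

/-! ### The pole of the second period integral -/

lemma norm_theta_zero_sub_one_le {y : ℝ} (hy : 1 ≤ y) :
    ‖theta 0 (I * y) - 1‖ ≤ 4 * Real.exp (-y) := by
  have hy0 : 0 < y := by linarith
  have him : 0 < (I * (y : ℂ)).im := by simpa using hy0
  set q := qpow 1 (I * y) with hq
  have hqn : ‖q‖ = Real.exp (-(2 * Real.pi * y)) := by
    rw [hq, qpow, Complex.norm_exp]
    congr 1
    simp
  have hq1 : ‖q‖ ≤ Real.exp (-y) := by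
    rw [hqn, Real.exp_le_exp]
    nlinarith [Real.pi_gt_three]
  have hq2 : ‖q‖ ≤ 1 / 2 := by
    refine hq1.trans ?_
    have h1 : Real.exp (-y) ≤ Real.exp (-1) := Real.exp_le_exp.2 (by linarith)
    have h2 : Real.exp (-1) ≤ 1 / 2 := by
      rw [Real.exp_neg, one_div]
      refine inv_anti₀ two_pos ?_
      have := Real.add_one_le_exp 1
      linarith
    linarith
  have hq3 : ‖q‖ < 1 := by linarith
  have hs := summable_sq_pow_mul_pow (t := 1) (by simp) hq3.le (by simpa using hq3)
  rw [theta_zero_eq_fineSum him, fineSum_neg_one (fineHyp_disc hq3 (by simp)) (by simp) hq3.le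
    (by simpa using hq3), hs.tsum_eq_zero_add]
  have hg := (summable_geometric_of_lt_one (norm_nonneg q) hq3).mul_left ‖q‖
  have h1 : ‖∑' k : ℕ, (-1 : ℂ) ^ (k + 1) * 1 ^ (2 * (k + 1)) * q ^ ((k + 1) ^ 2)‖
      ≤ ∑' k : ℕ, ‖q‖ * ‖q‖ ^ k := by
    refine tsum_of_norm_bounded hg.hasSum fun k => ?_
    have := sq_pow_mul_pow_norm_le (t := 1) (by simp) hq3.le (k + 1)
    rwa [one_mul, pow_succ' ‖q‖] at this
  rw [tsum_mul_left, tsum_geometric_of_lt_one (norm_nonneg q) hq3] at h1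
  have h2 : ‖q‖ * (1 - ‖q‖)⁻¹ ≤ ‖q‖ * 2 := by
    refine mul_le_mul_of_nonneg_left ?_ (norm_nonneg q)
    rw [inv_le_comm₀ (by linarith) two_pos]
    linarith
  calc _ = ‖2 * ∑' k : ℕ, (-1 : ℂ) ^ (k + 1) * 1 ^ (2 * (k + 1)) * q ^ ((k + 1) ^ 2)‖ := by
        congr 1
        simp only [pow_zero, mul_zero, one_mul]
        norm_num
        ring
    _ ≤ _ := by
        rw [norm_mul, Complex.norm_ofNat]
        linarith

/-- What remains of `θ₂` on the imaginary axis after subtracting its singularity at `0`. -/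
def thetaOneRemainder (t : ℝ) : ℂ := ((t ^ (-(1 / 2) : ℝ) : ℝ) : ℂ) * (theta 0 (I * (t⁻¹ : ℝ)) - 1)

lemma halfRoot_I_mul {y : ℝ} (hy : 0 < y) : halfRoot (I * y) = ((y ^ (1 / 2 : ℝ) : ℝ) : ℂ) := by
  have him : 0 < (I * (y : ℂ)).im := by simpa using hy
  refine eq_of_sq_eq_of_re_pos ?_ (halfRoot_re_pos him) ?_
  · rw [halfRoot_sq him, ← Complex.ofReal_pow, ← Real.rpow_natCast, ← Real.rpow_mul hy.le]
    norm_num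
    linear_combination (-(y : ℂ)) * I_sq
  · rw [Complex.ofReal_re]
    positivity

/-- Inversion relates the second theta near 0 to the first near i∞, which is 1 plus an exponentially
small term; the 1 produces the singular part t^(-1/2). -/
lemma theta_one_I_mul {t : ℝ} (ht : 0 < t) : theta 1 (I * t)
    = ((1 / Real.sqrt 2 : ℝ) : ℂ) * (((t ^ (-(1 / 2) : ℝ) : ℝ) : ℂ) + thetaOneRemainder t) := by
  have ht0 : (t : ℂ) ≠ 0 := by exact_mod_cast ht.ne'
  have him : 0 < (I * ((t⁻¹ : ℝ) : ℂ)).im := by simpa using ht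
  have h1 : I * (t : ℂ) = -1 / (I * ((t⁻¹ : ℝ) : ℂ)) := by
    push_cast
    field_simp
    linear_combination I_sq
  rw [h1, theta_one_neg_one_div him, halfRoot_I_mul (inv_pos.2 ht), Real.inv_rpow ht.le,
    ← Real.rpow_neg ht.le, thetaOneRemainder]
  push_cast
  ring

lemma flatWeight_thetaOneRemainder : FlatWeight thetaOneRemainder := by
  refine ⟨(continuousOn_rpow_cast _).mul (ContinuousOn.sub ?_ continuousOn_const), ?_, fun k => ?_⟩
  · exact (continuousOn_theta_I 0).comp (f := fun t : ℝ => t⁻¹)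
      (continuousOn_inv₀.mono fun t ht => ne_of_gt ht) fun _ ht =>
        Set.mem_Ioi.2 (inv_pos.2 ht)
  · obtain ⟨C, hC0, hC⟩ := exists_norm_theta_le_of_le_im 0
    refine ⟨C + 1, fun t ht => ?_⟩
    have ht0 : 0 < t := by linarith
    have h1 := hC (I * ((t⁻¹ : ℝ) : ℂ)) t⁻¹ (inv_pos.2 ht0) (inv_le_one_of_one_le₀ ht)
      (le_of_eq (by simp))
    rw [Real.inv_rpow ht0.le, Real.rpow_neg ht0.le, inv_inv] at h1
    have h2 := norm_sub_le (theta 0 (I * ((t⁻¹ : ℝ) : ℂ))) 1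
    rw [norm_one] at h2
    have h3 : t ^ (-(1 / 2) : ℝ) * t ^ (1 / 2 : ℝ) = 1 := by
      rw [← Real.rpow_add ht0]
      norm_num
    have h4 : t ^ (-(1 / 2) : ℝ) ≤ 1 := Real.rpow_le_one_of_one_le_of_nonpos ht (by norm_num)
    rw [thetaOneRemainder, norm_mul, norm_rpow_cast ht0]
    calc _ ≤ t ^ (-(1 / 2) : ℝ) * (C * t ^ (1 / 2 : ℝ) + 1) :=
          mul_le_mul_of_nonneg_left (by linarith) (by positivity)
      _ = C * (t ^ (-(1 / 2) : ℝ) * t ^ (1 / 2 : ℝ)) + t ^ (-(1 / 2) : ℝ) := by ring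
      _ ≤ C + 1 := by rw [h3]; linarith
  · refine ⟨4 * (k + 1).factorial, fun t ht ht1 => ?_⟩
    have h1 := norm_theta_zero_sub_one_le ((one_le_inv₀ ht).2 ht1)
    have h2 := Real.pow_div_factorial_le_exp t⁻¹ (inv_pos.2 ht).le (k + 1)
    have h3 : Real.exp (-t⁻¹) ≤ (k + 1).factorial * t ^ (k + 1) := by
      rw [Real.exp_neg]
      refine (inv_anti₀ (by positivity) h2).trans (le_of_eq ?_)
      rw [inv_div, inv_pow, div_inv_eq_mul]
    have h4 : t ^ (-(1 / 2) : ℝ) * t ^ (k + 1) ≤ t ^ k := by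
      have h5 : t ^ (-(1 / 2) : ℝ) ≤ t⁻¹ := by
        rw [← Real.rpow_neg_one]
        exact Real.rpow_le_rpow_of_exponent_ge ht ht1 (by norm_num)
      calc _ ≤ t⁻¹ * t ^ (k + 1) := mul_le_mul_of_nonneg_right h5 (by positivity)
        _ = t ^ k := by rw [pow_succ', inv_mul_cancel_left₀ ht.ne']
    rw [thetaOneRemainder, norm_mul, norm_rpow_cast ht]
    calc _ ≤ t ^ (-(1 / 2) : ℝ) * (4 * ((k + 1).factorial * t ^ (k + 1))) :=
          mul_le_mul_of_nonneg_left (by linarith) (by positivity)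
      _ = 4 * (k + 1).factorial * (t ^ (-(1 / 2) : ℝ) * t ^ (k + 1)) := by ring
      _ ≤ _ := mul_le_mul_of_nonneg_left h4 (by positivity)

/-- The primitive is (2/(ix)) (t/(t + ix))^(1/2). Its limits 0 and 2/(ix) at the ends of the
half-line produce the pole of the second period integral. -/
lemma hasDerivAt_rpow_mul_power {x : ℝ} (hx : x ≠ 0) {t : ℝ} (ht : 0 < t) :
    HasDerivAt (fun t : ℝ => 2 / (I * x) *
        (((t ^ (1 / 2 : ℝ) : ℝ) : ℂ) * ((t : ℂ) + I * x) ^ (-(1 / 2) : ℂ)))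
      (((t ^ (-(1 / 2) : ℝ) : ℝ) : ℂ) * ((t : ℂ) + I * x) ^ (-((3 / 2 : ℝ) : ℂ))) t := by
  have hxC : (x : ℂ) ≠ 0 := by exact_mod_cast hx
  have hm := mem_slitPlane_of_pos ht x
  have h1 := (Real.hasDerivAt_rpow_const (x := t) (p := 1 / 2) (Or.inl ht.ne')).ofReal_comp
  have h2 : HasDerivAt (fun y : ℂ => (y + I * x) ^ (-(1 / 2) : ℂ))
      (-(1 / 2) * ((t : ℂ) + I * x) ^ (-(1 / 2) - 1 : ℂ) * 1) (t : ℂ) :=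
    ((hasDerivAt_id (t : ℂ)).add_const (I * (x : ℂ))).cpow_const hm
  refine ((h1.mul h2.comp_ofReal).const_mul (2 / (I * (x : ℂ)))).congr_deriv ?_
  have e1 : (1 / 2 - 1 : ℝ) = -(1 / 2) := by norm_num
  have e2 : (-(1 / 2) - 1 : ℂ) = -((3 / 2 : ℝ) : ℂ) := by push_cast; ring
  have e3 : ((t : ℂ) + I * x) ^ (-(1 / 2) : ℂ)
      = ((t : ℂ) + I * x) ^ (-((3 / 2 : ℝ) : ℂ)) * ((t : ℂ) + I * x) := by
    nth_rewrite 3 [← Complex.cpow_one ((t : ℂ) + I * x)]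
    rw [← Complex.cpow_add _ _ (slitPlane_ne_zero hm)]
    congr 1
    push_cast
    ring
  have e4 : t ^ (1 / 2 : ℝ) = t ^ (-(1 / 2) : ℝ) * t := by
    rw [← Real.rpow_add_one ht.ne']
    norm_num
  rw [e1, e2, e3, e4]
  push_cast
  field_simp
  ring

lemma tendsto_rpow_mul_power (x : ℝ) :
    Tendsto (fun t : ℝ => ((t ^ (1 / 2 : ℝ) : ℝ) : ℂ) * ((t : ℂ) + I * x) ^ (-(1 / 2) : ℂ)) atTop
      (𝓝 1) := by
  have h1 : Tendsto (fun t : ℝ => 1 + I * x * ((t⁻¹ : ℝ) : ℂ)) atTop (𝓝 1) := by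
    have := ((continuous_ofReal.tendsto 0).comp tendsto_inv_atTop_zero).const_mul (I * (x : ℂ))
    simpa using this.const_add 1
  have h2 : Tendsto (fun t : ℝ => (1 + I * x * ((t⁻¹ : ℝ) : ℂ)) ^ (-(1 / 2) : ℂ)) atTop (𝓝 1) := by
    have h3 : ContinuousAt (fun w : ℂ => w ^ (-(1 / 2) : ℂ)) 1 :=
      ContinuousAt.cpow continuousAt_id continuousAt_const one_mem_slitPlane
    have h4 := h3.tendsto.comp h1
    rw [Complex.one_cpow] at h4
    exact h4
  refine h2.congr' ?_
  filter_upwards [eventually_gt_atTop 0] with t ht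
  have htC : (t : ℂ) ≠ 0 := by exact_mod_cast ht.ne'
  have h4 : (t : ℂ) + I * x = t * (1 + I * x * ((t⁻¹ : ℝ) : ℂ)) := by
    push_cast
    field_simp
  have h5 := slitPlane_ne_zero (mem_slitPlane_of_pos ht x)
  have h6 : 1 + I * x * ((t⁻¹ : ℝ) : ℂ) ≠ 0 := by
    intro h
    rw [h4, h, mul_zero] at h5
    exact h5 rfl
  rw [Complex.cpow_def_of_ne_zero h5, h4, Complex.log_ofReal_mul ht h6, add_mul, Complex.exp_add,
    Complex.cpow_def_of_ne_zero h6, Real.rpow_def_of_pos ht, ← mul_assoc]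
  push_cast
  rw [← Complex.exp_add]
  simp

lemma integral_rpow_mul_power {x : ℝ} (hx : x ≠ 0) :
    IntegrableOn (fun t : ℝ => ((t ^ (-(1 / 2) : ℝ) : ℝ) : ℂ) *
        ((t : ℂ) + I * x) ^ (-((3 / 2 : ℝ) : ℂ))) (Set.Ioi 0) ∧
      ∫ t in Set.Ioi (0 : ℝ), ((t ^ (-(1 / 2) : ℝ) : ℝ) : ℂ) *
        ((t : ℂ) + I * x) ^ (-((3 / 2 : ℝ) : ℂ)) = 2 / (I * x) := by
  have hx' : 0 < |x| := abs_pos.2 hx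
  have hP : 0 < |x| ^ (-(3 / 2) : ℝ) := Real.rpow_pos_of_pos hx' _
  have hInt : IntegrableOn (fun t : ℝ => ((t ^ (-(1 / 2) : ℝ) : ℝ) : ℂ) *
        ((t : ℂ) + I * x) ^ (-((3 / 2 : ℝ) : ℂ))) (Set.Ioi 0) := by
    refine integrableOn_Ioi_of_bounds (C := |x| ^ (-(3 / 2) : ℝ) + 1)
      ((continuousOn_rpow_cast _).mul (continuousOn_power fun t ht => mem_slitPlane_of_pos ht x))
      (fun t ht ht1 => ?_) (fun t ht => ?_)
    · rw [norm_mul, norm_rpow_cast ht, norm_cpow_neg, mul_comm]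
      refine mul_le_mul_of_nonneg_right ?_ (by positivity)
      have h1 := abs_re_le_norm_add_I_mul t x
      rw [Complex.ofReal_re] at h1
      have := Real.rpow_le_rpow_of_nonpos hx' h1 (by norm_num : (-(3 / 2) : ℝ) ≤ 0)
      linarith
    · have ht0 : 0 < t := by linarith
      rw [norm_mul, norm_rpow_cast ht0]
      refine mul_le_mul ?_ (norm_power_le ht0 x (by norm_num)) (norm_nonneg _) (by positivity)
      have := Real.rpow_le_one_of_one_le_of_nonpos ht (by norm_num : (-(1 / 2) : ℝ) ≤ 0)
      linarith
  refine ⟨hInt, ?_⟩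
  rw [integral_Ioi_zero_of_tendsto (l₀ := 0) (l₁ := 2 / (I * x) * 1)
    (fun t ht => hasDerivAt_rpow_mul_power hx ht) hInt ?_
    ((tendsto_rpow_mul_power x).const_mul _), mul_one, sub_zero]
  have hc : ContinuousAt (fun t : ℝ => 2 / (I * x) *
        (((t ^ (1 / 2 : ℝ) : ℝ) : ℂ) * ((t : ℂ) + I * x) ^ (-(1 / 2) : ℂ))) 0 := by
    refine continuousAt_const.mul (ContinuousAt.mul ?_ ?_)
    · exact continuous_ofReal.continuousAt.comp
        (ContinuousAt.rpow_const continuousAt_id (Or.inr (by norm_num)))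
    · exact ContinuousAt.cpow (by fun_prop) (by fun_prop)
        (mem_slitPlane_of_re_ne_zero 0 (by simpa using hx))
  have := hc.tendsto.mono_left (nhdsWithin_le_nhds (s := Set.Ioi 0))
  simpa [Real.zero_rpow (by norm_num : (1 / 2 : ℝ) ≠ 0)] using this

theorem g_one_eq : ∃ r : ℝ → ℂ, ContDiff ℝ ((⊤ : ℕ∞) : WithTop ℕ∞) r ∧
    ∀ x : ℝ, x ≠ 0 → g x 1 = -I / (Real.pi * x) + r x := by
  refine ⟨fun x => ((1 / (Real.pi * 2) : ℝ) : ℂ) * powerTransform thetaOneRemainder (3 / 2) x,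
    contDiff_const.mul (flatWeight_thetaOneRemainder.contDiff le_rfl), fun x hx => ?_⟩
  obtain ⟨h1, h2⟩ := integral_rpow_mul_power hx
  have h3 := flatWeight_thetaOneRemainder.integrableOn_power (p := 3 / 2) le_rfl x
  have h4 : powerTransform (fun t => theta 1 (I * t)) (3 / 2) x
      = ((1 / Real.sqrt 2 : ℝ) : ℂ) * (2 / (I * x) + powerTransform thetaOneRemainder (3 / 2) x) :=
        by
    rw [powerTransform, powerTransform, ← h2, ← integral_add h1 h3, ← integral_const_mul]
    refine setIntegral_congr_fun measurableSet_Ioi fun t ht => ?_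
    rw [theta_one_I_mul ht]
    ring
  have hxC : (x : ℂ) ≠ 0 := by exact_mod_cast hx
  have hpi : (Real.pi : ℂ) ≠ 0 := by exact_mod_cast Real.pi_ne_zero
  have hconst : ((1 / (Real.pi * Real.sqrt 2) : ℝ) : ℂ) * ((1 / Real.sqrt 2 : ℝ) : ℂ)
      = ((1 / (Real.pi * 2) : ℝ) : ℂ) := by
    rw [← Complex.ofReal_mul, div_mul_div_comm, one_mul, mul_assoc,
      Real.mul_self_sqrt (by norm_num)]
  rw [g_eq_powerTransform, h4, ← mul_assoc, hconst, mul_add]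
  congr 1
  push_cast
  field_simp
  linear_combination I_sq

/-! ### The factor of automorphy -/

/-- The function `(i u) ^ (3 / 2)`. -/
def imagPow (u : ℝ) : ℂ := (I * (u : ℂ)) ^ ((3 / 2 : ℝ) : ℂ)

/-- The phase of `imagPow` on the positive axis. -/
def imagPhase : ℂ := Complex.exp (3 * Real.pi / 4 * I)

lemma norm_imagPhase : ‖imagPhase‖ = 1 := by
  rw [imagPhase, show (3 * (Real.pi : ℂ) / 4 * I) =
    ((3 * Real.pi / 4 : ℝ) : ℂ) * I by push_cast; rfl]
  exact Complex.norm_exp_ofReal_mul_I _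

lemma imagPhase_ne_zero : imagPhase ≠ 0 := Complex.exp_ne_zero _

lemma imagPow_of_pos {u : ℝ} (hu : 0 < u) :
    imagPow u = ((|u| ^ (3 / 2 : ℝ) : ℝ) : ℂ) * imagPhase := by
  have h : I * (u : ℂ) ≠ 0 := mul_ne_zero I_ne_zero (by exact_mod_cast hu.ne')
  rw [imagPow, Complex.cpow_def_of_ne_zero h, mul_comm I, Complex.log_ofReal_mul hu I_ne_zero,
    Complex.log_I, abs_of_pos hu, Real.rpow_def_of_pos hu, imagPhase]
  push_cast
  rw [← Complex.exp_add]
  congr 1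
  ring

lemma imagPow_of_neg {u : ℝ} (hu : u < 0) :
    imagPow u = ((|u| ^ (3 / 2 : ℝ) : ℝ) : ℂ) * imagPhase⁻¹ := by
  have h : I * (u : ℂ) ≠ 0 := mul_ne_zero I_ne_zero (by exact_mod_cast hu.ne)
  rw [imagPow, Complex.cpow_def_of_ne_zero h,
    show I * (u : ℂ) = ((-u : ℝ) : ℂ) * -I by push_cast; ring,
    Complex.log_ofReal_mul (by linarith) (neg_ne_zero.2 I_ne_zero), Complex.log_neg_I,
    abs_of_neg hu, Real.rpow_def_of_pos (by linarith), imagPhase, ← Complex.exp_neg]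
  push_cast
  rw [← Complex.exp_add]
  congr 1
  ring

lemma imagPow_ne_zero {u : ℝ} (hu : u ≠ 0) : imagPow u ≠ 0 := by
  have h : I * (u : ℂ) ≠ 0 := mul_ne_zero I_ne_zero (by exact_mod_cast hu)
  rw [imagPow, Complex.cpow_def_of_ne_zero h]
  exact Complex.exp_ne_zero _

lemma abs_div_rpow_mul {p q : ℝ} (hq : q ≠ 0) :
    (((|p / q| ^ (3 / 2 : ℝ) : ℝ)) : ℂ) * ((|q| ^ (3 / 2 : ℝ) : ℝ) : ℂ)
      = ((|p| ^ (3 / 2 : ℝ) : ℝ) : ℂ) := by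
  rw [← Complex.ofReal_mul, ← Real.mul_rpow (abs_nonneg _) (abs_nonneg _), ← abs_mul,
    div_mul_cancel₀ _ hq]

/-- Absolute values multiply and `imagPow` has phase ω or ω⁻¹ according to sign, where ω =
`imagPhase`. In the excluded case the two sides have phases ω⁻² and ω², which differ by the sign ω⁴
= -1. -/
lemma imagPow_div_mul {p q : ℝ} (hp : p ≠ 0) (hq : q ≠ 0) (h : ¬(0 < p ∧ q < 0)) :
    imagPow (p / q) * imagPow q = imagPhase * imagPow p := by
  have hω := imagPhase_ne_zero
  have key := abs_div_rpow_mul (p := p) hq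
  rcases lt_or_gt_of_ne hp with hp' | hp' <;> rcases lt_or_gt_of_ne hq with hq' | hq'
  · rw [imagPow_of_pos (div_pos_of_neg_of_neg hp' hq'), imagPow_of_neg hq', imagPow_of_neg hp',
      ← key]
    field_simp
  · rw [imagPow_of_neg (div_neg_of_neg_of_pos hp' hq'), imagPow_of_pos hq', imagPow_of_neg hp',
      ← key]
    field_simp
  · exact absurd ⟨hp', hq'⟩ h
  · rw [imagPow_of_pos (div_pos hp' hq'), imagPow_of_pos hq', imagPow_of_pos hp', ← key]
    ring

lemma imagPow_neg_div_mul {p q : ℝ} (hp : p ≠ 0) (hq : q ≠ 0) (h : ¬(p < 0 ∧ 0 < q)) :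
    imagPow (-(p / q)) * imagPow q = imagPhase⁻¹ * imagPow p := by
  have hω := imagPhase_ne_zero
  have key := abs_div_rpow_mul (p := p) hq
  rcases lt_or_gt_of_ne hp with hp' | hp' <;> rcases lt_or_gt_of_ne hq with hq' | hq'
  · have h1 : -(p / q) < 0 := neg_lt_zero.2 (div_pos_of_neg_of_neg hp' hq')
    rw [imagPow_of_neg h1, abs_neg, imagPow_of_neg hq', imagPow_of_neg hp', ← key]
    ring
  · exact absurd ⟨hp', hq'⟩ h
  · have h1 : 0 < -(p / q) := neg_pos.2 (div_neg_of_pos_of_neg hp' hq')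
    rw [imagPow_of_pos h1, abs_neg, imagPow_of_neg hq', imagPow_of_pos hp', ← key]
    field_simp
  · have h1 : -(p / q) < 0 := neg_lt_zero.2 (div_pos hp' hq')
    rw [imagPow_of_neg h1, abs_neg, imagPow_of_pos hq', imagPow_of_pos hp', ← key]
    field_simp

lemma imagPow_neg_inv_mul {q : ℝ} (hq : q ≠ 0) : imagPow (-1 / q) * imagPow q = 1 := by
  have hω := imagPhase_ne_zero
  have key := abs_div_rpow_mul (p := -1) hq
  have h1 : ((|(-1 : ℝ)| ^ (3 / 2 : ℝ) : ℝ) : ℂ) = 1 := by simp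
  rw [h1] at key
  rcases lt_or_gt_of_ne hq with hq' | hq'
  · rw [imagPow_of_pos (div_pos_of_neg_of_neg (by norm_num) hq'), imagPow_of_neg hq',
      mul_mul_mul_comm, key, mul_inv_cancel₀ hω, one_mul]
  · rw [imagPow_of_neg (div_neg_of_neg_of_pos (by norm_num) hq'), imagPow_of_pos hq',
      mul_mul_mul_comm, key, inv_mul_cancel₀ hω, one_mul]

lemma autFactor_of_eq_zero {γ : SL(2, ℤ)} (h : γ 1 0 = 0) (k : ℝ) (x : ℚ) :
    autFactor k γ x = 1 := if_pos h

lemma autFactor_of_ne_zero {γ : SL(2, ℤ)} (h : γ 1 0 ≠ 0) (x : ℚ) :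
    autFactor (3 / 2) γ x = imagPow ((γ 1 0).sign * (γ 1 0 * (x : ℝ) + γ 1 1)) := by
  rw [autFactor, if_neg h, imagPow]
  push_cast
  congr 1
  ring

lemma S_mul_apply (γ : SL(2, ℤ)) :
    (ModularGroup.S * γ) 0 0 = -γ 1 0 ∧ (ModularGroup.S * γ) 0 1 = -γ 1 1 ∧
      (ModularGroup.S * γ) 1 0 = γ 0 0 ∧ (ModularGroup.S * γ) 1 1 = γ 0 1 := by
  simp [Matrix.SpecialLinearGroup.coe_mul, ModularGroup.coe_S, Matrix.mul_apply, Fin.sum_univ_two]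

lemma T_mul_apply (γ : SL(2, ℤ)) :
    (ModularGroup.T * γ) 0 0 = γ 0 0 + γ 1 0 ∧ (ModularGroup.T * γ) 0 1 = γ 0 1 + γ 1 1 ∧
      (ModularGroup.T * γ) 1 0 = γ 1 0 ∧ (ModularGroup.T * γ) 1 1 = γ 1 1 := by
  simp [Matrix.SpecialLinearGroup.coe_mul, ModularGroup.coe_T, Matrix.mul_apply, Fin.sum_univ_two]

lemma det_eq (γ : SL(2, ℤ)) : γ 0 0 * γ 1 1 - γ 0 1 * γ 1 0 = 1 := by
  rw [← Matrix.det_fin_two]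
  exact γ.det_coe

/-- The factor of automorphy of a product, up to a constant phase. -/
lemma exists_autFactor_S_mul (γ : SL(2, ℤ)) : ∃ κ : ℂ, ‖κ‖ = 1 ∧ (γ 1 0 = 0 → κ = 1) ∧
    ∀ x : ℚ, (γ 1 0 : ℚ) * x + γ 1 1 ≠ 0 → (γ 0 0 : ℚ) * x + γ 0 1 ≠ 0 →
      autFactor (3 / 2) (ModularGroup.S * γ) x
        = κ * (imagPow (mobius γ x : ℚ) * autFactor (3 / 2) γ x) := by
  obtain ⟨-, -, hS10, hS11⟩ := S_mul_apply γ
  have hdet := det_eq γ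
  have hmob : ∀ x : ℚ, ((mobius γ x : ℚ) : ℝ)
      = ((γ 0 0 : ℝ) * x + γ 0 1) / ((γ 1 0 : ℝ) * x + γ 1 1) := fun x => by
    rw [mobius]
    push_cast
    rfl
  generalize hA : γ 0 0 = a at *
  generalize hB : γ 0 1 = b at *
  generalize hC : γ 1 0 = c at *
  generalize hD : γ 1 1 = d at *
  have hAS : ∀ x : ℚ, a ≠ 0 → autFactor (3 / 2) (ModularGroup.S * γ) x
      = imagPow (a.sign * (a * (x : ℝ) + b)) := by
    intro x ha
    rw [autFactor_of_ne_zero (by rwa [hS10]), hS10, hS11]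
  have hAγ : ∀ x : ℚ, c ≠ 0 → autFactor (3 / 2) γ x
      = imagPow (c.sign * (c * (x : ℝ) + d)) := by
    intro x hc
    rw [autFactor_of_ne_zero (by rwa [hC]), hC, hD]
  by_cases hc : c = 0
  · refine ⟨1, norm_one, fun _ => rfl, fun x _ _ => ?_⟩
    have had : a * d = 1 := by simpa [hc] using hdet
    have ha : a ≠ 0 := by
      rintro rfl
      simp at had
    rw [hAS x ha, autFactor_of_eq_zero (hC.trans hc), hmob, one_mul, mul_one]
    congr 1
    rcases Int.mul_eq_one_iff_eq_one_or_neg_one.1 had with ⟨rfl, rfl⟩ | ⟨rfl, rfl⟩ <;> simp [hc]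
    ring
  by_cases ha : a = 0
  · refine ⟨1, norm_one, fun h => absurd h hc, fun x hx _ => ?_⟩
    have hbc : b * c = -1 := by
      rw [ha] at hdet
      linarith
    rw [autFactor_of_eq_zero (hS10.trans ha), hAγ x hc, hmob, one_mul]
    have hx' : (c : ℝ) * x + d ≠ 0 := by exact_mod_cast hx
    have hs : ((c.sign : ℤ) : ℝ) ≠ 0 := by exact_mod_cast (by simpa using hc : c.sign ≠ 0)
    rw [← imagPow_neg_inv_mul (mul_ne_zero hs hx')]
    congr 2
    rcases Int.mul_eq_neg_one_iff_eq_one_or_neg_one.1 hbc with ⟨rfl, rfl⟩ | ⟨rfl, rfl⟩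
    · simp [ha]
      rw [show -(x : ℝ) + d = -(-d + x) by ring, inv_neg, neg_div, one_div]
    · simp [ha]
  have hreal : ∀ x : ℚ, (c : ℚ) * x + d ≠ 0 → (a : ℚ) * x + b ≠ 0 →
      (c : ℝ) * x + d ≠ 0 ∧ (a : ℝ) * x + b ≠ 0 := fun x h1 h2 =>
    ⟨by exact_mod_cast h1, by exact_mod_cast h2⟩
  have hdetR : (a : ℝ) * d - b * c = 1 := by exact_mod_cast hdet
  have hω := imagPhase_ne_zero
  -- If a and c share the sign σ, the excluded pattern σ(ax + b) > 0 > σ(cx + d) would make c(ax +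
  -- b) - a(cx + d) positive, but it is bc - ad = -1. The case of opposite signs is analogous.
  have same : ∀ {σ : ℝ} {x : ℚ}, σ * σ = 1 → 0 < σ * a → 0 < σ * c → (c : ℝ) * x + d ≠ 0 →
      (a : ℝ) * x + b ≠ 0 → imagPow (σ * (a * x + b))
        = imagPhase⁻¹ * (imagPow ((a * x + b) / (c * x + d)) * imagPow (σ * (c * x + d))) := by
    intro σ x hσ hσa hσc h1 h2
    have hσ0 : σ ≠ 0 := by
      rintro rfl
      simp at hσ
    rw [← mul_div_mul_left (a * (x : ℝ) + b) (c * (x : ℝ) + d) hσ0,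
      imagPow_div_mul (mul_ne_zero hσ0 h2) (mul_ne_zero hσ0 h1), inv_mul_cancel_left₀ hω]
    rintro ⟨h3, h4⟩
    have e1 := mul_pos hσc h3
    have e2 := mul_pos hσa (neg_pos.2 h4)
    have e3 : σ * c * (σ * (a * x + b)) + σ * a * -(σ * (c * x + d)) = -1 := by
      linear_combination -hdetR + (b * c - a * d) * hσ
    linarith
  have opp : ∀ {σ : ℝ} {x : ℚ}, σ * σ = 1 → 0 < σ * a → 0 < -σ * c → (c : ℝ) * x + d ≠ 0 →
      (a : ℝ) * x + b ≠ 0 → imagPow (σ * (a * x + b))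
        = imagPhase * (imagPow ((a * x + b) / (c * x + d)) * imagPow (-σ * (c * x + d))) := by
    intro σ x hσ hσa hσc h1 h2
    have hσ0 : σ ≠ 0 := by
      rintro rfl
      simp at hσ
    have e0 : (a * (x : ℝ) + b) / (c * x + d) = -((σ * (a * x + b)) / (-σ * (c * x + d))) := by
      rw [neg_mul, div_neg, neg_neg, mul_div_mul_left _ _ hσ0]
    rw [e0, imagPow_neg_div_mul (mul_ne_zero hσ0 h2) (mul_ne_zero (neg_ne_zero.2 hσ0) h1),
      mul_inv_cancel_left₀ hω]
    rintro ⟨h3, h4⟩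
    have e1 := mul_pos hσc (neg_pos.2 h3)
    have e2 := mul_pos hσa h4
    have e3 : -σ * c * -(σ * (a * x + b)) + σ * a * (-σ * (c * x + d)) = -1 := by
      linear_combination -hdetR + (b * c - a * d) * hσ
    linarith
  have hpos : ∀ {n : ℤ}, 0 < n → ((n.sign : ℤ) : ℝ) = 1 := fun h => by
    rw [Int.sign_eq_one_of_pos h]
    simp
  have hneg : ∀ {n : ℤ}, n < 0 → ((n.sign : ℤ) : ℝ) = -1 := fun h => by
    rw [Int.sign_eq_neg_one_of_neg h]
    simp
  rcases lt_or_gt_of_ne ha with ha' | ha' <;> rcases lt_or_gt_of_ne hc with hc' | hc'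
  · refine ⟨imagPhase⁻¹, by rw [norm_inv, norm_imagPhase, inv_one], fun h => absurd h hc,
      fun x h1 h2 => ?_⟩
    obtain ⟨h3, h4⟩ := hreal x h1 h2
    rw [hAS x ha, hAγ x hc, hmob, hneg ha', hneg hc']
    refine same (by norm_num) ?_ ?_ h3 h4
    · have : (a : ℝ) < 0 := by exact_mod_cast ha'
      linarith
    · have : (c : ℝ) < 0 := by exact_mod_cast hc'
      linarith
  · refine ⟨imagPhase, norm_imagPhase, fun h => absurd h hc, fun x h1 h2 => ?_⟩
    obtain ⟨h3, h4⟩ := hreal x h1 h2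
    have h5 := opp (σ := -1) (x := x) (by norm_num) ?_ ?_ h3 h4
    · rw [hAS x ha, hAγ x hc, hmob, hneg ha', hpos hc', h5, neg_neg]
    · have : (a : ℝ) < 0 := by exact_mod_cast ha'
      linarith
    · have : (0 : ℝ) < c := by exact_mod_cast hc'
      linarith
  · refine ⟨imagPhase, norm_imagPhase, fun h => absurd h hc, fun x h1 h2 => ?_⟩
    obtain ⟨h3, h4⟩ := hreal x h1 h2
    rw [hAS x ha, hAγ x hc, hmob, hpos ha', hneg hc']
    refine opp (by norm_num) ?_ ?_ h3 h4
    · have : (0 : ℝ) < a := by exact_mod_cast ha'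
      linarith
    · have : (c : ℝ) < 0 := by exact_mod_cast hc'
      linarith
  · refine ⟨imagPhase⁻¹, by rw [norm_inv, norm_imagPhase, inv_one], fun h => absurd h hc,
      fun x h1 h2 => ?_⟩
    obtain ⟨h3, h4⟩ := hreal x h1 h2
    rw [hAS x ha, hAγ x hc, hmob, hpos ha', hpos hc']
    refine same (by norm_num) ?_ ?_ h3 h4
    · have : (0 : ℝ) < a := by exact_mod_cast ha'
      linarith
    · have : (0 : ℝ) < c := by exact_mod_cast hc'
      linarith

/-! ### Linear independence of the theta functions -/

lemma tendsto_theta_zero_I : Tendsto (fun t : ℝ => theta 0 (I * t)) atTop (𝓝 1) := by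
  rw [tendsto_iff_norm_sub_tendsto_zero]
  have h : Tendsto (fun y : ℝ => 4 * Real.exp (-y)) atTop (𝓝 0) := by
    simpa using (Real.tendsto_exp_neg_atTop_nhds_zero).const_mul 4
  refine squeeze_zero' (Eventually.of_forall fun _ => norm_nonneg _) ?_ h
  filter_upwards [eventually_ge_atTop 1] with y hy using norm_theta_zero_sub_one_le hy

lemma tendsto_rpow_mul_theta_inv (i : Fin 3) (hi : i ≠ 1) :
    Tendsto (fun t : ℝ => ((t ^ (-(1 / 2) : ℝ) : ℝ) : ℂ) * theta i (I * (t⁻¹ : ℝ))) atTop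
      (𝓝 0) := by
  obtain ⟨C, hC⟩ := (flatWeight_theta i hi).flat 0
  have h : Tendsto (fun t : ℝ => t ^ (-(1 / 2) : ℝ) * C) atTop (𝓝 0) := by
    simpa using (tendsto_rpow_neg_atTop (by norm_num : (0 : ℝ) < 1 / 2)).mul_const C
  refine squeeze_zero_norm' ?_ h
  filter_upwards [eventually_ge_atTop 1] with t ht
  have ht0 : 0 < t := by linarith
  rw [norm_mul, norm_rpow_cast ht0]
  refine mul_le_mul_of_nonneg_left ?_ (by positivity)
  simpa using hC t⁻¹ (inv_pos.2 ht0) (inv_le_one_of_one_le₀ ht)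

lemma theta_I_mul_eq {i j : Fin 3} {m : ℂ}
    (hθ : ∀ τ : ℂ, 0 < τ.im → theta i (-1 / τ) = halfRoot τ * (m * theta j τ)) {t : ℝ}
    (ht : 0 < t) : theta i (I * t)
      = m * (((t ^ (-(1 / 2) : ℝ) : ℝ) : ℂ) * theta j (I * (t⁻¹ : ℝ))) := by
  have ht0 : (t : ℂ) ≠ 0 := by exact_mod_cast ht.ne'
  have him : 0 < (I * ((t⁻¹ : ℝ) : ℂ)).im := by simpa using ht
  have h1 : I * (t : ℂ) = -1 / (I * ((t⁻¹ : ℝ) : ℂ)) := by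
    push_cast
    field_simp
    linear_combination I_sq
  rw [h1, hθ _ him, halfRoot_I_mul (inv_pos.2 ht), Real.inv_rpow ht.le, ← Real.rpow_neg ht.le]
  ring

lemma tendsto_theta_I {i j : Fin 3} {m : ℂ} (hj : j ≠ 1)
    (hθ : ∀ τ : ℂ, 0 < τ.im → theta i (-1 / τ) = halfRoot τ * (m * theta j τ)) :
    Tendsto (fun t : ℝ => theta i (I * t)) atTop (𝓝 0) := by
  have h := (tendsto_rpow_mul_theta_inv j hj).const_mul m
  rw [mul_zero] at h
  refine h.congr' ?_
  filter_upwards [eventually_gt_atTop 0] with t ht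
  rw [theta_I_mul_eq hθ ht]

lemma tendsto_theta_one_I : Tendsto (fun t : ℝ => theta 1 (I * t)) atTop (𝓝 0) :=
  tendsto_theta_I (j := 0) (m := 1 / Real.sqrt 2) (by decide) fun τ hτ => by
    rw [theta_one_neg_one_div hτ]
    ring

lemma tendsto_theta_two_I : Tendsto (fun t : ℝ => theta 2 (I * t)) atTop (𝓝 0) :=
  tendsto_theta_I (j := 2) (m := 1) (by decide) fun τ hτ => by
    rw [theta_two_neg_one_div hτ, one_mul]

lemma theta_ne_zero (i : Fin 3) {z : ℂ} (hz : 0 < z.im) : theta i z ≠ 0 := by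
  have h2 : 0 < (2 * z).im := by simpa using hz
  have h3 : 0 < (z / 2).im := by
    rw [show z / 2 = ((1 / 2 : ℝ) : ℂ) * z by push_cast; ring, Complex.im_ofReal_mul]
    linarith
  have h4 : 0 < (z / 2 + 1 / 2).im := by
    rw [Complex.add_im, show (1 / 2 : ℂ) = ((1 / 2 : ℝ) : ℂ) by push_cast; rfl, Complex.ofReal_im]
    linarith
  have hη : ∀ {w : ℂ}, 0 < w.im → ModularForm.eta w ≠ 0 := fun hw => ModularForm.eta_ne_zero hw
  fin_cases i
  · exact div_ne_zero (pow_ne_zero 2 (hη hz)) (hη h2)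
  · exact div_ne_zero (pow_ne_zero 2 (hη hz)) (hη h3)
  · exact div_ne_zero (pow_ne_zero 2 (hη hz)) (hη h4)

/-- At i∞ only the first theta has a non-zero limit, so its coefficient vanishes. Inversion carries
the second coefficient into that position, and the third theta alone has no zeros. -/
lemma eq_zero_of_theta_relation {v : Fin 3 → ℂ}
    (h : ∀ z : ℂ, 0 < z.im → ∑ j, v j * theta j z = 0) : v = 0 := by
  have key : ∀ {u : Fin 3 → ℂ}, (∀ z : ℂ, 0 < z.im → ∑ j, u j * theta j z = 0) → u 0 = 0 := by
    intro u hu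
    have h1 := ((tendsto_theta_zero_I.const_mul (u 0)).add (tendsto_theta_one_I.const_mul
      (u 1))).add
      (tendsto_theta_two_I.const_mul (u 2))
    have h2 := tendsto_nhds_unique (h1.congr' (f₂ := fun _ => (0 : ℂ)) (by
      filter_upwards [eventually_gt_atTop 0] with t ht
      rw [← hu (I * t) (by simpa using ht), Fin.sum_univ_three])) tendsto_const_nhds
    simpa using h2
  have h0 := key h
  have hs : ((Real.sqrt 2 : ℝ) : ℂ) ≠ 0 := by
    exact_mod_cast (Real.sqrt_pos.2 two_pos).ne'
  have h1 : v 1 = 0 := by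
    have h2 := key (u := ![1 / Real.sqrt 2 * v 1, Real.sqrt 2 * v 0, v 2]) fun z hz => by
      have h3 := h (-1 / z) (neg_one_div_im_pos hz)
      rw [Fin.sum_univ_three, theta_zero_neg_one_div hz, theta_one_neg_one_div hz,
        theta_two_neg_one_div hz] at h3
      have h4 : halfRoot z * (1 / Real.sqrt 2 * v 1 * theta 0 z + Real.sqrt 2 * v 0 * theta 1 z +
          v 2 * theta 2 z) = 0 := by
        rw [← h3]
        ring
      rw [Fin.sum_univ_three]
      exact (mul_eq_zero.1 h4).resolve_left (halfRoot_ne_zero z)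
    have h5 : 1 / ((Real.sqrt 2 : ℝ) : ℂ) * v 1 = 0 := h2
    exact (mul_eq_zero.1 h5).resolve_left (one_div_ne_zero hs)
  have h2 : v 2 = 0 := by
    have h3 := h I (by simp)
    rw [Fin.sum_univ_three, h0, h1, zero_mul, zero_mul, zero_add, zero_add] at h3
    exact (mul_eq_zero.1 h3).resolve_right (theta_ne_zero 2 (by simp))
  funext i
  fin_cases i
  · exact h0
  · exact h1
  · exact h2

/-! ### Multipliers -/

open UpperHalfPlane in
/-- The matrices by which the vectors of theta functions and of strange series transform
under `γ`. -/
structure IsMultiplier (γ : SL(2, ℤ)) (M : Matrix (Fin 3) (Fin 3) ℂ) : Prop where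
  isUnit_det : IsUnit M.det
  automorphy : ∃ (J : ℍ → ℂ) (ε : ℂ), Continuous J ∧ ‖ε‖ = 1 ∧
    (∀ τ : ℍ, J τ ^ 2 = ε * ((γ 1 0 : ℂ) * τ + (γ 1 1 : ℂ))) ∧
    ∀ (τ : ℍ) (i : Fin 3), theta i ((γ • τ : ℍ) : ℂ) = J τ * M.mulVec (fun j => theta j τ) i
  parity : ∀ i j, M i j ≠ 0 → ∀ m n : ℤ,
    Odd (parityForm i (γ 0 0 * m + γ 0 1 * n) (γ 1 0 * m + γ 1 1 * n)) → Odd (parityForm j m n)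
  quantum : ∃ (E : Set ℝ) (h : Fin 3 → ℝ → ℂ), E.Finite ∧ (∀ i, AnalyticOnNhd ℝ (h i) Eᶜ) ∧
    ∀ x : ℚ, (x : ℝ) ∉ E → (γ 1 0 : ℚ) * x + (γ 1 1 : ℚ) ≠ 0 → ∀ i, mobius γ x ∈ domain i →
      (autFactor (3 / 2) γ x)⁻¹ * phi (mobius γ x) i - M.mulVec (phi x) i = h i (x : ℝ)

/-- Determinant one keeps numerator and denominator coprime, so the parity criterion applies to the
unreduced formula for γx. -/
lemma IsMultiplier.mem_domain {γ : SL(2, ℤ)} {M : Matrix (Fin 3) (Fin 3) ℂ} (hM : IsMultiplier γ M)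
    {x : ℚ} (hx : (γ 1 0 : ℚ) * x + (γ 1 1 : ℚ) ≠ 0) {i j : Fin 3} (hi : mobius γ x ∈ domain i)
    (hij : M i j ≠ 0) : x ∈ domain j := by
  have hd : (x.den : ℚ) ≠ 0 := by exact_mod_cast x.den_nz
  have hxd : (x.den : ℚ) * x = x.num := den_mul_self_rat x
  have h1 : mobius γ x = ((γ 0 0 * x.num + γ 0 1 * x.den : ℤ) : ℚ) /
      ((γ 1 0 * x.num + γ 1 1 * x.den : ℤ) : ℚ) := by
    rw [mobius, ← mul_div_mul_left _ _ hd]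
    push_cast
    rw [← hxd]
    congr 1 <;> ring
  have h2 : γ 1 0 * x.num + γ 1 1 * x.den ≠ 0 := by
    intro h
    have h3 : (γ 1 0 : ℚ) * x.num + γ 1 1 * x.den = 0 := by exact_mod_cast h
    refine hx ((mul_eq_zero.1 (?_ : (x.den : ℚ) * _ = 0)).resolve_left hd)
    linear_combination h3 + (γ 1 0 : ℚ) * hxd
  have h4 : IsCoprime (γ 0 0 * x.num + γ 0 1 * x.den) (γ 1 0 * x.num + γ 1 1 * x.den) := by
    obtain ⟨u, v, huv⟩ := isCoprime_num_den x
    refine ⟨u * γ 1 1 - v * γ 1 0, v * γ 0 0 - u * γ 0 1, ?_⟩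
    linear_combination huv + (u * x.num + v * x.den) * det_eq γ
  rw [h1, mem_domain_div i h4 h2] at hi
  exact (mem_domain_iff_parityForm j x).2 (hM.parity i j hij _ _ hi)

lemma isMultiplier_one : IsMultiplier 1 1 where
  isUnit_det := by simp
  automorphy := ⟨fun _ => 1, 1, continuous_const, norm_one, fun τ => by simp, fun τ i => by simp⟩
  parity i j hij m n h := by
    have : i = j := by
      by_contra hne
      exact hij (Matrix.one_apply_ne hne)
    subst this
    simpa using h
  quantum := by
    refine ⟨∅, fun _ _ => 0, Set.finite_empty, fun i => analyticOnNhd_const, fun x _ _ i _ => ?_⟩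
    rw [autFactor_of_eq_zero (by simp)]
    simp [mobius]

lemma isUnit_det_matT : IsUnit matT.det := by
  rw [isUnit_iff_ne_zero, matT, Matrix.det_fin_three]
  simpa using ⟨zeta_ne_zero 12, zeta_ne_zero 24⟩

lemma isUnit_det_matS : IsUnit matS.det := by
  rw [isUnit_iff_ne_zero, matS, Matrix.det_fin_three]
  simp

lemma exists_of_mul_apply_ne_zero {A B : Matrix (Fin 3) (Fin 3) ℂ} {i j : Fin 3}
    (h : (A * B) i j ≠ 0) : ∃ k, A i k ≠ 0 ∧ B k j ≠ 0 := by
  rw [Matrix.mul_apply] at h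
  obtain ⟨k, -, hk⟩ := Finset.exists_ne_zero_of_sum_ne_zero h
  exact ⟨k, left_ne_zero_of_mul hk, right_ne_zero_of_mul hk⟩

lemma matT_apply_ne_zero {i j : Fin 3} (h : matT i j ≠ 0) : j = ![0, 2, 1] i := by
  fin_cases i <;> fin_cases j <;> first | rfl | exact absurd rfl h

lemma odd_add_two_mul {p q : ℤ} (h : Odd (p + q + q)) : Odd p := by
  rw [add_assoc, Int.odd_add] at h
  exact h.2 (by simp)

-- Translation has no error term of its own: the new error is `matT` applied to the old one, and the
-- factor of automorphy is unchanged because the bottom row is.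
open UpperHalfPlane in
lemma IsMultiplier.T_mul {γ : SL(2, ℤ)} {M : Matrix (Fin 3) (Fin 3) ℂ} (hM : IsMultiplier γ M) :
    IsMultiplier (ModularGroup.T * γ) (matT * M) := by
  obtain ⟨h00, h01, h10, h11⟩ := T_mul_apply γ
  refine ⟨?_, ?_, ?_, ?_⟩
  · rw [Matrix.det_mul]
    exact isUnit_det_matT.mul hM.isUnit_det
  · obtain ⟨J, ε, hJ, hε, hsq, hθ⟩ := hM.automorphy
    refine ⟨J, ε, hJ, hε, fun τ => by rw [hsq, h10, h11], fun τ i => ?_⟩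
    have h1 : ((ModularGroup.T * γ) • τ : ℍ) = ((γ • τ : ℍ) : ℂ) + 1 := by
      rw [mul_smul, modular_T_smul, coe_vadd, add_comm]
      push_cast
      rfl
    have h2 : (fun j => theta j ((γ • τ : ℍ) : ℂ)) = J τ • M.mulVec (fun j => theta j τ) :=
      funext fun j => hθ τ j
    rw [h1, theta_add_one, h2, Matrix.mulVec_smul, Matrix.mulVec_mulVec, Pi.smul_apply, smul_eq_mul]
  · intro i j hij m n h
    obtain ⟨k, hik, hkj⟩ := exists_of_mul_apply_ne_zero hij
    refine hM.parity k j hkj m n ?_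
    rw [matT_apply_ne_zero hik]
    rw [h00, h01, h10, h11] at h
    have e : (γ 0 0 + γ 1 0) * m + (γ 0 1 + γ 1 1) * n
        = (γ 0 0 * m + γ 0 1 * n) + (γ 1 0 * m + γ 1 1 * n) := by ring
    rw [e] at h
    fin_cases i
    · exact h
    · exact h
    · exact odd_add_two_mul h
  · obtain ⟨E, h, hE, han, heq⟩ := hM.quantum
    refine ⟨E, fun i r => ∑ j, matT i j * h j r, hE, fun i => ?_, fun x hxE hx i hi => ?_⟩
    · exact Finset.analyticOnNhd_fun_sum _ fun j _ => analyticOnNhd_const.mul (han j)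
    · rw [h10, h11] at hx
      have hmob : mobius (ModularGroup.T * γ) x = mobius γ x + 1 := by
        rw [mobius, mobius, h00, h01, h10, h11, div_add_one hx]
        push_cast
        congr 1
        ring
      have haut : autFactor (3 / 2) (ModularGroup.T * γ) x = autFactor (3 / 2) γ x := by
        rw [autFactor, autFactor, h10, h11]
      rw [hmob] at hi ⊢
      obtain ⟨hdom, hlaw⟩ := translation_law (mobius γ x) i hi
      rw [Pi.sub_apply, sub_eq_zero] at hlaw
      rw [haut, hlaw, ← Matrix.mulVec_mulVec, Matrix.mulVec, Matrix.mulVec, dotProduct, dotProduct,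
        Finset.mul_sum, ← Finset.sum_sub_distrib]
      refine Finset.sum_congr rfl fun j _ => ?_
      rcases eq_or_ne (matT i j) 0 with h0 | h0
      · simp [h0]
      · rw [← heq x hxE hx j (hdom j h0)]
        ring

lemma finite_setOf_linear_eq_zero {c d : ℤ} (h : c ≠ 0 ∨ d ≠ 0) :
    {r : ℝ | (c : ℝ) * r + d = 0}.Finite := by
  rcases eq_or_ne c 0 with rfl | hc
  · have hd : (d : ℝ) ≠ 0 := by
      have : d ≠ 0 := by simpa using h
      exact_mod_cast this
    refine Set.finite_empty.subset fun r hr => hd ?_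
    simpa using hr
  · have hc' : (c : ℝ) ≠ 0 := by exact_mod_cast hc
    refine (Set.finite_singleton (-d / c : ℝ)).subset fun r hr => ?_
    have hr' : (c : ℝ) * r + d = 0 := hr
    rw [Set.mem_singleton_iff, eq_div_iff hc']
    linarith

lemma analyticAt_imagPow {u : ℝ} (hu : u ≠ 0) : AnalyticAt ℝ imagPow u := by
  have h1 : AnalyticAt ℂ (fun z : ℂ => (I * z) ^ ((3 / 2 : ℝ) : ℂ)) (u : ℂ) := by
    refine AnalyticAt.cpow (by fun_prop) (by fun_prop) (Or.inr ?_)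
    simpa using hu
  exact (h1.restrictScalars (𝕜 := ℝ)).comp_of_eq (Complex.ofRealCLM.analyticAt u) rfl

/-- The factor of automorphy of weight `3/2` as a function on the real line. -/
def autFactorReal (γ : SL(2, ℤ)) (r : ℝ) : ℂ :=
  if γ 1 0 = 0 then 1 else imagPow ((γ 1 0).sign * (γ 1 0 * r + γ 1 1))

lemma autFactor_eq_real (γ : SL(2, ℤ)) (x : ℚ) : autFactor (3 / 2) γ x = autFactorReal γ x := by
  by_cases h : γ 1 0 = 0
  · rw [autFactor_of_eq_zero h, autFactorReal, if_pos h]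
  · rw [autFactor_of_ne_zero h, autFactorReal, if_neg h]

lemma autFactorReal_ne_zero (γ : SL(2, ℤ)) {r : ℝ} (hr : (γ 1 0 : ℝ) * r + γ 1 1 ≠ 0) :
    autFactorReal γ r ≠ 0 := by
  rw [autFactorReal]
  split_ifs with h
  · exact one_ne_zero
  · refine imagPow_ne_zero (mul_ne_zero ?_ hr)
    exact_mod_cast (by simpa using h : (γ 1 0).sign ≠ 0)

lemma analyticAt_autFactorReal (γ : SL(2, ℤ)) {r : ℝ} (hr : (γ 1 0 : ℝ) * r + γ 1 1 ≠ 0) :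
    AnalyticAt ℝ (autFactorReal γ) r := by
  by_cases h : γ 1 0 = 0
  · rw [show autFactorReal γ = fun _ => 1 from funext fun r => if_pos h]
    exact analyticAt_const
  · rw [show autFactorReal γ = fun r => imagPow ((γ 1 0).sign * (γ 1 0 * r + γ 1 1)) from
      funext fun r => if_neg h]
    refine (analyticAt_imagPow (mul_ne_zero ?_ hr)).comp_of_eq
      (f := fun r : ℝ => ((γ 1 0).sign : ℝ) * (γ 1 0 * r + γ 1 1)) (by fun_prop) rfl
    exact_mod_cast (by simpa using h : (γ 1 0).sign ≠ 0)

lemma inversion_law_imagPow {y : ℚ} (hy : y ≠ 0) {i : Fin 3} (hi : -1 / y ∈ domain i) :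
    phi (-1 / y) i = imagPow y * ∑ j, matS i j * (g (y : ℝ) j - phi y j) := by
  obtain ⟨-, h⟩ := inversion_law y hy i hi
  have h1 : (y : ℂ) / (-I) = I * ((y : ℝ) : ℂ) := by
    rw [div_neg, div_I]
    push_cast
    ring
  have h2 : ((y : ℂ) / (-I)) ^ (-(3 / 2) : ℂ) = (imagPow y)⁻¹ := by
    rw [h1, Complex.cpow_neg, imagPow]
    push_cast
    rfl
  have h3 : imagPow y ≠ 0 := imagPow_ne_zero (by exact_mod_cast hy)
  rw [Pi.add_apply, Pi.smul_apply, smul_eq_mul, h2, ← eq_sub_iff_add_eq, Matrix.mulVec,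
    Matrix.mulVec, dotProduct, dotProduct, ← Finset.sum_sub_distrib, inv_mul_eq_iff_eq_mul₀ h3] at h
  rw [h]
  congr 1
  refine Finset.sum_congr rfl fun j _ => ?_
  ring

lemma continuous_smul_upperHalfPlane (γ : SL(2, ℤ)) :
    Continuous fun τ : UpperHalfPlane => γ • τ :=
  continuous_const_smul (γ : GL (Fin 2) ℝ)

lemma coe_smul_mul (γ : SL(2, ℤ)) (τ : UpperHalfPlane) :
    ((γ • τ : UpperHalfPlane) : ℂ) * ((γ 1 0 : ℂ) * τ + (γ 1 1 : ℂ))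
      = (γ 0 0 : ℂ) * τ + (γ 0 1 : ℂ) := by
  have h := UpperHalfPlane.denom_ne_zero (γ : GL (Fin 2) ℝ) τ
  rw [ModularGroup.denom_apply] at h
  rw [UpperHalfPlane.coe_specialLinearGroup_apply]
  simp only [algebraMap_int_eq, eq_intCast, ofReal_intCast]
  rw [div_mul_cancel₀ _ h]

lemma linear_ne_zero (γ : SL(2, ℤ)) (τ : UpperHalfPlane) :
    (γ 1 0 : ℂ) * τ + (γ 1 1 : ℂ) ≠ 0 := by
  have h := UpperHalfPlane.denom_ne_zero (γ : GL (Fin 2) ℝ) τ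
  rwa [ModularGroup.denom_apply] at h

-- The inversion law at y = γx adds the period integral at γx, divided by the factor of automorphy
-- of γ, to the error. It introduces singularities only where γx is ∞ or 0, two further finite sets.
-- The scalar -κ⁻¹ combines the minus sign of the inversion law with the phase of the factor of
-- automorphy.
open UpperHalfPlane in
lemma IsMultiplier.S_mul {γ : SL(2, ℤ)} {M : Matrix (Fin 3) (Fin 3) ℂ} (hM : IsMultiplier γ M)
    {κ : ℂ} (hκ : ‖κ‖ = 1)
    (haut : ∀ x : ℚ, (γ 1 0 : ℚ) * x + γ 1 1 ≠ 0 → (γ 0 0 : ℚ) * x + γ 0 1 ≠ 0 →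
      autFactor (3 / 2) (ModularGroup.S * γ) x
        = κ * (imagPow (mobius γ x : ℚ) * autFactor (3 / 2) γ x)) :
    IsMultiplier (ModularGroup.S * γ) ((-κ⁻¹) • (matS * M)) := by
  obtain ⟨h00, h01, h10, h11⟩ := S_mul_apply γ
  have hκ0 : κ ≠ 0 := norm_ne_zero_iff.1 (by rw [hκ]; exact one_ne_zero)
  have hκ' : -κ⁻¹ ≠ 0 := neg_ne_zero.2 (inv_ne_zero hκ0)
  refine ⟨?_, ?_, ?_, ?_⟩
  · rw [Matrix.det_smul, Matrix.det_mul]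
    exact ((isUnit_iff_ne_zero.2 hκ').pow _).mul (isUnit_det_matS.mul hM.isUnit_det)
  · obtain ⟨J, ε, hJ, hε, hsq, hθ⟩ := hM.automorphy
    refine ⟨fun τ => -κ * (halfRoot ((γ • τ : ℍ) : ℂ) * J τ), -Complex.I * κ ^ 2 * ε, ?_, ?_,
      fun τ => ?_,
      fun τ i => ?_⟩
    · refine continuous_const.mul (Continuous.mul ?_ hJ)
      rw [continuous_iff_continuousAt]
      intro τ
      exact ContinuousAt.comp (g := halfRoot) (continuousAt_halfRoot (γ • τ).im_pos)
        (UpperHalfPlane.continuous_coe.comp (continuous_smul_upperHalfPlane γ)).continuousAt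
    · rw [norm_mul, norm_mul, norm_pow, norm_neg, norm_I, hκ, hε]
      norm_num
    · rw [mul_pow, mul_pow, hsq, halfRoot_sq (γ • τ).im_pos, h10, h11, ← coe_smul_mul γ τ]
      ring
    · have h1 : ((ModularGroup.S * γ) • τ : ℍ) = -1 / ((γ • τ : ℍ) : ℂ) := by
        rw [mul_smul, modular_S_smul]
        change (-((γ • τ : ℍ) : ℂ))⁻¹ = _
        rw [inv_neg, neg_div, one_div]
      have h2 : (fun j => theta j ((γ • τ : ℍ) : ℂ)) = J τ • M.mulVec (fun j => theta j τ) :=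
        funext fun j => hθ τ j
      rw [h1, theta_neg_one_div i (γ • τ).im_pos, h2, Matrix.mulVec_smul, Matrix.mulVec_mulVec,
        Matrix.smul_mulVec, Pi.smul_apply, Pi.smul_apply, smul_eq_mul, smul_eq_mul]
      field_simp
  · intro i j hij m n h
    have hij' : (matS * M) i j ≠ 0 := by
      rw [Matrix.smul_apply, smul_eq_mul] at hij
      exact right_ne_zero_of_mul hij
    obtain ⟨k, hik, hkj⟩ := exists_of_mul_apply_ne_zero hij'
    refine hM.parity k j hkj m n ?_
    rw [matS_apply_ne_zero hik]
    rw [h00, h01, h10, h11] at h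
    have e : -γ 1 0 * m + -γ 1 1 * n = -(γ 1 0 * m + γ 1 1 * n) := by ring
    rw [e] at h
    generalize γ 0 0 * m + γ 0 1 * n = p at h ⊢
    generalize γ 1 0 * m + γ 1 1 * n = q at h ⊢
    fin_cases i
    · exact h
    · exact odd_neg.1 h
    · change Odd (-q + p) at h
      change Odd (p + q)
      rw [Int.odd_add', even_neg] at h
      rwa [Int.odd_add]
  · obtain ⟨E, h, hE, han, heq⟩ := hM.quantum
    have hdet := det_eq γ
    have hcd : γ 1 0 ≠ 0 ∨ γ 1 1 ≠ 0 := by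
      by_contra! hcon
      rw [hcon.1, hcon.2] at hdet
      simp at hdet
    have hab : γ 0 0 ≠ 0 ∨ γ 0 1 ≠ 0 := by
      by_contra! hcon
      rw [hcon.1, hcon.2] at hdet
      simp at hdet
    refine ⟨E ∪ ({r : ℝ | (γ 1 0 : ℝ) * r + γ 1 1 = 0} ∪ {r : ℝ | (γ 0 0 : ℝ) * r + γ 0 1 = 0}),
      fun i r => ∑ j, κ⁻¹ * matS i j * ((autFactorReal γ r)⁻¹ *
        g (((γ 0 0 : ℝ) * r + γ 0 1) / ((γ 1 0 : ℝ) * r + γ 1 1)) j - h j r),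
      hE.union ((finite_setOf_linear_eq_zero hcd).union (finite_setOf_linear_eq_zero hab)),
      fun i => ?_, fun x hxE hx i hi => ?_⟩
    · intro r hr
      simp only [Set.mem_compl_iff, Set.mem_union, not_or] at hr
      obtain ⟨hrE, hr1, hr2⟩ := hr
      have hr1' : (γ 1 0 : ℝ) * r + γ 1 1 ≠ 0 := hr1
      have hr2' : (γ 0 0 : ℝ) * r + γ 0 1 ≠ 0 := hr2
      refine Finset.analyticAt_fun_sum _ fun j _ => analyticAt_const.mul (AnalyticAt.sub ?_
        (han j r hrE))
      refine ((analyticAt_autFactorReal γ hr1').inv (autFactorReal_ne_zero γ hr1')).mul ?_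
      refine AnalyticAt.comp_of_eq (g := fun y => g y j) (f := fun r : ℝ =>
        ((γ 0 0 : ℝ) * r + γ 0 1) / ((γ 1 0 : ℝ) * r + γ 1 1))
        (analyticOnNhd_g j _ (div_ne_zero hr2' hr1')) ?_ rfl
      exact AnalyticAt.div (by fun_prop) (by fun_prop) hr1'
    · simp only [Set.mem_union, not_or] at hxE
      obtain ⟨hxE, hx1, hx2⟩ := hxE
      have hx1' : (γ 1 0 : ℝ) * x + γ 1 1 ≠ 0 := hx1
      have hx2' : (γ 0 0 : ℝ) * x + γ 0 1 ≠ 0 := hx2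
      have hq1 : (γ 1 0 : ℚ) * x + γ 1 1 ≠ 0 := by exact_mod_cast hx1'
      have hq2 : (γ 0 0 : ℚ) * x + γ 0 1 ≠ 0 := by exact_mod_cast hx2'
      have hy : mobius γ x ≠ 0 := div_ne_zero hq2 hq1
      have hmob : mobius (ModularGroup.S * γ) x = -1 / mobius γ x := by
        rw [mobius, mobius, h00, h01, h10, h11, div_div_eq_mul_div]
        push_cast
        congr 1
        ring
      have hyR : ((mobius γ x : ℚ) : ℝ)
          = ((γ 0 0 : ℝ) * x + γ 0 1) / ((γ 1 0 : ℝ) * x + γ 1 1) := by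
        rw [mobius]
        push_cast
        rfl
      rw [hmob] at hi ⊢
      have hP0 : imagPow (mobius γ x : ℚ) ≠ 0 := imagPow_ne_zero (by exact_mod_cast hy)
      beta_reduce
      rw [← hyR, ← autFactor_eq_real, inversion_law_imagPow hy hi, haut x hq1 hq2, mul_inv, mul_inv,
        Matrix.smul_mulVec, Pi.smul_apply, smul_eq_mul, ← Matrix.mulVec_mulVec, Matrix.mulVec,
        dotProduct]
      rw [show ∀ a b d s : ℂ, κ⁻¹ * (a⁻¹ * b⁻¹) * (a * s) - -κ⁻¹ * d
        = κ⁻¹ * (a⁻¹ * a) * (b⁻¹ * s) + κ⁻¹ * d by intros; ring, inv_mul_cancel₀ hP0, mul_one,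
        ← mul_add, Finset.mul_sum, ← Finset.sum_add_distrib, Finset.mul_sum]
      have hdom := (inversion_law (mobius γ x) hy i hi).1
      refine Finset.sum_congr rfl fun j _ => ?_
      rcases eq_or_ne (matS i j) 0 with h0 | h0
      · simp [h0]
      · rw [← heq x hxE hq1 j (hdom j h0)]
        ring

lemma exists_isMultiplier (γ : SL(2, ℤ)) : ∃ M, IsMultiplier γ M := by
  have hS : ∀ γ : SL(2, ℤ), (∃ M, IsMultiplier γ M) → ∃ M, IsMultiplier (ModularGroup.S * γ) M := by
    rintro γ ⟨M, hM⟩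
    obtain ⟨κ, hκ, -, haut⟩ := exists_autFactor_S_mul γ
    exact ⟨_, hM.S_mul hκ haut⟩
  have hT : ∀ γ : SL(2, ℤ), (∃ M, IsMultiplier γ M) → ∃ M, IsMultiplier (ModularGroup.T * γ) M := by
    rintro γ ⟨M, hM⟩
    exact ⟨_, hM.T_mul⟩
  have hSinv : ModularGroup.S⁻¹ = ModularGroup.S * ModularGroup.S * ModularGroup.S := by decide
  -- Both inverses are positive words in S and T, so induction over the generators needs no separate
  -- argument for inverses.
  have hTinv : ModularGroup.T⁻¹ = ModularGroup.S * ModularGroup.S * ModularGroup.S *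
      ModularGroup.T * ModularGroup.S * ModularGroup.T * ModularGroup.S := by decide
  have hγ : γ ∈ Subgroup.closure {ModularGroup.S, ModularGroup.T} := by
    rw [SpecialLinearGroup.SL2Z_generators]
    trivial
  induction hγ using Subgroup.closure_induction_left with
  | one => exact ⟨1, isMultiplier_one⟩
  | mul_left x hx y _ ih =>
    rcases hx with rfl | rfl
    · exact hS y ih
    · exact hT y ih
  | inv_mul_cancel x hx y _ ih =>
    rcases hx with rfl | rfl
    · rw [hSinv]
      simp only [mul_assoc]
      exact hS _ (hS _ (hS _ ih))
    · rw [hTinv]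
      simp only [mul_assoc]
      exact hS _ (hS _ (hS _ (hT _ (hS _ (hT _ (hS _ ih))))))

lemma isMultiplier_T : IsMultiplier ModularGroup.T matT := by
  simpa using isMultiplier_one.T_mul

lemma isMultiplier_S : IsMultiplier ModularGroup.S (-matS) := by
  obtain ⟨κ, hκ, hone, haut⟩ := exists_autFactor_S_mul 1
  have h := isMultiplier_one.S_mul hκ haut
  rw [hone (by simp)] at h
  simpa using h

lemma linear_mul (γ₁ γ₂ : SL(2, ℤ)) (τ : UpperHalfPlane) :
    ((γ₁ * γ₂) 1 0 : ℂ) * τ + ((γ₁ * γ₂) 1 1 : ℂ)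
      = ((γ₁ 1 0 : ℂ) * (γ₂ • τ : UpperHalfPlane) + (γ₁ 1 1 : ℂ)) *
        ((γ₂ 1 0 : ℂ) * τ + (γ₂ 1 1 : ℂ)) := by
  have h := coe_smul_mul γ₂ τ
  have h0 : (γ₁ * γ₂) 1 0 = γ₁ 1 0 * γ₂ 0 0 + γ₁ 1 1 * γ₂ 1 0 := by
    simp [Matrix.SpecialLinearGroup.coe_mul, Matrix.mul_apply, Fin.sum_univ_two]
  have h1 : (γ₁ * γ₂) 1 1 = γ₁ 1 0 * γ₂ 0 1 + γ₁ 1 1 * γ₂ 1 1 := by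
    simp [Matrix.SpecialLinearGroup.coe_mul, Matrix.mul_apply, Fin.sum_univ_two]
  rw [h0, h1]
  push_cast
  linear_combination -(γ₁ 1 0 : ℂ) * h

/-- Multipliers are multiplicative up to constants of modulus one. -/
lemma IsMultiplier.exists_eq_smul_mul {γ₁ γ₂ : SL(2, ℤ)} {M₁ M₂ M₃ : Matrix (Fin 3) (Fin 3) ℂ}
    (h₁ : IsMultiplier γ₁ M₁) (h₂ : IsMultiplier γ₂ M₂) (h₃ : IsMultiplier (γ₁ * γ₂) M₃) :
    ∃ c : ℂ, ‖c‖ = 1 ∧ M₃ = c • (M₁ * M₂) := by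
  obtain ⟨J₁, ε₁, hJ₁, hε₁, hsq₁, hθ₁⟩ := h₁.automorphy
  obtain ⟨J₂, ε₂, hJ₂, hε₂, hsq₂, hθ₂⟩ := h₂.automorphy
  obtain ⟨J₃, ε₃, hJ₃, hε₃, hsq₃, hθ₃⟩ := h₃.automorphy
  have hne : ∀ {ε : ℂ}, ‖ε‖ = 1 → ε ≠ 0 := fun h => norm_ne_zero_iff.1 (h ▸ one_ne_zero)
  -- With δ² = ε₁ε₂/ε₃ the functions J₁(γ₂τ)J₂(τ) and δJ₃(τ) have equal squares, by the cocycle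
  -- relation for cτ + d.
  obtain ⟨δ, hδ⟩ := IsAlgClosed.exists_pow_nat_eq (ε₁ * ε₂ / ε₃) (n := 2) two_pos
  have hδn : ‖δ‖ = 1 := by
    have h : ‖δ‖ ^ 2 = 1 := by
      rw [← norm_pow, hδ, norm_div, norm_mul, hε₁, hε₂, hε₃]
      norm_num
    exact (pow_eq_one_iff_of_nonneg (norm_nonneg _) two_ne_zero).1 h
  have hJ₃0 : ∀ τ, J₃ τ ≠ 0 := fun τ h0 => by
    have h := hsq₃ τ
    rw [h0, zero_pow two_ne_zero] at h
    exact mul_ne_zero (hne hε₃) (linear_ne_zero (γ₁ * γ₂) τ) h.symm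
  have hsq : ∀ τ, (J₁ (γ₂ • τ) * J₂ τ) ^ 2 = (δ * J₃ τ) ^ 2 := fun τ => by
    rw [mul_pow, mul_pow, hsq₁, hsq₂, hsq₃, hδ, linear_mul]
    have := hne hε₃
    field_simp
  -- Two continuous functions with equal squares, one of them without zeros, agree up to one global
  -- sign on the connected upper half plane.
  have hpm := isPreconnected_univ.eq_or_eq_neg_of_sq_eq
    (f := fun τ => J₁ (γ₂ • τ) * J₂ τ) (g := fun τ => δ * J₃ τ)
    ((hJ₁.comp (continuous_smul_upperHalfPlane γ₂)).mul hJ₂).continuousOn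
    (continuous_const.mul hJ₃).continuousOn (fun τ _ => hsq τ)
    (fun _ => mul_ne_zero (hne hδn) (hJ₃0 _))
  obtain ⟨c, hc, hcJ⟩ : ∃ c : ℂ, ‖c‖ = 1 ∧ ∀ τ, J₁ (γ₂ • τ) * J₂ τ = c * J₃ τ := by
    rcases hpm with h | h
    · exact ⟨δ, hδn, fun τ => h (Set.mem_univ τ)⟩
    · exact ⟨-δ, by rwa [norm_neg], fun τ => by simpa using h (Set.mem_univ τ)⟩
  refine ⟨c, hc, ?_⟩
  rw [← sub_eq_zero]
  ext i j
  -- Both matrices send the vector of thetas to the same vector; linear independence makes their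
  -- rows equal.
  refine congrFun (eq_zero_of_theta_relation (v := fun j => (M₃ - c • (M₁ * M₂)) i j)
    fun z hz => ?_) j
  set τ : UpperHalfPlane := ⟨z, hz⟩
  change (M₃ - c • (M₁ * M₂)).mulVec (fun j => theta j (τ : ℂ)) i = 0
  have h2 : (fun j => theta j ((γ₂ • τ : UpperHalfPlane) : ℂ))
      = J₂ τ • M₂.mulVec (fun j => theta j τ) := funext fun j => hθ₂ τ j
  have h3 := hθ₃ τ i
  rw [mul_smul, hθ₁, h2, Matrix.mulVec_smul, Matrix.mulVec_mulVec, Pi.smul_apply, smul_eq_mul,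
    ← mul_assoc, hcJ, mul_comm c, mul_assoc] at h3
  have h4 := mul_left_cancel₀ (hJ₃0 τ) h3
  rw [Matrix.sub_mulVec, Matrix.smul_mulVec, Pi.sub_apply, Pi.smul_apply, smul_eq_mul, h4, sub_self]

/-- Analyticity is required only off the finite set E. On E the error function is redefined as the
discrepancy itself, so the law also holds at the rationals in E. -/
lemma IsMultiplier.exists_quantum {γ : SL(2, ℤ)} {M : Matrix (Fin 3) (Fin 3) ℂ}
    (hM : IsMultiplier γ M) : ∃ (E : Set ℝ) (h : Fin 3 → ℝ → ℂ), E.Finite ∧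
      (∀ i, AnalyticOnNhd ℝ (h i) Eᶜ) ∧
      ∀ x : ℚ, (γ 1 0 : ℚ) * x + (γ 1 1 : ℚ) ≠ 0 → ∀ i, mobius γ x ∈ domain i →
        (∀ j, M i j ≠ 0 → x ∈ domain j) ∧
        (autFactor (3 / 2) γ x)⁻¹ * phi (mobius γ x) i - M.mulVec (phi x) i = h i (x : ℝ) := by
  classical
  obtain ⟨E, h, hE, han, heq⟩ := hM.quantum
  let F : Fin 3 → ℚ → ℂ := fun i x =>
    (autFactor (3 / 2) γ x)⁻¹ * phi (mobius γ x) i - M.mulVec (phi x) i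
  refine ⟨E, fun i r => if r ∈ E then F i (Function.invFun (fun x : ℚ => (x : ℝ)) r) else h i r, hE,
    fun i r hr => (han i r hr).congr ?_, fun x hx i hi =>
    ⟨fun j hij => hM.mem_domain hx hi hij, ?_⟩⟩
  · filter_upwards [hE.isClosed.isOpen_compl.mem_nhds hr] with s hs
    exact (if_neg hs).symm
  · beta_reduce
    by_cases hxE : (x : ℝ) ∈ E
    · rw [if_pos hxE, Function.leftInverse_invFun Rat.cast_injective x]
    · rw [if_neg hxE, heq x hxE hx i hi]

lemma exists_isVectorQuantumModularForm : ∃ ρ : SL(2, ℤ) → Matrix (Fin 3) (Fin 3) ℂ,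
    ρ ModularGroup.T = matT ∧ ρ ModularGroup.S = -matS ∧
      IsVectorQuantumModularForm (3 / 2) ρ domain phi := by
  classical
  have hST : ModularGroup.S ≠ ModularGroup.T := by decide
  choose N hN using exists_isMultiplier
  -- The multipliers chosen away from S and T are arbitrary: multiplicativity up to phases holds for
  -- every choice.
  let ρ : SL(2, ℤ) → Matrix (Fin 3) (Fin 3) ℂ := fun γ =>
    if γ = ModularGroup.T then matT else if γ = ModularGroup.S then -matS else N γ
  have hρ : ∀ γ, IsMultiplier γ (ρ γ) := fun γ => by
    by_cases hT : γ = ModularGroup.T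
    · simpa [ρ, hT] using isMultiplier_T
    · by_cases hS : γ = ModularGroup.S
      · simpa [ρ, hS, hST] using isMultiplier_S
      · simpa [ρ, hT, hS] using hN γ
  exact ⟨ρ, if_pos rfl, (if_neg hST).trans (if_pos rfl), fun γ => (hρ γ).isUnit_det,
    fun γ₁ γ₂ => (hρ γ₁).exists_eq_smul_mul (hρ γ₂) (hρ _), fun γ => (hρ γ).exists_quantum⟩

end Strange

end

theorem mainTheorem8 :
    -- where the strange series are defined; there they converge
    ((∀ x : ℚ, x ∈ Strange.domain 0 ↔ Odd x.den) ∧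
      (∀ x : ℚ, x ∈ Strange.domain 1 ↔ Odd x.num) ∧
      (∀ x : ℚ, x ∈ Strange.domain 2 ↔ Even (x.num * x.den)) ∧
      ∀ i, ∀ x ∈ Strange.domain i, Summable fun n => Strange.strangeTerm i n (x : ℂ)) ∧
    -- (1) reflection: the series `Gᵢ` converge in the unit disc, and agree with the strange series
    -- at `q⁻¹` for the roots of unity `q` at which the latter are defined
    ((∀ i, ∀ w : ℂ, ‖w‖ < 1 → (∀ n, Strange.reflDen i n w ≠ 0) ∧
        Summable fun n => Strange.reflNum i n w / Strange.reflDen i n w) ∧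
      ∀ i, ∀ x : ℚ, -x ∈ Strange.domain i →
        (∀ n, Strange.reflDen i n (Strange.reflVar i (x : ℂ)) ≠ 0) ∧
        (Summable fun n => Strange.reflNum i n (Strange.reflVar i (x : ℂ)) /
          Strange.reflDen i n (Strange.reflVar i (x : ℂ))) ∧
        Strange.phi (-x) i = Strange.G i (x : ℂ)) ∧
    -- (2) quantum modularity of weight 3/2
    (∃ ρ : Matrix.SpecialLinearGroup (Fin 2) ℤ → Matrix (Fin 3) (Fin 3) ℂ,
      ρ ModularGroup.T = Strange.matT ∧ ρ ModularGroup.S = -Strange.matS ∧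
      Strange.IsVectorQuantumModularForm (3 / 2) ρ Strange.domain Strange.phi) ∧
    -- the law for `z ↦ z + 1`
    (∀ z : ℚ, ∀ i, z + 1 ∈ Strange.domain i →
      (∀ j, Strange.matT i j ≠ 0 → z ∈ Strange.domain j) ∧
      (Strange.phi (z + 1) - Strange.matT.mulVec (Strange.phi z)) i = 0) ∧
    -- the law for `z ↦ -1 / z`
    (∀ z : ℚ, z ≠ 0 → ∀ i, -1 / z ∈ Strange.domain i →
      (∀ j, Strange.matS i j ≠ 0 → z ∈ Strange.domain j) ∧
      ((((z : ℂ) / (-Complex.I)) ^ (-(3 / 2) : ℂ)) • Strange.phi (-1 / z) +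
          Strange.matS.mulVec (Strange.phi z)) i =
        Strange.matS.mulVec (Strange.g (z : ℝ)) i) ∧
    -- the period integrals converge, and are analytic off 0; at 0 the first and the third are
    -- smooth, and the second one is a simple pole plus a smooth function
    (∀ i, ∀ x : ℝ, (x ≠ 0 ∨ i ≠ 1) →
      MeasureTheory.IntegrableOn (Strange.periodIntegrand i x) (Set.Ioi 0)) ∧
    (∀ i, AnalyticOnNhd ℝ (fun x => Strange.g x i) {0}ᶜ) ∧
    ContDiff ℝ ((⊤ : ℕ∞) : WithTop ℕ∞) (fun x => Strange.g x 0) ∧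
    ContDiff ℝ ((⊤ : ℕ∞) : WithTop ℕ∞) (fun x => Strange.g x 2) ∧
    (∃ r : ℝ → ℂ, ContDiff ℝ ((⊤ : ℕ∞) : WithTop ℕ∞) r ∧
      ∀ x : ℝ, x ≠ 0 → Strange.g x 1 = -Complex.I / (Real.pi * x) + r x) := by
  open Strange in
  exact ⟨⟨mem_domain_zero, mem_domain_one, mem_domain_two, fun i x _ => summable_strangeTerm i x⟩,
    ⟨fun i w hw => ⟨reflDen_ne_zero_of_norm_lt i hw, summable_reflTerm_of_norm_lt i hw⟩,
      fun i x hx => ⟨reflDen_ne_zero_of_mem i (neg_mem_domain i hx), summable_reflTerm i x,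
        reflection i x (neg_mem_domain i hx)⟩⟩,
    exists_isVectorQuantumModularForm, translation_law, inversion_law,
    integrableOn_periodIntegrand, analyticOnNhd_g, contDiff_g 0 (by decide),
    contDiff_g 2 (by decide), g_one_eq⟩
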